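/- Let $s\ge 2$ and $p$ be integers and let $D_i=(X_i,T_i,\Delta_i)$, $i=1,2,\dots$, be i.i.d. right-censored observations, $T_i=\min(T_i^*,C_i^*)$, $\Delta_i=1\{T_i^*\le C_i^*\}$, from the Cox regression model: given $X$, the failure time $T^*$ has hazard $\lambda_0(t)\exp(\theta_0^{T}X)$ on $[0,\tau]$. Assume: (A1) $T^*$ and $C^*$ are independent given $X$; (A2) the study ends at time $\tau>0$ (so $C^*\le\tau$), and for some $\delta_\tau>0$, $\mathbb P(\Delta=1\mid X)\ge\delta_\tau$ and $\mathbb P(T^*\ge\tau\mid X)\ge\delta_\tau$ almost surely; (A3) $X$ takes values in $[0,1]^p$ and has a density there that is bounded away from zero; (R1) $\theta_0$ lies in the interior of the ball $\mathbb R^p_M=\{\theta\in\mathbb R^p:\|\theta\|\le M\}$; (R2) the subdensity $p(x,t,\Delta=1)$ of $(X,T,\Delta=1)$ satisfies $c_1<p(x,t,\Delta=1)<c_2$ on $[0,1]^p\times[0,\tau]$ for some constants $0<c_1<c_2<\infty$; (R3) for some $k\ge 2$ and both $\delta\in\{0,1\}$, the $k$-th order partial derivatives in $(x,t)$ of the subdensity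 $p(x,t,\Delta=\delta)$ exist and are bounded on $[0,1]^p\times[0,\tau]$. (Subdensities describe the distribution on $\{T<\tau\}$; censoring at the end of the study may put an atom at $T=\tau$.) For a mini-batch $B$ of $s$ observations put $$L^{(s)}_B(\theta)=-\frac1s\sum_{i\in B}\Delta_i\log\frac{\exp(\theta^TX_i)}{\sum_{j\in B}1\{T_j\ge T_i\}\exp(\theta^TX_j)} .$$ Let $\tilde\theta_n^{SB(s)}$ be a minimizer over $\mathbb R^p_M$ of the average of $L_B^{(s)}$ over all $\binom ns$ subsets $B$ of size $s$ of the first $n$ observations. For $n=ms$, let the first $n$ observations be split, deterministically or at random but independently of the data, into $m$ disjoint batches of size $s$, and let $\tilde\theta_n^{FB(s)}$ be a minimizer over $\Theta$ of the average of $L_B^{(s)}$ over these $m$ batches, where $\Theta$ is $\mathbb R^p$ or $\mathbb R^p_M$ (an arbitrary measurable value is allowed where no minimizer exists). Let $$H_s=\mathbb E[\nabla^2_\theta L_B^{(s)}(\theta_0)],\qquad \Sigma_s=\mathbb V[\nabla_\theta L_B^{(s)}(\theta_0)],\qquad \Sigma_{(s|1)}=\mathrm{Cov}\bigl(\nabla_\theta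 L_B^{(s)}(\theta_0),\nabla_\theta L_{B'}^{(s)}(\theta_0)\bigr),$$ where $B,B'$ are mini-batches of size $s$ with exactly one common observation. Then these matrices are well defined, $H_s$ is invertible, both estimators are $\sqrt n$-consistent, and $$\sqrt n\,(\tilde\theta_n^{SB(s)}-\theta_0)\to^d N\bigl(0,\;s^2H_s^{-1}\Sigma_{(s|1)}(H_s^{-1})^T\bigr)\quad(n\to\infty),$$ $$\sqrt n\,(\tilde\theta_n^{FB(s)}-\theta_0)\to^d N\bigl(0,\;sH_s^{-1}\Sigma_s(H_s^{-1})^T\bigr)\quad(n=ms,\ m\to\infty).$$ -/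

import Mathlib

open MeasureTheory ProbabilityTheory Filter Set Topology
open scoped ENNReal RealInnerProductSpace

noncomputable section

namespace CoxSGD

/-! ### Right-censored data -/

/-- An observation `(X, T, Δ)`: covariate, observed time, event indicator. -/
abbrev Datum (p : ℕ) : Type := EuclideanSpace ℝ (Fin p) × ℝ × Bool

open Classical in
/-- The observation `(X, min (T*, C*), 1{T* ≤ C*})` of a subject with covariate `X`, failure time
`T*` and censoring time `C*`. -/
def observe {p : ℕ} {Ω : Type*} (X : Ω → EuclideanSpace ℝ (Fin p)) (Tst Cst : Ω → ℝ≥0∞) (ω : Ω) :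
    Datum p :=
  (X ω, (min (Tst ω) (Cst ω)).toReal, decide (Tst ω ≤ Cst ω))

/-! ### Partial likelihood of a mini-batch and the targets of SGD -/

/-- The negative log-partial likelihood of the mini-batch `{d i : i ∈ B}`, with the at-risk sets
built inside the mini-batch. -/
def batchLoss {p : ℕ} {ι : Type*} (B : Finset ι) (d : ι → Datum p)
    (θ : EuclideanSpace ℝ (Fin p)) : ℝ :=
  -((1 / (B.card : ℝ)) * ∑ i ∈ B, (if (d i).2.2 = true then (1 : ℝ) else 0) *
    Real.log (Real.exp ⟪θ, (d i).1⟫ /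
      ∑ j ∈ B, (if (d i).2.1 ≤ (d j).2.1 then (1 : ℝ) else 0) * Real.exp ⟪θ, (d j).1⟫))

/-- The gradient in `θ` of the mini-batch loss. -/
def batchGrad {p : ℕ} {ι : Type*} (B : Finset ι) (d : ι → Datum p)
    (θ : EuclideanSpace ℝ (Fin p)) : EuclideanSpace ℝ (Fin p) :=
  gradient (batchLoss B d) θ

/-- The Hessian matrix in `θ` of the mini-batch loss. -/
def batchHess {p : ℕ} {ι : Type*} (B : Finset ι) (d : ι → Datum p)
    (θ : EuclideanSpace ℝ (Fin p)) : Matrix (Fin p) (Fin p) ℝ :=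
  Matrix.of fun i j => (fderiv ℝ (batchGrad B d) θ (EuclideanSpace.single j 1)) i

/-- Stochastic batches: the average of the mini-batch loss over all `s`-subsets of the first `n`
observations. -/
def sbObjective {p : ℕ} (s n : ℕ) (d : ℕ → Datum p) (θ : EuclideanSpace ℝ (Fin p)) : ℝ :=
  (1 / (n.choose s : ℝ)) * ∑ B ∈ (Finset.range n).powersetCard s, batchLoss B d θ

/-- Fixed batches: the average of the mini-batch loss over the `m` mini-batches
`{d (σ b 0), …, d (σ b (s - 1))}`, `b < m`. -/
def fbObjective {p : ℕ} (s m : ℕ) (σ : Fin m → Fin s → ℕ) (d : ℕ → Datum p)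
    (θ : EuclideanSpace ℝ (Fin p)) : ℝ :=
  (1 / (m : ℝ)) * ∑ b : Fin m, batchLoss Finset.univ (fun k : Fin s => d (σ b k)) θ

/-- `σ` splits the first `m * s` indices into `m` disjoint batches of size `s`. -/
def IsSplit (s m : ℕ) (σ : Fin m → Fin s → ℕ) : Prop :=
  BijOn (fun bk : Fin m × Fin s => σ bk.1 bk.2) univ {i | i < m * s}

/-- `θ` is a minimizer of `f` over `Θ`, unless there is none. -/
def IsArgmin {p : ℕ} (f : EuclideanSpace ℝ (Fin p) → ℝ) (Θ : Set (EuclideanSpace ℝ (Fin p)))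
    (θ : EuclideanSpace ℝ (Fin p)) : Prop :=
  (∃ η ∈ Θ, IsMinOn f Θ η) → θ ∈ Θ ∧ IsMinOn f Θ θ

/-! ### The matrices `H_s`, `Σ_s`, `Σ_(s|1)`, for i.i.d. observations `D 0, D 1, …` -/

variable {p : ℕ} {Ω : Type*} [MeasurableSpace Ω]

/-- `H_s = E[∇² L^(s)(θ)]`. -/
def hessMatrix (μ : Measure Ω) (D : ℕ → Ω → Datum p) (s : ℕ) (θ : EuclideanSpace ℝ (Fin p)) :
    Matrix (Fin p) (Fin p) ℝ :=
  Matrix.of fun i j => ∫ ω, batchHess (Finset.range s) (fun k => D k ω) θ i j ∂μ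

/-- The covariance matrix of the gradients of the losses of the mini-batches `A` and `B`. -/
def gradCov (μ : Measure Ω) (D : ℕ → Ω → Datum p) (A B : Finset ℕ)
    (θ : EuclideanSpace ℝ (Fin p)) : Matrix (Fin p) (Fin p) ℝ :=
  Matrix.of fun i j => cov[fun ω => batchGrad A (fun k => D k ω) θ i,
    fun ω => batchGrad B (fun k => D k ω) θ j; μ]

/-- The first mini-batch, `{0, …, s - 1}`. -/
def batch₁ (s : ℕ) : Finset ℕ := Finset.range s

/-- A mini-batch that shares exactly the sample `0` with `{0, …, s - 1}`:
`{0, s, s + 1, …, 2 s - 2}`. -/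
def batch₂ (s : ℕ) : Finset ℕ := insert 0 (Finset.Ico s (2 * s - 1))

/-- `Σ_s = V[∇ L^(s)(θ)]`. -/
def sigmaS (μ : Measure Ω) (D : ℕ → Ω → Datum p) (s : ℕ) (θ : EuclideanSpace ℝ (Fin p)) :
    Matrix (Fin p) (Fin p) ℝ :=
  gradCov μ D (batch₁ s) (batch₁ s) θ

/-- `Σ_(s|1)`: the covariance of `∇ L^(s)(θ)` on two mini-batches that have one sample in common. -/
def sigmaS1 (μ : Measure Ω) (D : ℕ → Ω → Datum p) (s : ℕ) (θ : EuclideanSpace ℝ (Fin p)) :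
    Matrix (Fin p) (Fin p) ℝ :=
  gradCov μ D (batch₁ s) (batch₂ s) θ

/-- Asymptotic variance of the stochastic-batch estimator. -/
def sbVariance (μ : Measure Ω) (D : ℕ → Ω → Datum p) (s : ℕ) (θ : EuclideanSpace ℝ (Fin p)) :
    Matrix (Fin p) (Fin p) ℝ :=
  (s : ℝ) ^ 2 • ((hessMatrix μ D s θ)⁻¹ * sigmaS1 μ D s θ * ((hessMatrix μ D s θ)⁻¹).transpose)

/-- Asymptotic variance of the fixed-batch estimator. -/
def fbVariance (μ : Measure Ω) (D : ℕ → Ω → Datum p) (s : ℕ) (θ : EuclideanSpace ℝ (Fin p)) :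
    Matrix (Fin p) (Fin p) ℝ :=
  (s : ℝ) • ((hessMatrix μ D s θ)⁻¹ * sigmaS μ D s θ * ((hessMatrix μ D s θ)⁻¹).transpose)

/-! ### Model assumptions on one subject -/

/-- Cox regression model on the study period `[0, τ]`: given `X`, the failure time has hazard
`lam t * exp ⟪θ₀, X⟫`, that is, survival function `exp (- exp ⟪θ₀, X⟫ * ∫₀ᵗ lam)`. -/
def CoxModel (μ : Measure Ω) (τ : ℝ) (lam : ℝ → ℝ) (θ₀ : EuclideanSpace ℝ (Fin p))
    (X : Ω → EuclideanSpace ℝ (Fin p)) (Tst : Ω → ℝ≥0∞) : Prop :=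
  (∀ t ∈ Icc 0 τ, 0 ≤ lam t) ∧ IntervalIntegrable lam volume 0 τ ∧
  ∀ t ∈ Icc 0 τ,
    μ⟦{ω | ENNReal.ofReal t < Tst ω} | MeasurableSpace.comap X inferInstance⟧
      =ᵐ[μ] fun ω => Real.exp (-(Real.exp ⟪θ₀, X ω⟫ * ∫ u in (0 : ℝ)..t, lam u))

/-- `T*` and `C*` are independent given `X`. -/
def CondIndepGiven (μ : Measure Ω) (X : Ω → EuclideanSpace ℝ (Fin p)) (Tst Cst : Ω → ℝ≥0∞) :
    Prop :=
  ∀ A B : Set ℝ≥0∞, MeasurableSet A → MeasurableSet B →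
    μ⟦Tst ⁻¹' A ∩ Cst ⁻¹' B | MeasurableSpace.comap X inferInstance⟧
      =ᵐ[μ] μ⟦Tst ⁻¹' A | MeasurableSpace.comap X inferInstance⟧
        * μ⟦Cst ⁻¹' B | MeasurableSpace.comap X inferInstance⟧

/-- The study ends at `τ` (so `C* ≤ τ`), and, given `X`, both a failure being observed and
survival up to `τ` have probability at least `δ`. -/
def StudyEnd (μ : Measure Ω) (τ δ : ℝ) (X : Ω → EuclideanSpace ℝ (Fin p))
    (Tst Cst : Ω → ℝ≥0∞) : Prop :=
  (∀ᵐ ω ∂μ, Cst ω ≤ ENNReal.ofReal τ) ∧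
  (∀ᵐ ω ∂μ, δ ≤ (μ⟦{ω' | Tst ω' ≤ Cst ω'} | MeasurableSpace.comap X inferInstance⟧) ω) ∧
  (∀ᵐ ω ∂μ, δ ≤ (μ⟦{ω' | ENNReal.ofReal τ ≤ Tst ω'} |
    MeasurableSpace.comap X inferInstance⟧) ω)

/-- The unit cube `[0,1]^p`. -/
def cube (p : ℕ) : Set (EuclideanSpace ℝ (Fin p)) := {x | ∀ j, x j ∈ Icc (0 : ℝ) 1}

/-- `X` has a density on `[0,1]^p` that is bounded away from zero. -/
def CovariateDensity (μ : Measure Ω) (X : Ω → EuclideanSpace ℝ (Fin p)) : Prop :=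
  ∃ (c : ℝ) (f : EuclideanSpace ℝ (Fin p) → ℝ≥0∞), 0 < c ∧ Measurable f ∧
    (∀ x ∈ cube p, ENNReal.ofReal c ≤ f x) ∧
    μ.map X = (volume.restrict (cube p)).withDensity f

/-- The box `[0,1]^p × [0,τ]`. -/
def box (p : ℕ) (τ : ℝ) : Set (EuclideanSpace ℝ (Fin p) × ℝ) := cube p ×ˢ Icc 0 τ

/-- `q` is a subdensity of `(X, T, Δ = δ)` on `[0,1]^p × [0,τ]`. Only times before `τ` are tested:
subjects that are still under observation when the study ends are censored at `τ`, which gives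
`(T, Δ = 0)` an atom at `τ`. -/
def IsSubdensity (μ : Measure Ω) (τ : ℝ) (D : Ω → Datum p) (δ : Bool)
    (q : EuclideanSpace ℝ (Fin p) × ℝ → ℝ) : Prop :=
  Measurable q ∧ (∀ z ∈ box p τ, 0 ≤ q z) ∧
  ∀ A : Set (EuclideanSpace ℝ (Fin p) × ℝ), MeasurableSet A →
    μ {ω | ((D ω).1, (D ω).2.1) ∈ A ∧ (D ω).2.1 < τ ∧ (D ω).2.2 = δ}
      = ∫⁻ z in A ∩ box p τ, ENNReal.ofReal (q z)

/-- The coordinate directions of `ℝ^p × ℝ`. -/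
def dir (p : ℕ) : Fin p ⊕ Unit → EuclideanSpace ℝ (Fin p) × ℝ
  | Sum.inl j => (EuclideanSpace.single j 1, 0)
  | Sum.inr _ => (0, 1)

/-- Iterated partial derivatives of `q` on the set `S` (one-sided where `S` ends). -/
def iterPartial (S : Set (EuclideanSpace ℝ (Fin p) × ℝ)) (q : EuclideanSpace ℝ (Fin p) × ℝ → ℝ) :
    List (Fin p ⊕ Unit) → EuclideanSpace ℝ (Fin p) × ℝ → ℝ
  | [] => q
  | v :: l => fun z => lineDerivWithin ℝ (iterPartial S q l) S z (dir p v)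

/-- All partial derivatives of order `k` of `q` exist on `S` and are bounded there. -/
def HasBoundedPartials (k : ℕ) (S : Set (EuclideanSpace ℝ (Fin p) × ℝ))
    (q : EuclideanSpace ℝ (Fin p) × ℝ → ℝ) : Prop :=
  (∀ l : List (Fin p ⊕ Unit), l.length < k → ∀ v, ∀ z ∈ S,
    LineDifferentiableWithinAt ℝ (iterPartial S q l) S z (dir p v)) ∧
  (∀ l : List (Fin p ⊕ Unit), l.length = k → ∃ b : ℝ, ∀ z ∈ S, |iterPartial S q l z| ≤ b)

/-- `Z n` is bounded in probability as `n → ∞`. -/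
def BoundedInProbability (μ : Measure Ω) (Z : ℕ → Ω → EuclideanSpace ℝ (Fin p)) : Prop :=
  ∀ ε : ℝ, 0 < ε → ∃ K : ℝ, ∀ᶠ n in atTop, μ {ω | K < ‖Z n ω‖} ≤ ENNReal.ofReal ε

end CoxSGD

end

open CoxSGD

/-! Both objectives average convex functions of `θ`: for each observed failure, a log-sum-exp minus
a linear term. The gradient of a batch loss has a Taylor expansion at `θ₀` whose quadratic remainder
is controlled by the batch size and a bound on the covariates alone (`norm_score_taylor_le`). Hence
only the average score `G` and the average Hessian at the single point `θ₀` matter; neither a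
uniform law of large numbers nor a separate consistency proof is needed. If `G` is small and the
Hessian is close to a coercive limit `H`, convexity confines every minimizer to a small ball around
`θ₀` inside the constraint set, and there `θ - θ₀ = -H⁻¹ G` up to an error of smaller order
(`ConvexExpansion.expansion_of_isMinOn`, `tendstoInDistribution_of_expansion`).

Three facts about one mini-batch feed this argument.

The score at `θ₀` has mean zero for every batch. By the compensator identity
(`HazardModel.integral_failure`) a sum over observed failures has the expectation of a time integral
over the subjects at risk, each weighted by its hazard, proportional to `exp ⟪θ₀, X⟫`. With exactly
these weights the deviations of the covariates from the risk-set mean cancel within the batch at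
every time (`CoxLaw.integral_scoreKernel`).

The mean Hessian is positive definite. It is a mean of softmax covariances, and in any direction `v
≠ 0` two observed failures are separated with positive probability, since a covariate law with a
density charges no hyperplane (`CoxLaw.integral_inner_hessOp_pos`).

The average score is asymptotically normal. Over all batches it is a U-statistic with bounded
kernel, and the Hájek projection reduces it to an i.i.d. sum: residuals of batches sharing at most
one observation are uncorrelated, and larger overlaps are rare. The limit covariance is that of the
projection, which is `Σ_(s|1)` because two batches sharing one observation are conditionally
independent given it. Over fixed batches the scores are i.i.d. Reordering the data by an independent
random split does not change their law, so every split may be taken to consist of consecutive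
blocks.

Covariates are truncated at a radius that they almost surely do not exceed, so that all bounds hold
for every data sequence. -/

open CoxSGD

noncomputable section

namespace CoxSGD

/-! ### Softmax weights and the log-sum-exp function -/

section Softmax

variable {ι : Type*} (B : Finset ι)

/-- Exponentially tilted weights along a line. -/
def tilt (b a : ι → ℝ) (t : ℝ) (j : ι) : ℝ :=
  b j * Real.exp (t * a j) / ∑ k ∈ B, b k * Real.exp (t * a k)

variable {B} {b a : ι → ℝ}

lemma sum_mul_exp_pos (hb : ∀ j ∈ B, 0 ≤ b j) (hpos : 0 < ∑ j ∈ B, b j) (f : ι → ℝ) :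
    0 < ∑ k ∈ B, b k * Real.exp (f k) := by
  obtain ⟨i, hi, hi'⟩ := (Finset.sum_pos_iff_of_nonneg hb).1 hpos
  exact Finset.sum_pos' (fun j hj => mul_nonneg (hb j hj) (Real.exp_pos _).le)
    ⟨i, hi, mul_pos hi' (Real.exp_pos _)⟩

lemma tilt_nonneg (hb : ∀ j ∈ B, 0 ≤ b j) (t : ℝ) {j : ι} (hj : j ∈ B) : 0 ≤ tilt B b a t j :=
  div_nonneg (mul_nonneg (hb j hj) (Real.exp_pos _).le)
    (Finset.sum_nonneg fun k hk => mul_nonneg (hb k hk) (Real.exp_pos _).le)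

lemma sum_tilt (hb : ∀ j ∈ B, 0 ≤ b j) (hpos : 0 < ∑ j ∈ B, b j) (t : ℝ) :
    ∑ j ∈ B, tilt B b a t j = 1 := by
  unfold tilt
  rw [← Finset.sum_div, div_self (sum_mul_exp_pos hb hpos _).ne']

lemma tilt_le_one (hb : ∀ j ∈ B, 0 ≤ b j) (hpos : 0 < ∑ j ∈ B, b j) (t : ℝ) {j : ι}
    (hj : j ∈ B) : tilt B b a t j ≤ 1 := by
  rw [← sum_tilt (a := a) hb hpos t]
  exact Finset.single_le_sum (fun k hk => tilt_nonneg hb t hk) hj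

lemma abs_sum_tilt_mul_le (hb : ∀ j ∈ B, 0 ≤ b j) (hpos : 0 < ∑ j ∈ B, b j) (t : ℝ) {A : ℝ}
    {f : ι → ℝ} (hA : ∀ j ∈ B, |f j| ≤ A) : |∑ j ∈ B, tilt B b a t j * f j| ≤ A := by
  calc |∑ j ∈ B, tilt B b a t j * f j| ≤ ∑ j ∈ B, |tilt B b a t j * f j| :=
        Finset.abs_sum_le_sum_abs _ _
    _ ≤ ∑ j ∈ B, tilt B b a t j * A := by
        refine Finset.sum_le_sum fun j hj => ?_
        rw [abs_mul, abs_of_nonneg (tilt_nonneg hb t hj)]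
        exact mul_le_mul_of_nonneg_left (hA j hj) (tilt_nonneg hb t hj)
    _ = A := by rw [← Finset.sum_mul, sum_tilt hb hpos, one_mul]

/-- The weights form an exponential family in `t`: differentiating the normalization subtracts the
weighted mean of `a`. -/
lemma hasDerivAt_tilt (hb : ∀ j ∈ B, 0 ≤ b j) (hpos : 0 < ∑ j ∈ B, b j) (t : ℝ) (j : ι) :
    HasDerivAt (fun t => tilt B b a t j)
      (tilt B b a t j * (a j - ∑ k ∈ B, tilt B b a t k * a k)) t := by
  have hN : ∀ k, HasDerivAt (fun t => b k * Real.exp (t * a k))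
      (b k * (Real.exp (t * a k) * a k)) t := fun k => by
    have := ((hasDerivAt_id t).mul_const (a k)).exp.const_mul (b k)
    simpa using this
  have hS := (sum_mul_exp_pos (B := B) hb hpos (fun k => t * a k)).ne'
  have hsum : HasDerivAt (fun t => ∑ k ∈ B, b k * Real.exp (t * a k))
      (∑ k ∈ B, b k * (Real.exp (t * a k) * a k)) t := HasDerivAt.fun_sum fun k _ => hN k
  refine ((hN j).div hsum hS).congr_deriv ?_
  have : ∑ k ∈ B, tilt B b a t k * a k
      = (∑ k ∈ B, b k * (Real.exp (t * a k) * a k)) / ∑ k ∈ B, b k * Real.exp (t * a k) := by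
    rw [Finset.sum_div]
    refine Finset.sum_congr rfl fun k _ => ?_
    unfold tilt
    ring
  rw [this]
  unfold tilt
  field_simp

/-- Every weighted mean of quantities bounded by `A` is bounded by `A`, so the second derivative of
a weight is bounded by a multiple of `A ^ 2` whatever the base weights are. The constant is `4 + 2`:
the product rule gives one term from the weight and one from the moving mean. -/
lemma abs_tilt_taylor_le (hb : ∀ j ∈ B, 0 ≤ b j) (hpos : 0 < ∑ j ∈ B, b j) {A : ℝ}
    (hA : ∀ j ∈ B, |a j| ≤ A) {j : ι} (hj : j ∈ B) :
    |tilt B b a 1 j - tilt B b a 0 j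
      - tilt B b a 0 j * (a j - ∑ k ∈ B, tilt B b a 0 k * a k)| ≤ 6 * A ^ 2 := by
  have hA0 : 0 ≤ A := (abs_nonneg _).trans (hA j hj)
  set f : ℝ → ℝ := fun t => tilt B b a t j
  set m : ℝ → ℝ := fun t => ∑ k ∈ B, tilt B b a t k * a k
  set f' : ℝ → ℝ := fun t => tilt B b a t j * (a j - m t)
  set m' : ℝ → ℝ := fun t => ∑ k ∈ B, tilt B b a t k * (a k - m t) * a k
  have hf : ∀ t, HasDerivAt f (f' t) t := fun t => hasDerivAt_tilt hb hpos t j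
  have hm : ∀ t, HasDerivAt m (m' t) t := fun t =>
    HasDerivAt.fun_sum fun k _ => (hasDerivAt_tilt hb hpos t k).mul_const (a k)
  have hf' : ∀ t, HasDerivAt f' (f' t * (a j - m t) + tilt B b a t j * (-(m' t))) t := fun t =>
    (hf t).mul (by simpa using (hm t).const_sub (a j))
  have hmA : ∀ t, |m t| ≤ A := fun t => abs_sum_tilt_mul_le hb hpos t hA
  have hdev : ∀ t, ∀ k ∈ B, |a k - m t| ≤ 2 * A := fun t k hk => by
    have := abs_sub (a k) (m t)
    have := hA k hk; have := hmA t; linarith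
  have hm'A : ∀ t, |m' t| ≤ 2 * A ^ 2 := fun t => by
    have : m' t = ∑ k ∈ B, tilt B b a t k * ((a k - m t) * a k) :=
      Finset.sum_congr rfl fun k _ => by ring
    rw [this]
    refine abs_sum_tilt_mul_le hb hpos t fun k hk => ?_
    rw [abs_mul]
    calc |a k - m t| * |a k| ≤ (2 * A) * A :=
          mul_le_mul (hdev t k hk) (hA k hk) (abs_nonneg _) (by positivity)
      _ = 2 * A ^ 2 := by ring
  have hp0 : ∀ t, 0 ≤ tilt B b a t j := fun t => tilt_nonneg hb t hj
  have hp1 : ∀ t, tilt B b a t j ≤ 1 := fun t => tilt_le_one hb hpos t hj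
  have hf'A : ∀ t, |f' t| ≤ 2 * A := fun t => by
    simp only [f', abs_mul, abs_of_nonneg (hp0 t)]
    calc tilt B b a t j * |a j - m t| ≤ 1 * (2 * A) :=
          mul_le_mul (hp1 t) (hdev t j hj) (abs_nonneg _) zero_le_one
      _ = 2 * A := one_mul _
  have hf''A : ∀ t, |f' t * (a j - m t) + tilt B b a t j * (-(m' t))| ≤ 6 * A ^ 2 := fun t => by
    refine (abs_add_le _ _).trans ?_
    rw [abs_mul (f' t), abs_mul _ (-(m' t)), abs_of_nonneg (hp0 t), abs_neg]
    have h1 : |f' t| * |a j - m t| ≤ (2 * A) * (2 * A) :=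
      mul_le_mul (hf'A t) (hdev t j hj) (abs_nonneg _) (by positivity)
    have h2 : tilt B b a t j * |m' t| ≤ 1 * (2 * A ^ 2) :=
      mul_le_mul (hp1 t) (hm'A t) (abs_nonneg _) zero_le_one
    nlinarith
  -- Mean value theorem twice, for `f` on `[0, 1]` and for `f'` on `[0, c]`; this loses only the
  -- factor `1 / 2` of the Lagrange remainder.
  obtain ⟨c, hc, hc'⟩ := exists_hasDerivAt_eq_slope f f' (zero_lt_one (α := ℝ))
    (fun t _ => (hf t).continuousAt.continuousWithinAt) (fun t _ => hf t)
  obtain ⟨e, he, he'⟩ := exists_hasDerivAt_eq_slope f' _ hc.1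
    (fun t _ => (hf' t).continuousAt.continuousWithinAt) (fun t _ => hf' t)
  have h1 : f 1 - f 0 = f' c := by rw [hc']; simp
  have h2 : f' c - f' 0
      = (f' e * (a j - m e) + tilt B b a e j * (-(m' e))) * c := by
    rw [he', sub_zero, div_mul_cancel₀ _ hc.1.ne']
  change |f 1 - f 0 - f' 0| ≤ _
  rw [h1, h2, abs_mul, abs_of_pos hc.1]
  calc _ ≤ 6 * A ^ 2 * 1 :=
        mul_le_mul (hf''A e) hc.2.le hc.1.le (by positivity)
    _ = _ := mul_one _

variable {E : Type*} [NormedAddCommGroup E] [InnerProductSpace ℝ E]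

/-- The softmax weights `w j * exp ⟪θ, x j⟫ / ∑ k, w k * exp ⟪θ, x k⟫`. -/
def softmax (B : Finset ι) (w : ι → ℝ) (x : ι → E) (θ : E) (j : ι) : ℝ :=
  w j * Real.exp ⟪θ, x j⟫ / ∑ k ∈ B, w k * Real.exp ⟪θ, x k⟫

variable {w : ι → ℝ} {x : ι → E}

lemma softmax_add_smul (θ v : E) (t : ℝ) (j : ι) :
    softmax B w x (θ + t • v) j
      = tilt B (fun k => w k * Real.exp ⟪θ, x k⟫) (fun k => ⟪v, x k⟫) t j := by
  simp only [softmax, tilt, inner_add_left, real_inner_smul_left, Real.exp_add, mul_assoc]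

/-- The zero direction is a dummy: it makes the sign and sum rules of `tilt` available at a fixed
`θ`. -/
lemma softmax_eq_tilt (θ : E) (j : ι) :
    softmax B w x θ j
      = tilt B (fun k => w k * Real.exp ⟪θ, x k⟫) (fun _ => 0) 0 j := by
  simp [softmax, tilt]

lemma mul_exp_nonneg (hw : ∀ j ∈ B, 0 ≤ w j) (θ : E) :
    ∀ j ∈ B, 0 ≤ w j * Real.exp ⟪θ, x j⟫ :=
  fun j hj => mul_nonneg (hw j hj) (Real.exp_pos _).le

lemma softmax_nonneg (hw : ∀ j ∈ B, 0 ≤ w j) (θ : E) {j : ι} (hj : j ∈ B) :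
    0 ≤ softmax B w x θ j := by
  rw [softmax_eq_tilt]
  exact tilt_nonneg (mul_exp_nonneg hw θ) _ hj

lemma sum_softmax (hw : ∀ j ∈ B, 0 ≤ w j) (hpos : 0 < ∑ j ∈ B, w j) (θ : E) :
    ∑ j ∈ B, softmax B w x θ j = 1 := by
  simp_rw [softmax_eq_tilt]
  exact sum_tilt (mul_exp_nonneg hw θ) (sum_mul_exp_pos hw hpos _) _

/-- No sign or positivity of the weights is assumed: if the denominator vanishes, division by zero
makes all terms `0`. Norm bounds therefore need no nonempty risk set. -/
lemma sum_softmax_le_one (θ : E) :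
    ∑ j ∈ B, softmax B w x θ j ≤ 1 := by
  unfold softmax
  rw [← Finset.sum_div]
  exact div_self_le_one _

/-- The softmax mean of `x`. -/
def softMean (B : Finset ι) (w : ι → ℝ) (x : ι → E) (θ : E) : E :=
  ∑ j ∈ B, softmax B w x θ j • x j

lemma norm_softMean_le (hw : ∀ j ∈ B, 0 ≤ w j) {R : ℝ} (hR : 0 ≤ R) (hx : ∀ j ∈ B, ‖x j‖ ≤ R)
    (θ : E) : ‖softMean B w x θ‖ ≤ R := by
  calc ‖softMean B w x θ‖ ≤ ∑ j ∈ B, ‖softmax B w x θ j • x j‖ := norm_sum_le _ _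
    _ ≤ ∑ j ∈ B, softmax B w x θ j * R := by
        refine Finset.sum_le_sum fun j hj => ?_
        rw [norm_smul, Real.norm_of_nonneg (softmax_nonneg hw θ hj)]
        exact mul_le_mul_of_nonneg_left (hx j hj) (softmax_nonneg hw θ hj)
    _ ≤ 1 * R := by
        rw [← Finset.sum_mul]
        exact mul_le_mul_of_nonneg_right (sum_softmax_le_one θ) hR
    _ = R := one_mul R

/-- The logarithm of `∑ j, w j * exp ⟪θ, x j⟫`. -/
def logSumExp (B : Finset ι) (w : ι → ℝ) (x : ι → E) (θ : E) : ℝ :=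
  Real.log (∑ j ∈ B, w j * Real.exp ⟪θ, x j⟫)

/-- Convexity in the form of a tangent inequality. The exponential is bounded below by its tangent
at the softmax mean `m` of the increments `⟪x j, θ' - θ⟫`; after weighting, the linear terms cancel
and `exp m` remains. -/
lemma logSumExp_add_inner_le (hw : ∀ j ∈ B, 0 ≤ w j) (hpos : 0 < ∑ j ∈ B, w j) (θ θ' : E) :
    logSumExp B w x θ + ⟪softMean B w x θ, θ' - θ⟫ ≤ logSumExp B w x θ' := by
  set S := ∑ j ∈ B, w j * Real.exp ⟪θ, x j⟫ with hS
  have hSpos : 0 < S := sum_mul_exp_pos hw hpos _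
  set m := ⟪softMean B w x θ, θ' - θ⟫ with hm
  have hm' : m = ∑ j ∈ B, softmax B w x θ j * ⟪x j, θ' - θ⟫ := by
    simp only [hm, softMean, sum_inner, real_inner_smul_left]
  have hexp : ∀ j ∈ B, S * softmax B w x θ j * (Real.exp m * (1 + (⟪x j, θ' - θ⟫ - m)))
      ≤ w j * Real.exp ⟪θ', x j⟫ := fun j hj => by
    have h1 : S * softmax B w x θ j = w j * Real.exp ⟪θ, x j⟫ := by
      exact mul_div_cancel₀ _ hSpos.ne'
    have h2 : Real.exp ⟪θ', x j⟫
        = Real.exp ⟪θ, x j⟫ * (Real.exp m * Real.exp (⟪x j, θ' - θ⟫ - m)) := by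
      rw [← Real.exp_add, ← Real.exp_add]
      congr 1
      rw [inner_sub_right, real_inner_comm θ' (x j), real_inner_comm θ (x j)]
      ring
    rw [h1, h2, ← mul_assoc (w j)]
    refine mul_le_mul_of_nonneg_left ?_ (mul_exp_nonneg hw θ j hj)
    refine mul_le_mul_of_nonneg_left ?_ (Real.exp_pos _).le
    have := Real.add_one_le_exp (⟪x j, θ' - θ⟫ - m)
    linarith
  have key : S * Real.exp m ≤ ∑ j ∈ B, w j * Real.exp ⟪θ', x j⟫ := by
    refine le_trans (le_of_eq ?_) (Finset.sum_le_sum hexp)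
    have : ∀ j ∈ B, S * softmax B w x θ j * (Real.exp m * (1 + (⟪x j, θ' - θ⟫ - m)))
        = S * Real.exp m * (1 - m) * softmax B w x θ j
          + S * Real.exp m * (softmax B w x θ j * ⟪x j, θ' - θ⟫) := fun j _ => by ring
    rw [Finset.sum_congr rfl this, Finset.sum_add_distrib, ← Finset.mul_sum, ← Finset.mul_sum,
      sum_softmax hw hpos, ← hm']
    ring
  have h3 : Real.log (S * Real.exp m) = logSumExp B w x θ + m := by
    rw [Real.log_mul hSpos.ne' (Real.exp_pos _).ne', Real.log_exp]
    rfl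
  rw [← h3]
  exact Real.log_le_log (by positivity) key

lemma hasGradientAt_logSumExp [CompleteSpace E] (hw : ∀ j ∈ B, 0 ≤ w j)
    (hpos : 0 < ∑ j ∈ B, w j) (θ : E) :
    HasGradientAt (logSumExp B w x) (softMean B w x θ) θ := by
  rw [hasGradientAt_iff_hasFDerivAt]
  have h1 : ∀ j, HasFDerivAt (fun θ : E => w j * Real.exp ⟪θ, x j⟫)
      (w j • (Real.exp ⟪θ, x j⟫ • innerSL ℝ (x j))) θ := fun j => by
    have h : HasFDerivAt (fun θ : E => ⟪θ, x j⟫) (innerSL ℝ (x j)) θ := by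
      have := (innerSL ℝ (x j)).hasFDerivAt (x := θ)
      refine this.congr_of_eventuallyEq (Eventually.of_forall fun y => ?_)
      simp [real_inner_comm]
    exact h.exp.const_mul (w j)
  have h2 : HasFDerivAt (fun θ : E => ∑ j ∈ B, w j * Real.exp ⟪θ, x j⟫)
      (∑ j ∈ B, w j • (Real.exp ⟪θ, x j⟫ • innerSL ℝ (x j))) θ := HasFDerivAt.fun_sum fun j _ => h1 j
  refine (h2.log (sum_mul_exp_pos hw hpos _).ne').congr_fderiv ?_
  ext v
  simp only [smul_apply, sum_apply,
    InnerProductSpace.toDual_apply_apply, innerSL_apply_apply, softMean, sum_inner,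
    real_inner_smul_left, smul_eq_mul, softmax, Finset.mul_sum]
  refine Finset.sum_congr rfl fun j _ => ?_
  ring

/-- The derivative of `softMean`: the softmax covariance operator of `x`. -/
def softCov (B : Finset ι) (w : ι → ℝ) (x : ι → E) (θ : E) : E →L[ℝ] E :=
  ∑ j ∈ B, softmax B w x θ j • (innerSL ℝ (x j - softMean B w x θ)).smulRight (x j)

lemma softCov_apply (θ v : E) : softCov B w x θ v
    = ∑ j ∈ B, (softmax B w x θ j * ⟪x j - softMean B w x θ, v⟫) • x j := by
  simp [softCov, mul_smul, inner_sub_left]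

lemma inner_softCov (hw : ∀ j ∈ B, 0 ≤ w j) (hpos : 0 < ∑ j ∈ B, w j) (θ v : E) :
    ⟪v, softCov B w x θ v⟫
      = ∑ j ∈ B, softmax B w x θ j * ⟪x j - softMean B w x θ, v⟫ ^ 2 := by
  -- Deviations from the softmax mean average to zero. This allows the second factor `x j` in
  -- `softCov` to be centred as well, which turns the form into a sum of squares.
  have h0 : ∑ j ∈ B, softmax B w x θ j * ⟪x j - softMean B w x θ, v⟫ = 0 := by
    have : ∀ j ∈ B, softmax B w x θ j * ⟪x j - softMean B w x θ, v⟫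
        = softmax B w x θ j * ⟪x j, v⟫ - softmax B w x θ j * ⟪softMean B w x θ, v⟫ :=
      fun j _ => by rw [inner_sub_left]; ring
    rw [Finset.sum_congr rfl this, Finset.sum_sub_distrib, ← Finset.sum_mul,
      sum_softmax hw hpos, softMean]
    simp [sum_inner, real_inner_smul_left]
  rw [softCov_apply, inner_sum]
  have : ∀ j ∈ B, softmax B w x θ j * ⟪x j - softMean B w x θ, v⟫ ^ 2
      = ⟪v, (softmax B w x θ j * ⟪x j - softMean B w x θ, v⟫) • x j⟫
        - ⟪softMean B w x θ, v⟫ * (softmax B w x θ j * ⟪x j - softMean B w x θ, v⟫) :=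
    fun j _ => by
      rw [real_inner_smul_right, real_inner_comm (x j) v]
      simp only [inner_sub_left]
      ring
  rw [Finset.sum_congr rfl this, Finset.sum_sub_distrib, ← Finset.mul_sum, h0]
  simp

/-- Each softmax weight is expanded along the segment from `θ` to `θ + v`, where the tilting
exponents are at most `R * ‖v‖`; the factor `B.card` comes from adding the errors of the weights. -/
lemma norm_softMean_taylor_le (hw : ∀ j ∈ B, 0 ≤ w j) (hpos : 0 < ∑ j ∈ B, w j) {R : ℝ}
    (hR : 0 ≤ R) (hx : ∀ j ∈ B, ‖x j‖ ≤ R) (θ v : E) :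
    ‖softMean B w x (θ + v) - softMean B w x θ - softCov B w x θ v‖
      ≤ B.card * (6 * R ^ 3) * ‖v‖ ^ 2 := by
  rw [softCov_apply]
  unfold softMean
  rw [← Finset.sum_sub_distrib, ← Finset.sum_sub_distrib]
  have key : ∀ j ∈ B, ‖softmax B w x (θ + v) j • x j - softmax B w x θ j • x j
      - (softmax B w x θ j * ⟪x j - ∑ k ∈ B, softmax B w x θ k • x k, v⟫) • x j‖
      ≤ 6 * R ^ 3 * ‖v‖ ^ 2 := fun j hj => by
    rw [← sub_smul, ← sub_smul, norm_smul]
    have ht := abs_tilt_taylor_le (a := fun k => ⟪v, x k⟫) (A := R * ‖v‖) (mul_exp_nonneg (x := x) hw θ)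
      (sum_mul_exp_pos hw hpos _) (fun k hk => by
        refine (abs_real_inner_le_norm _ _).trans ?_
        rw [mul_comm]
        exact mul_le_mul_of_nonneg_right (hx k hk) (norm_nonneg _)) hj
    simp only [← softmax_add_smul, one_smul, zero_smul, add_zero] at ht
    have hin : ⟪x j - ∑ k ∈ B, softmax B w x θ k • x k, v⟫
        = ⟪v, x j⟫ - ∑ k ∈ B, softmax B w x θ k * ⟪v, x k⟫ := by
      rw [real_inner_comm, inner_sub_right, inner_sum]
      simp only [real_inner_smul_right]
    rw [hin, Real.norm_eq_abs]
    calc _ ≤ (6 * (R * ‖v‖) ^ 2) * R :=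
          mul_le_mul ht (hx j hj) (norm_nonneg _) (by positivity)
      _ = _ := by ring
  calc _ ≤ ∑ j ∈ B, 6 * R ^ 3 * ‖v‖ ^ 2 := (norm_sum_le _ _).trans (Finset.sum_le_sum key)
    _ = _ := by rw [Finset.sum_const, nsmul_eq_mul]; ring

end Softmax

/-! ### Gradient and Hessian of the mini-batch loss -/

section Batch

variable {p : ℕ} {ι : Type*}

/-- `1` if `j` is at risk at the observed time of `i`. -/
def riskWeight (d : ι → Datum p) (i j : ι) : ℝ := if (d i).2.1 ≤ (d j).2.1 then 1 else 0

/-- The event indicator as a number. -/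
def eventIndicator (z : Datum p) : ℝ := if z.2.2 = true then 1 else 0

lemma eventIndicator_nonneg (z : Datum p) : 0 ≤ eventIndicator z := by
  unfold eventIndicator; split_ifs <;> norm_num

lemma eventIndicator_le_one (z : Datum p) : eventIndicator z ≤ 1 := by
  unfold eventIndicator; split_ifs <;> norm_num

lemma riskWeight_nonneg (d : ι → Datum p) (i j : ι) : 0 ≤ riskWeight d i j := by
  unfold riskWeight; split_ifs <;> norm_num

lemma riskWeight_self (d : ι → Datum p) (i : ι) : riskWeight d i i = 1 := by
  simp [riskWeight]

lemma sum_riskWeight_pos {B : Finset ι} (d : ι → Datum p) {i : ι} (hi : i ∈ B) :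
    0 < ∑ j ∈ B, riskWeight d i j :=
  Finset.sum_pos' (fun j _ => riskWeight_nonneg d i j) ⟨i, hi, by simp [riskWeight_self]⟩

/-- The weighted mean of the covariates at risk at the observed time of `i`. -/
def riskMean (B : Finset ι) (d : ι → Datum p) (θ : EuclideanSpace ℝ (Fin p)) (i : ι) :
    EuclideanSpace ℝ (Fin p) :=
  softMean B (riskWeight d i) (fun j => (d j).1) θ

/-- The gradient of the mini-batch loss in closed form. -/
def score (B : Finset ι) (d : ι → Datum p) (θ : EuclideanSpace ℝ (Fin p)) :
    EuclideanSpace ℝ (Fin p) :=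
  (1 / (B.card : ℝ)) • ∑ i ∈ B, eventIndicator (d i) • (riskMean B d θ i - (d i).1)

/-- The Hessian of the mini-batch loss in closed form. -/
def hessOp (B : Finset ι) (d : ι → Datum p) (θ : EuclideanSpace ℝ (Fin p)) :
    EuclideanSpace ℝ (Fin p) →L[ℝ] EuclideanSpace ℝ (Fin p) :=
  (1 / (B.card : ℝ)) • ∑ i ∈ B,
    eventIndicator (d i) • softCov B (riskWeight d i) (fun j => (d j).1) θ

/-- Subject `i` belongs to its own risk set, so the denominator is positive and the logarithm
splits. This form exhibits the loss as convex in `θ`. -/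
lemma batchLoss_eq (B : Finset ι) (d : ι → Datum p) (θ : EuclideanSpace ℝ (Fin p)) :
    batchLoss B d θ = (1 / (B.card : ℝ)) * ∑ i ∈ B, eventIndicator (d i) *
      (logSumExp B (riskWeight d i) (fun j => (d j).1) θ - ⟪(d i).1, θ⟫) := by
  unfold batchLoss
  rw [← mul_neg, ← Finset.sum_neg_distrib]
  congr 1
  refine Finset.sum_congr rfl fun i hi => ?_
  have hS := sum_mul_exp_pos (fun j _ => riskWeight_nonneg d i j)
    (sum_riskWeight_pos d hi) (fun j => ⟪θ, (d j).1⟫)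
  rw [← mul_neg]
  change eventIndicator (d i) * _ = _
  congr 1
  change -Real.log (_ / ∑ j ∈ B, riskWeight d i j * _) = Real.log _ - _
  rw [Real.log_div (Real.exp_pos _).ne' hS.ne', Real.log_exp, real_inner_comm]
  ring

lemma hasGradientAt_batchLoss (B : Finset ι) (d : ι → Datum p) (θ : EuclideanSpace ℝ (Fin p)) :
    HasGradientAt (batchLoss B d) (score B d θ) θ := by
  have h1 : ∀ i ∈ B, HasFDerivAt (fun θ => eventIndicator (d i) *
      (logSumExp B (riskWeight d i) (fun j => (d j).1) θ - ⟪(d i).1, θ⟫))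
      (eventIndicator (d i) • (innerSL ℝ (riskMean B d θ i) - innerSL ℝ (d i).1)) θ :=
    fun i hi => by
      have := (hasGradientAt_logSumExp (x := fun j => (d j).1)
        (fun j _ => riskWeight_nonneg d i j) (sum_riskWeight_pos d hi) θ).hasFDerivAt
      exact (HasFDerivAt.sub this (innerSL ℝ (d i).1).hasFDerivAt).const_mul _
  have h2 := (HasFDerivAt.fun_sum h1).const_mul (1 / (B.card : ℝ))
  rw [hasGradientAt_iff_hasFDerivAt]
  refine (h2.congr_of_eventuallyEq (Eventually.of_forall fun θ => batchLoss_eq B d θ)).congr_fderiv ?_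
  ext v
  simp [score]

lemma batchGrad_eq (B : Finset ι) (d : ι → Datum p) : batchGrad B d = score B d :=
  funext fun θ => (hasGradientAt_batchLoss B d θ).gradient

lemma batchLoss_add_inner_le (B : Finset ι) (d : ι → Datum p)
    (θ θ' : EuclideanSpace ℝ (Fin p)) :
    batchLoss B d θ + ⟪score B d θ, θ' - θ⟫ ≤ batchLoss B d θ' := by
  rw [batchLoss_eq, batchLoss_eq, score, real_inner_smul_left, sum_inner, ← mul_add,
    ← Finset.sum_add_distrib]
  refine mul_le_mul_of_nonneg_left (Finset.sum_le_sum fun i hi => ?_) (by positivity)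
  have := logSumExp_add_inner_le (x := fun j => (d j).1)
    (fun j _ => riskWeight_nonneg d i j) (sum_riskWeight_pos d hi) θ θ'
  rw [real_inner_smul_left, ← mul_add]
  refine mul_le_mul_of_nonneg_left ?_ (eventIndicator_nonneg _)
  rw [inner_sub_left, inner_sub_right (d i).1]
  unfold riskMean
  linarith

/-- The assumption `0 ≤ K` takes care of the empty set, whose average is `0`. -/
lemma one_div_card_mul_sum_le {B : Finset ι} {f : ι → ℝ} {K : ℝ} (hK : 0 ≤ K)
    (hf : ∀ i ∈ B, f i ≤ K) : (1 / (B.card : ℝ)) * ∑ i ∈ B, f i ≤ K := by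
  have h1 : ∑ i ∈ B, f i ≤ B.card * K := by
    simpa [nsmul_eq_mul] using Finset.sum_le_card_nsmul B f K hf
  calc (1 / (B.card : ℝ)) * ∑ i ∈ B, f i ≤ (1 / (B.card : ℝ)) * (B.card * K) :=
        mul_le_mul_of_nonneg_left h1 (by positivity)
    _ = ((B.card : ℝ) / B.card) * K := by ring
    _ ≤ 1 * K := mul_le_mul_of_nonneg_right (div_self_le_one _) hK
    _ = K := one_mul K

lemma norm_one_div_card_smul_sum_le {F : Type*} [SeminormedAddCommGroup F] [NormedSpace ℝ F]
    {B : Finset ι} {f : ι → F} {K : ℝ} (hK : 0 ≤ K)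
    (hf : ∀ i ∈ B, ‖f i‖ ≤ K) : ‖(1 / (B.card : ℝ)) • ∑ i ∈ B, f i‖ ≤ K := by
  rw [norm_smul, Real.norm_of_nonneg (by positivity)]
  exact (mul_le_mul_of_nonneg_left (norm_sum_le _ _) (by positivity)).trans
    (one_div_card_mul_sum_le hK hf)

lemma norm_eventIndicator_smul_le {F : Type*} [SeminormedAddCommGroup F] [NormedSpace ℝ F]
    (z : Datum p) (v : F) : ‖eventIndicator z • v‖ ≤ ‖v‖ := by
  rw [norm_smul, Real.norm_of_nonneg (eventIndicator_nonneg z)]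
  exact mul_le_of_le_one_left (norm_nonneg _) (eventIndicator_le_one z)

variable {B : Finset ι} {d : ι → Datum p} {R : ℝ}

lemma norm_score_le (hR : 0 ≤ R) (hd : ∀ i ∈ B, ‖(d i).1‖ ≤ R)
    (θ : EuclideanSpace ℝ (Fin p)) : ‖score B d θ‖ ≤ 2 * R := by
  refine norm_one_div_card_smul_sum_le (by positivity) fun i hi => ?_
  refine (norm_eventIndicator_smul_le _ _).trans ((norm_sub_le _ _).trans ?_)
  have h1 := norm_softMean_le (x := fun j => (d j).1) (fun j _ => riskWeight_nonneg d i j) hR hd θ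
  have h2 := hd i hi
  unfold riskMean
  linarith

/-- The remainder bound is deterministic and holds for all `v`. It is what replaces uniform
convergence of the Hessians in a neighbourhood of `θ₀`. -/
lemma norm_score_taylor_le (hR : 0 ≤ R) (hd : ∀ i ∈ B, ‖(d i).1‖ ≤ R)
    (θ v : EuclideanSpace ℝ (Fin p)) :
    ‖score B d (θ + v) - score B d θ - hessOp B d θ v‖ ≤ B.card * (6 * R ^ 3) * ‖v‖ ^ 2 := by
  have : score B d (θ + v) - score B d θ - hessOp B d θ v
      = (1 / (B.card : ℝ)) • ∑ i ∈ B, eventIndicator (d i) • (riskMean B d (θ + v) i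
        - riskMean B d θ i - softCov B (riskWeight d i) (fun j => (d j).1) θ v) := by
    simp only [score, hessOp, smul_apply, sum_apply]
    rw [← smul_sub, ← smul_sub, ← Finset.sum_sub_distrib, ← Finset.sum_sub_distrib]
    congr 1
    refine Finset.sum_congr rfl fun i _ => ?_
    rw [← smul_sub, ← smul_sub]
    congr 1
    abel
  rw [this]
  refine norm_one_div_card_smul_sum_le (by positivity) fun i hi => ?_
  exact (norm_eventIndicator_smul_le _ _).trans (norm_softMean_taylor_le
    (fun j _ => riskWeight_nonneg d i j) (sum_riskWeight_pos d hi) hR hd θ v)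

lemma hasFDerivAt_of_norm_sub_le_sq {E F : Type*} [NormedAddCommGroup E] [NormedSpace ℝ E]
    [NormedAddCommGroup F] [NormedSpace ℝ F] {g : E → F} {A : E →L[ℝ] F} {θ : E} {C : ℝ}
    (h : ∀ v, ‖g (θ + v) - g θ - A v‖ ≤ C * ‖v‖ ^ 2) : HasFDerivAt g A θ := by
  rw [hasFDerivAt_iff_isLittleO_nhds_zero]
  have h1 : (fun v => g (θ + v) - g θ - A v) =O[𝓝 0] fun v => ‖v‖ ^ 2 :=
    Asymptotics.IsBigO.of_bound C (Eventually.of_forall fun v => by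
      simpa using h v)
  refine h1.trans_isLittleO ?_
  have := (Asymptotics.isLittleO_norm_pow_id (E' := E) one_lt_two)
  simpa using this

lemma fderiv_batchGrad (hR : 0 ≤ R) (hd : ∀ i ∈ B, ‖(d i).1‖ ≤ R)
    (θ : EuclideanSpace ℝ (Fin p)) : fderiv ℝ (batchGrad B d) θ = hessOp B d θ := by
  rw [batchGrad_eq]
  exact (hasFDerivAt_of_norm_sub_le_sq (norm_score_taylor_le hR hd θ)).fderiv

/-- The matrix of `hessOp`. -/
def hessMat (B : Finset ι) (d : ι → Datum p) (θ : EuclideanSpace ℝ (Fin p)) :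
    Matrix (Fin p) (Fin p) ℝ :=
  Matrix.of fun i j => hessOp B d θ (EuclideanSpace.single j 1) i

lemma batchHess_eq (d : ι → Datum p) (θ : EuclideanSpace ℝ (Fin p)) :
    batchHess B d θ = hessMat B d θ := by
  classical
  -- A finite batch is bounded by the sum of its covariate norms, so the formula needs no assumption
  -- on the data.
  rw [batchHess, fderiv_batchGrad (R := ∑ i ∈ B, ‖(d i).1‖)
    (Finset.sum_nonneg fun i _ => norm_nonneg _)
    fun i hi => Finset.single_le_sum (f := fun i => ‖(d i).1‖) (fun i _ => norm_nonneg _) hi]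
  rfl

lemma norm_softCov_le {w : ι → ℝ} {x : ι → EuclideanSpace ℝ (Fin p)} (hw : ∀ j ∈ B, 0 ≤ w j)
    (hR : 0 ≤ R) (hx : ∀ j ∈ B, ‖x j‖ ≤ R) (θ v : EuclideanSpace ℝ (Fin p)) :
    ‖softCov B w x θ v‖ ≤ 2 * R ^ 2 * ‖v‖ := by
  rw [softCov_apply]
  calc _ ≤ ∑ j ∈ B, softmax B w x θ j * (2 * R ^ 2 * ‖v‖) := by
        refine (norm_sum_le _ _).trans (Finset.sum_le_sum fun j hj => ?_)
        rw [norm_smul, Real.norm_eq_abs, abs_mul, abs_of_nonneg (softmax_nonneg hw θ hj), mul_assoc]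
        refine mul_le_mul_of_nonneg_left ?_ (softmax_nonneg hw θ hj)
        have h1 : |⟪x j - softMean B w x θ, v⟫| ≤ 2 * R * ‖v‖ := by
          refine (abs_real_inner_le_norm _ _).trans ?_
          refine mul_le_mul_of_nonneg_right ((norm_sub_le _ _).trans ?_) (norm_nonneg _)
          have := hx j hj
          have := norm_softMean_le hw hR hx θ
          linarith
        calc _ ≤ (2 * R * ‖v‖) * R := mul_le_mul h1 (hx j hj) (norm_nonneg _) (by positivity)
          _ = _ := by ring
    _ ≤ 1 * (2 * R ^ 2 * ‖v‖) := by
        rw [← Finset.sum_mul]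
        exact mul_le_mul_of_nonneg_right (sum_softmax_le_one θ) (by positivity)
    _ = _ := one_mul _

lemma norm_hessOp_le (hR : 0 ≤ R) (hd : ∀ i ∈ B, ‖(d i).1‖ ≤ R)
    (θ v : EuclideanSpace ℝ (Fin p)) : ‖hessOp B d θ v‖ ≤ 2 * R ^ 2 * ‖v‖ := by
  simp only [hessOp, smul_apply, sum_apply]
  refine norm_one_div_card_smul_sum_le (by positivity) fun i _ => ?_
  exact (norm_eventIndicator_smul_le _ _).trans
    (norm_softCov_le (fun j _ => riskWeight_nonneg d i j) hR hd θ v)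

lemma abs_hessMat_le (hR : 0 ≤ R) (hd : ∀ i ∈ B, ‖(d i).1‖ ≤ R)
    (θ : EuclideanSpace ℝ (Fin p)) (i j : Fin p) : |hessMat B d θ i j| ≤ 2 * R ^ 2 := by
  have h := norm_hessOp_le hR hd θ (EuclideanSpace.single j 1)
  rw [PiLp.norm_single, norm_one, mul_one] at h
  exact (PiLp.norm_apply_le (hessOp B d θ (EuclideanSpace.single j 1)) i).trans h

/-! ### Reindexing -/

variable {κ : Type*}

lemma batchLoss_map (e : ι ↪ κ) (d : κ → Datum p) (θ : EuclideanSpace ℝ (Fin p)) :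
    batchLoss (B.map e) d θ = batchLoss B (d ∘ e) θ := by
  simp [batchLoss, Finset.sum_map]

lemma score_map (e : ι ↪ κ) (d : κ → Datum p) (θ : EuclideanSpace ℝ (Fin p)) :
    score (B.map e) d θ = score B (d ∘ e) θ := by
  rw [← batchGrad_eq, ← batchGrad_eq, batchGrad, batchGrad, funext (batchLoss_map e d)]

lemma hessMat_map (e : ι ↪ κ) (d : κ → Datum p) (θ : EuclideanSpace ℝ (Fin p)) :
    hessMat (B.map e) d θ = hessMat B (d ∘ e) θ := by
  rw [← batchHess_eq, ← batchHess_eq, batchHess, batchHess, batchGrad_eq, batchGrad_eq,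
    funext (score_map e d)]

lemma batchLoss_congr {d' : ι → Datum p} (h : ∀ i ∈ B, d i = d' i) :
    batchLoss B d = batchLoss B d' := by
  funext θ
  unfold batchLoss
  congr 2
  refine Finset.sum_congr rfl fun i hi => ?_
  rw [h i hi]
  congr 3
  exact Finset.sum_congr rfl fun j hj => by rw [h j hj]

lemma score_congr {d' : ι → Datum p} (h : ∀ i ∈ B, d i = d' i) : score B d = score B d' := by
  rw [← batchGrad_eq, ← batchGrad_eq]
  funext θ
  rw [batchGrad, batchGrad, batchLoss_congr h]

lemma hessMat_congr {d' : ι → Datum p} (h : ∀ i ∈ B, d i = d' i)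
    (θ : EuclideanSpace ℝ (Fin p)) : hessMat B d θ = hessMat B d' θ := by
  rw [← batchHess_eq, ← batchHess_eq, batchHess, batchHess, batchGrad_eq, batchGrad_eq,
    score_congr h]

/-! ### Measurability -/

lemma measurable_eventIndicator : Measurable (eventIndicator (p := p)) := by
  unfold eventIndicator
  exact Measurable.ite (measurableSet_eq_fun (by fun_prop) (by fun_prop)) measurable_const
    measurable_const

lemma measurable_riskWeight (i j : ι) : Measurable fun d : ι → Datum p => riskWeight d i j := by
  unfold riskWeight
  exact Measurable.ite (measurableSet_le (by fun_prop) (by fun_prop)) measurable_const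
    measurable_const

lemma measurable_softmax {α : Type*} [MeasurableSpace α] {w : α → ι → ℝ}
    {x : α → ι → EuclideanSpace ℝ (Fin p)} (hw : ∀ i, Measurable fun a => w a i)
    (hx : ∀ i, Measurable fun a => x a i) (θ : EuclideanSpace ℝ (Fin p)) (j : ι) :
    Measurable fun a => softmax B (w a) (x a) θ j := by
  unfold softmax
  have h : ∀ k, Measurable fun a => w a k * Real.exp ⟪θ, x a k⟫ := fun k =>
    (hw k).mul (Real.measurable_exp.comp (measurable_const.inner (hx k)))
  exact (h j).div (Finset.measurable_fun_sum _ fun k _ => h k)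

lemma measurable_softMean {α : Type*} [MeasurableSpace α] {w : α → ι → ℝ}
    {x : α → ι → EuclideanSpace ℝ (Fin p)} (hw : ∀ i, Measurable fun a => w a i)
    (hx : ∀ i, Measurable fun a => x a i) (θ : EuclideanSpace ℝ (Fin p)) :
    Measurable fun a => softMean B (w a) (x a) θ :=
  Finset.measurable_fun_sum _ fun k _ => (measurable_softmax hw hx θ k).smul (hx k)

lemma measurable_score (θ : EuclideanSpace ℝ (Fin p)) :
    Measurable fun d : ι → Datum p => score B d θ := by
  have h : Measurable fun d : ι → Datum p =>
      ∑ i ∈ B, eventIndicator (d i) • (riskMean B d θ i - (d i).1) := by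
    refine Finset.measurable_fun_sum _ fun i _ => ?_
    refine (measurable_eventIndicator.comp (measurable_pi_apply i)).smul ?_
    exact (measurable_softMean (fun j => measurable_riskWeight i j) (fun j => by fun_prop) θ).sub
      (by fun_prop)
  have h' := h.const_smul (1 / (B.card : ℝ))
  exact h'

lemma measurable_hessMat (θ : EuclideanSpace ℝ (Fin p)) (a b : Fin p) :
    Measurable fun d : ι → Datum p => hessMat B d θ a b := by
  have h : Measurable fun d : ι → Datum p => ∑ i ∈ B, eventIndicator (d i) •
      softCov B (riskWeight d i) (fun j => (d j).1) θ (EuclideanSpace.single b 1) := by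
    refine Finset.measurable_fun_sum _ fun i _ => ?_
    refine (measurable_eventIndicator.comp (measurable_pi_apply i)).smul ?_
    simp only [softCov_apply]
    refine Finset.measurable_fun_sum _ fun j _ => ?_
    have h1 := measurable_softmax (B := B) (fun j => measurable_riskWeight i j)
      (fun j => by fun_prop : ∀ j, Measurable fun d : ι → Datum p => (d j).1) θ j
    have h2 := measurable_softMean (B := B) (fun j => measurable_riskWeight i j)
      (fun j => by fun_prop : ∀ j, Measurable fun d : ι → Datum p => (d j).1) θ
    have h3 : Measurable fun d : ι → Datum p => (d j).1 := by fun_prop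
    exact (h1.mul ((h3.sub h2).inner measurable_const)).smul h3
  have h' := (by fun_prop : Measurable fun v : EuclideanSpace ℝ (Fin p) => v a).comp
    (h.const_smul (1 / (B.card : ℝ)))
  convert h' using 2
  simp [hessMat, hessOp]

end Batch

/-! ### Minimizers of convex functions near a zero of the limiting gradient -/

section Argmin

variable {E : Type*} [NormedAddCommGroup E] [InnerProductSpace ℝ E]

/-- A function with gradient `g` that lies above its tangents, and whose gradient has a first-order
expansion at `θ₀` with derivative `A` and quadratic remainder. -/
structure ConvexExpansion [CompleteSpace E] (F : E → ℝ) (g : E → E) (A : E →L[ℝ] E) (θ₀ : E)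
    (C : ℝ) : Prop where
  tangent_le : ∀ θ θ', F θ + ⟪g θ, θ' - θ⟫ ≤ F θ'
  hasGradientAt : ∀ θ, HasGradientAt F (g θ) θ
  taylor : ∀ v, ‖g (θ₀ + v) - g θ₀ - A v‖ ≤ C * ‖v‖ ^ 2

variable [CompleteSpace E] {F : E → ℝ} {g : E → E} {A : E →L[ℝ] E} {θ₀ : E} {C c r : ℝ}

/-- A minimizer farther away would allow a point `θ₀ + u` on the segment towards it, at a distance
`ρ` between `2 * ‖g θ₀‖ / c` and `r`. There the gradient points outwards, so by the tangent
inequality `F` is strictly larger at `θ` than at `θ₀ + u`, which lies in `Θ`. -/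
lemma ConvexExpansion.norm_sub_le (h : ConvexExpansion F g A θ₀ C)
    (hA : ∀ v, c * ‖v‖ ^ 2 ≤ ⟪A v, v⟫) (hc : 0 < c) (hC : 0 ≤ C) (hr : 2 * C * r ≤ c)
    (hG : 2 * ‖g θ₀‖ < c * r) {Θ : Set E} (hΘ : Metric.closedBall θ₀ r ⊆ Θ) {θ : E}
    (hθ : IsMinOn F Θ θ) : ‖θ - θ₀‖ ≤ 2 * ‖g θ₀‖ / c := by
  by_contra! hlt
  have hGr : 2 * ‖g θ₀‖ / c < r := by rwa [div_lt_iff₀ hc, mul_comm r]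
  obtain ⟨ρ, hρ1, hρ2⟩ := exists_between (lt_min hlt hGr)
  obtain ⟨hρθ, hρr⟩ := lt_min_iff.1 hρ2
  have hρ0 : 0 < ρ := lt_of_le_of_lt (by positivity) hρ1
  set n := ‖θ - θ₀‖ with hn
  have hn0 : 0 < n := hρ0.trans hρθ
  set u := (ρ / n) • (θ - θ₀) with hu
  have hun : ‖u‖ = ρ := by
    rw [hu, norm_smul, Real.norm_of_nonneg (by positivity), ← hn, div_mul_cancel₀ _ hn0.ne']
  -- The curvature contributes at least `c * ρ ^ 2`. The remainder costs at most half of this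
  -- because `2 * C * ρ ≤ c`, and the gradient at `θ₀` strictly less than half because `2 * ‖g θ₀‖ <
  -- c * ρ`.
  have hpos : 0 < ⟪g (θ₀ + u), u⟫ := by
    have h1 : ⟪g (θ₀ + u), u⟫
        = ⟪g (θ₀ + u) - g θ₀ - A u, u⟫ + ⟪g θ₀, u⟫ + ⟪A u, u⟫ := by
      rw [inner_sub_left, inner_sub_left]; ring
    have h2 : -(C * ρ ^ 2 * ρ) ≤ ⟪g (θ₀ + u) - g θ₀ - A u, u⟫ := by
      have := (abs_real_inner_le_norm (g (θ₀ + u) - g θ₀ - A u) u).trans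
        (mul_le_mul_of_nonneg_right (h.taylor u) (norm_nonneg u))
      rw [hun] at this
      exact (abs_le.1 this).1
    have h3 : -(‖g θ₀‖ * ρ) ≤ ⟪g θ₀, u⟫ := by
      have := abs_real_inner_le_norm (g θ₀) u
      rw [hun] at this
      exact (abs_le.1 this).1
    have h4 := hA u
    rw [hun] at h4
    have h5 : 2 * ‖g θ₀‖ < ρ * c := by rwa [div_lt_iff₀ hc] at hρ1
    have h6 : 2 * C * ρ ≤ c := le_trans (by nlinarith) hr
    rw [h1]
    nlinarith [mul_pos hρ0 hρ0, mul_le_mul_of_nonneg_right h6 (mul_pos hρ0 hρ0).le,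
      mul_lt_mul_of_pos_right h5 hρ0]
  have hdiff : θ - (θ₀ + u) = (n / ρ - 1) • u := by
    rw [hu, smul_smul, ← sub_sub, sub_mul, one_mul, div_mul_div_cancel₀ hρ0.ne', div_self hn0.ne',
      sub_smul, one_smul]
  have h7 := h.tangent_le (θ₀ + u) θ
  rw [hdiff, real_inner_smul_right] at h7
  have h8 : 0 < n / ρ - 1 := by rw [sub_pos, one_lt_div hρ0]; exact hρθ
  have h9 : F θ ≤ F (θ₀ + u) := hθ (hΘ (by simp [hun, hρr.le]))
  nlinarith [mul_pos h8 hpos]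

/-- The distance bound is strictly smaller than `r`, so `Θ` is a neighbourhood of the minimizer and
the constraint is not active. -/
lemma ConvexExpansion.gradient_eq_zero (h : ConvexExpansion F g A θ₀ C)
    (hA : ∀ v, c * ‖v‖ ^ 2 ≤ ⟪A v, v⟫) (hc : 0 < c) (hC : 0 ≤ C) (hr : 2 * C * r ≤ c)
    (hG : 2 * ‖g θ₀‖ < c * r) {Θ : Set E} (hΘ : Metric.closedBall θ₀ r ⊆ Θ) {θ : E}
    (hθ : IsMinOn F Θ θ) : g θ = 0 := by
  have hGr : 2 * ‖g θ₀‖ / c < r := by rwa [div_lt_iff₀ hc, mul_comm r]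
  have hmem : Θ ∈ 𝓝 θ := by
    refine mem_of_superset ?_ (Metric.ball_subset_closedBall.trans hΘ)
    refine Metric.isOpen_ball.mem_nhds ?_
    rw [mem_ball_iff_norm]
    exact (h.norm_sub_le hA hc hC hr hG hΘ hθ).trans_lt hGr
  have := (hθ.isLocalMin hmem).hasFDerivAt_eq_zero (h.hasGradientAt θ).hasFDerivAt
  simpa using this

/-- A minimizer over the compact ball has zero gradient, and the tangent inequality then makes it a
global minimizer. This discharges the existence premise of `IsArgmin`, also for unbounded `Θ`. -/
lemma ConvexExpansion.exists_isMinOn [ProperSpace E] (h : ConvexExpansion F g A θ₀ C)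
    (hA : ∀ v, c * ‖v‖ ^ 2 ≤ ⟪A v, v⟫) (hc : 0 < c) (hC : 0 ≤ C) (hr : 2 * C * r ≤ c)
    (hG : 2 * ‖g θ₀‖ < c * r) {Θ : Set E} (hΘ : Metric.closedBall θ₀ r ⊆ Θ) :
    ∃ η ∈ Θ, IsMinOn F Θ η := by
  have hr0 : 0 ≤ r := by
    by_contra! hr0
    nlinarith [norm_nonneg (g θ₀), mul_neg_of_pos_of_neg hc hr0]
  obtain ⟨η, hη, hmin⟩ := (isCompact_closedBall θ₀ r).exists_isMinOn
    ⟨θ₀, Metric.mem_closedBall_self hr0⟩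
    (fun θ _ => (h.hasGradientAt θ).hasFDerivAt.continuousAt.continuousWithinAt)
  have h0 := h.gradient_eq_zero hA hc hC hr hG subset_rfl hmin
  refine ⟨η, hΘ hη, fun θ _ => ?_⟩
  have := h.tangent_le η θ
  rwa [h0, inner_zero_left, add_zero] at this

/-- `A` plays the empirical Hessian and `H` its limit; half of the coercivity constant is given up
to absorb their difference `η`. The gradient vanishes at the minimizer, so the Taylor expansion
bounds `g θ₀ + A (θ - θ₀)` quadratically, and replacing `A` by `H` costs `η * ‖θ - θ₀‖`. The
coercivity of `A` is returned because existence of a minimizer needs it too. -/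
lemma ConvexExpansion.expansion_of_isMinOn (h : ConvexExpansion F g A θ₀ C) {H : E →L[ℝ] E}
    {η : ℝ} (hAH : ∀ v, ‖A v - H v‖ ≤ η * ‖v‖) (hη : 2 * η ≤ c)
    (hH : ∀ v, c * ‖v‖ ^ 2 ≤ ⟪H v, v⟫) (hc : 0 < c) (hC : 0 ≤ C) (hη0 : 0 ≤ η)
    (hr : 4 * C * r ≤ c) (hG : 4 * ‖g θ₀‖ < c * r) {Θ : Set E}
    (hΘ : Metric.closedBall θ₀ r ⊆ Θ) :
    (∀ v, c / 2 * ‖v‖ ^ 2 ≤ ⟪A v, v⟫) ∧ ∀ θ, IsMinOn F Θ θ →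
    ‖g θ₀ + H (θ - θ₀)‖ ≤ (4 * C / c * ‖g θ₀‖ + η) * (4 / c * ‖g θ₀‖) := by
  have hA : ∀ v, c / 2 * ‖v‖ ^ 2 ≤ ⟪A v, v⟫ := fun v => by
    have h1 : ⟪A v, v⟫ = ⟪A v - H v, v⟫ + ⟪H v, v⟫ := by rw [inner_sub_left]; ring
    have h2 := (abs_real_inner_le_norm (A v - H v) v).trans
      (mul_le_mul_of_nonneg_right (hAH v) (norm_nonneg v))
    have h3 := (abs_le.1 h2).1
    have h4 := hH v
    rw [h1]
    nlinarith [sq_nonneg ‖v‖]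
  refine ⟨hA, fun θ hθ => ?_⟩
  have hc2 : 0 < c / 2 := by positivity
  have hr2 : 2 * C * r ≤ c / 2 := by linarith
  have hG2 : 2 * ‖g θ₀‖ < c / 2 * r := by linarith
  have hn : ‖θ - θ₀‖ ≤ 4 / c * ‖g θ₀‖ := by
    refine (h.norm_sub_le hA hc2 hC hr2 hG2 hΘ hθ).trans (le_of_eq ?_)
    field_simp
    ring
  have h0 := h.gradient_eq_zero hA hc2 hC hr2 hG2 hΘ hθ
  have h1 := h.taylor (θ - θ₀)
  rw [add_sub_cancel, h0, zero_sub, ← norm_neg, neg_sub, sub_neg_eq_add] at h1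
  have h2 : g θ₀ + H (θ - θ₀) = (A (θ - θ₀) + g θ₀) - (A (θ - θ₀) - H (θ - θ₀)) := by abel
  rw [h2]
  calc _ ≤ C * ‖θ - θ₀‖ ^ 2 + η * ‖θ - θ₀‖ :=
        (_root_.norm_sub_le _ _).trans (add_le_add h1 (hAH _))
    _ = (C * ‖θ - θ₀‖ + η) * ‖θ - θ₀‖ := by ring
    _ ≤ (C * (4 / c * ‖g θ₀‖) + η) * (4 / c * ‖g θ₀‖) := by gcongr
    _ = _ := by ring

/-- Convex expansions are stable under averages. -/
lemma ConvexExpansion.average {β : Type*} {J : Finset β} {F : β → E → ℝ} {g : β → E → E}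
    {A : β → E →L[ℝ] E} {a : ℝ} (ha : 0 ≤ a) (haJ : a * J.card ≤ 1) (hC : 0 ≤ C)
    (h : ∀ b ∈ J, ConvexExpansion (F b) (g b) (A b) θ₀ C) :
    ConvexExpansion (fun θ => a * ∑ b ∈ J, F b θ) (fun θ => a • ∑ b ∈ J, g b θ)
      (a • ∑ b ∈ J, A b) θ₀ C where
  tangent_le θ θ' := by
    rw [real_inner_smul_left, sum_inner, ← mul_add, ← Finset.sum_add_distrib]
    exact mul_le_mul_of_nonneg_left
      (Finset.sum_le_sum fun b hb => (h b hb).tangent_le θ θ') ha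
  hasGradientAt θ := by
    rw [hasGradientAt_iff_hasFDerivAt]
    have := (HasFDerivAt.fun_sum fun b hb => ((h b hb).hasGradientAt θ).hasFDerivAt).const_mul a
    refine this.congr_fderiv ?_
    simp [map_sum]
  taylor v := by
    have : (a • ∑ b ∈ J, g b (θ₀ + v)) - (a • ∑ b ∈ J, g b θ₀) - (a • ∑ b ∈ J, A b) v
        = a • ∑ b ∈ J, (g b (θ₀ + v) - g b θ₀ - A b v) := by
      rw [smul_apply, sum_apply, ← smul_sub, ← smul_sub, ← Finset.sum_sub_distrib,
        ← Finset.sum_sub_distrib]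
    rw [this, norm_smul, Real.norm_of_nonneg ha]
    calc _ ≤ a * ∑ b ∈ J, C * ‖v‖ ^ 2 := mul_le_mul_of_nonneg_left
          ((norm_sum_le _ _).trans (Finset.sum_le_sum fun b hb => (h b hb).taylor v)) ha
      _ = a * J.card * (C * ‖v‖ ^ 2) := by rw [Finset.sum_const, nsmul_eq_mul]; ring
      _ ≤ 1 * (C * ‖v‖ ^ 2) := mul_le_mul_of_nonneg_right haJ (by positivity)
      _ = _ := one_mul _

end Argmin

lemma convexExpansion_batchLoss {p : ℕ} {ι : Type*} {B : Finset ι} {d : ι → Datum p} {R : ℝ}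
    (hR : 0 ≤ R) (hd : ∀ i ∈ B, ‖(d i).1‖ ≤ R) (θ₀ : EuclideanSpace ℝ (Fin p)) :
    ConvexExpansion (batchLoss B d) (score B d) (hessOp B d θ₀) θ₀ (B.card * (6 * R ^ 3)) where
  tangent_le := batchLoss_add_inner_le B d
  hasGradientAt := hasGradientAt_batchLoss B d
  taylor := norm_score_taylor_le hR hd θ₀

/-- The operator norm is bounded by the sum of the absolute values of the entries. -/
lemma norm_apply_le_sum_abs_mul {p : ℕ}
    (A : EuclideanSpace ℝ (Fin p) →L[ℝ] EuclideanSpace ℝ (Fin p)) (v : EuclideanSpace ℝ (Fin p)) :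
    ‖A v‖ ≤ (∑ i, ∑ j, |A (EuclideanSpace.single j 1) i|) * ‖v‖ := by
  have h1 : A v = ∑ j, v j • A (EuclideanSpace.single j 1) := by
    conv_lhs => rw [← (EuclideanSpace.basisFun (Fin p) ℝ).sum_repr v]
    simp
  have h2 : ∀ w : EuclideanSpace ℝ (Fin p), ‖w‖ ≤ ∑ i, |w i| := fun w => by
    rw [EuclideanSpace.norm_eq]
    refine Real.sqrt_le_iff.2 ⟨Finset.sum_nonneg fun i _ => abs_nonneg _, ?_⟩
    simpa using Finset.sum_sq_le_sq_sum_of_nonneg (s := Finset.univ) (f := fun i => |w i|)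
      fun i _ => abs_nonneg _
  calc ‖A v‖ ≤ ∑ j, ‖v j • A (EuclideanSpace.single j 1)‖ := by
        rw [h1]; exact norm_sum_le _ _
    _ ≤ ∑ j, ‖v‖ * ∑ i, |A (EuclideanSpace.single j 1) i| := by
        refine Finset.sum_le_sum fun j _ => ?_
        rw [norm_smul]
        exact mul_le_mul (PiLp.norm_apply_le v j) (h2 _) (norm_nonneg _) (norm_nonneg _)
    _ = _ := by rw [← Finset.mul_sum, Finset.sum_comm, mul_comm]

/-! ### Integrals over i.i.d. sequences -/

section IID

variable {β : Type*}

lemma piecewise_singleton_eq_update (i : ℕ) (d d' : ℕ → β) :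
    ({i} : Finset ℕ).piecewise d d' = Function.update d' i (d i) := by
  simp [Finset.piecewise_singleton]

variable [MeasurableSpace β] (P : Measure β) [IsProbabilityMeasure P]

/-- The law of an i.i.d. sequence with marginal `P`. -/
abbrev iidLaw : Measure (ℕ → β) := Measure.infinitePi fun _ => P

lemma measurable_piecewise (S : Finset ℕ) :
    Measurable fun q : (ℕ → β) × (ℕ → β) => S.piecewise q.1 q.2 := by
  refine measurable_pi_lambda _ fun i => ?_
  by_cases hi : i ∈ S
  · simp only [Finset.piecewise, hi, if_true]; fun_prop
  · simp only [Finset.piecewise, hi, if_false]; fun_prop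

/-- Coordinates outside `S` may be replaced by an independent copy. With Fubini this is the concrete
form of conditioning on the observations in `S`. On a cylinder the preimage is a product of a
cylinder over the coordinates in `S` and one over the rest. -/
lemma map_piecewise_iidLaw (S : Finset ℕ) :
    ((iidLaw P).prod (iidLaw P)).map (fun q => S.piecewise q.1 q.2) = iidLaw P := by
  refine Measure.eq_infinitePi _ fun T t ht => ?_
  have hpre : (fun q : (ℕ → β) × (ℕ → β) => S.piecewise q.1 q.2) ⁻¹' (Set.pi T t)
      = (Set.pi (T ∩ S : Finset ℕ) t) ×ˢ (Set.pi (T \ S : Finset ℕ) t) := by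
    ext q
    simp only [mem_preimage, Set.mem_pi, Finset.mem_coe, mem_prod, Finset.mem_inter,
      Finset.mem_sdiff, Finset.piecewise]
    refine ⟨fun h => ⟨fun i hi => by simpa [hi.2] using h i hi.1,
      fun i hi => by simpa [hi.2] using h i hi.1⟩, fun h i hi => ?_⟩
    by_cases hS : i ∈ S
    · simpa [hS] using h.1 i ⟨hi, hS⟩
    · simpa [hS] using h.2 i ⟨hi, hS⟩
  rw [Measure.map_apply (measurable_piecewise S)
    (MeasurableSet.pi T.countable_toSet fun i _ => ht i), hpre, Measure.prod_prod,
    Measure.infinitePi_pi _ fun i _ => ht i, Measure.infinitePi_pi _ fun i _ => ht i, mul_comm,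
    ← Finset.prod_union (Finset.disjoint_sdiff_inter T S), Finset.sdiff_union_inter]

lemma integral_iidLaw_piecewise (S : Finset ℕ) {Φ : (ℕ → β) → ℝ} (hΦ : Integrable Φ (iidLaw P)) :
    ∫ d, Φ d ∂(iidLaw P) = ∫ d, ∫ d', Φ (S.piecewise d d') ∂(iidLaw P) ∂(iidLaw P) := by
  have hm := map_piecewise_iidLaw P S
  rw [← hm] at hΦ
  conv_lhs => rw [← hm]
  rw [integral_map (measurable_piecewise S).aemeasurable hΦ.1]
  exact integral_prod _ ((integrable_map_measure hΦ.1 (measurable_piecewise S).aemeasurable).1 hΦ)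

lemma integral_iidLaw_eval (i : ℕ) {f : β → ℝ} (hf : AEStronglyMeasurable f P) :
    ∫ d, f (d i) ∂(iidLaw P) = ∫ x, f x ∂P := by
  have h := measurePreserving_eval_infinitePi (fun _ : ℕ => P) i
  have := integral_map (f := f) h.measurable.aemeasurable (by rwa [h.map_eq])
  rw [h.map_eq] at this
  exact this.symm

lemma measurable_update_prod (i : ℕ) :
    Measurable fun q : (ℕ → β) × β => Function.update q.1 i q.2 := by
  refine measurable_pi_lambda _ fun j => ?_
  by_cases hj : j = i
  · subst hj; simp only [Function.update_self]; fun_prop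
  · simp only [Function.update_of_ne hj]; fun_prop

lemma integral_iidLaw_comp_embedding (e : ℕ ↪ ℕ) {Φ : (ℕ → β) → ℝ} (hΦ : Measurable Φ) :
    ∫ d, Φ (d ∘ e) ∂(iidLaw P) = ∫ d, Φ d ∂(iidLaw P) := by
  have h : (iidLaw P).map (fun d i => d (e i)) = iidLaw P :=
    Measure.map_infinitePi_infinitePi_of_inj e.injective
  conv_rhs => rw [← h]
  rw [integral_map (measurable_pi_lambda _ fun i => measurable_pi_apply _).aemeasurable
    hΦ.aestronglyMeasurable]
  rfl

end IID

/-! ### Kernels of U-statistics -/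

section Kernel

variable {β : Type*} [MeasurableSpace β]

/-- A bounded family of functions of finitely many observations, compatible with reindexing. -/
structure SymmKernel (Ψ : Finset ℕ → (ℕ → β) → ℝ) (K : ℝ) : Prop where
  measurable : ∀ B, Measurable (Ψ B)
  abs_le : ∀ B d, |Ψ B d| ≤ K
  congr : ∀ B d d', (∀ i ∈ B, d i = d' i) → Ψ B d = Ψ B d'
  map : ∀ B (e : ℕ ↪ ℕ) d, Ψ (B.map e) d = Ψ B (d ∘ e)

lemma SymmKernel.sub_const {Ψ : Finset ℕ → (ℕ → β) → ℝ} {K : ℝ} (h : SymmKernel Ψ K) (a : ℝ) :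
    SymmKernel (fun B d => Ψ B d - a) (K + |a|) where
  measurable B := (h.measurable B).sub_const a
  abs_le B d := (abs_sub _ _).trans (by have := h.abs_le B d; linarith)
  congr B d d' hd := by rw [h.congr B d d' hd]
  map B e d := by rw [h.map]

/-- Reduces a batch with a marked member to the standard batch marked at `0`. Permutations of `ℕ`
are multiply transitive, which moves the first `s` numbers onto `B`; a transposition then corrects
the mark. -/
lemma exists_embedding_map_range {s : ℕ} {B : Finset ℕ} (hB : B.card = s) {i : ℕ} (hi : i ∈ B) :
    ∃ e : ℕ ↪ ℕ, (Finset.range s).map e = B ∧ e 0 = i := by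
  classical
  have hs : 0 < s := hB ▸ Finset.card_pos.2 ⟨i, hi⟩
  have := Equiv.Perm.isMultiplyPretransitive ℕ s
  obtain ⟨g, hg⟩ := MulAction.exists_smul_eq (Equiv.Perm ℕ) (Fin.valEmbedding (n := s))
    (B.orderEmbOfFin hB).toEmbedding
  have hmap : (Finset.range s).map g.toEmbedding = B := by
    have h1 : (Finset.range s).map g.toEmbedding
        = Finset.univ.map (B.orderEmbOfFin hB).toEmbedding := by
      rw [← hg, ← Nat.Iio_eq_range, ← Fin.map_valEmbedding_univ, Finset.map_map]
      rfl
    rw [h1]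
    exact Finset.map_orderEmbOfFin_univ B hB
  have hg0 : g 0 ∈ B := by
    rw [← hmap]
    exact Finset.mem_map.2 ⟨0, Finset.mem_range.2 hs, rfl⟩
  -- Both `g 0` and `i` lie in `B`, so exchanging them maps `B` to itself.
  refine ⟨(g.trans (Equiv.swap (g 0) i)).toEmbedding, ?_, by simp⟩
  ext j
  have key : ∀ k, Equiv.swap (g 0) i k ∈ B ↔ k ∈ B := fun k => by
    rw [Equiv.swap_apply_def]
    split_ifs with h1 h2
    · simp [h1, hi, hg0]
    · simp [h2, hi, hg0]
    · rfl
  rw [← key j]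
  conv_rhs => rw [← hmap]
  simp only [Finset.mem_map_equiv, Equiv.symm_trans_apply, Equiv.symm_swap]

variable (P : Measure β) [IsProbabilityMeasure P] {Ψ : Finset ℕ → (ℕ → β) → ℝ} {K : ℝ} {s : ℕ}

/-- The first-order projection of a kernel: its expectation given one observation. -/
def proj (Ψ : Finset ℕ → (ℕ → β) → ℝ) (s : ℕ) (x : β) : ℝ :=
  ∫ d, Ψ (Finset.range s) (Function.update d 0 x) ∂(iidLaw P)

variable {P}

lemma SymmKernel.integrable_of_measurable {Φ : (ℕ → β) → ℝ} (hΦ : Measurable Φ) {L : ℝ}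
    (hL : ∀ d, |Φ d| ≤ L) : Integrable Φ (iidLaw P) :=
  Integrable.of_bound hΦ.aestronglyMeasurable L (Eventually.of_forall hL)

lemma SymmKernel.measurable_proj (h : SymmKernel Ψ K) : Measurable (proj P Ψ s) := by
  have : Measurable fun q : β × (ℕ → β) => Ψ (Finset.range s) (Function.update q.2 0 q.1) :=
    (h.measurable _).comp ((measurable_update_prod 0).comp measurable_swap)
  exact this.stronglyMeasurable.integral_prod_right.measurable

lemma SymmKernel.abs_proj_le (h : SymmKernel Ψ K) (x : β) : |proj P Ψ s x| ≤ K := by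
  have := norm_integral_le_of_norm_le_const (μ := iidLaw P) (C := K)
    (f := fun d => Ψ (Finset.range s) (Function.update d 0 x))
    (Eventually.of_forall fun d => h.abs_le _ _)
  simpa [proj] using this

/-- By exchangeability neither the batch nor the member held fixed matters, so a single function
`proj` serves all batches of size `s`. -/
lemma SymmKernel.integral_update (h : SymmKernel Ψ K) {B : Finset ℕ} (hB : B.card = s) {i : ℕ}
    (hi : i ∈ B) (x : β) :
    ∫ d, Ψ B (Function.update d i x) ∂(iidLaw P) = proj P Ψ s x := by
  obtain ⟨e, rfl, rfl⟩ := exists_embedding_map_range hB hi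
  have h1 : ∀ d : ℕ → β, Ψ ((Finset.range s).map e) (Function.update d (e 0) x)
      = Ψ (Finset.range s) (Function.update (d ∘ e) 0 x) := fun d => by
    rw [h.map]
    congr 1
    exact Function.update_comp_eq_of_injective d e.injective 0 x
  simp_rw [h1]
  refine integral_iidLaw_comp_embedding P e
    (Φ := fun d => Ψ (Finset.range s) (Function.update d 0 x)) ((h.measurable _).comp ?_)
  exact (measurable_update_prod 0).comp (measurable_id.prodMk measurable_const)

lemma SymmKernel.integral_eq (h : SymmKernel Ψ K) {B : Finset ℕ} (hB : B.card = s) :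
    ∫ d, Ψ B d ∂(iidLaw P) = ∫ d, Ψ (Finset.range s) d ∂(iidLaw P) := by
  rcases B.eq_empty_or_nonempty with rfl | ⟨i, hi⟩
  · simp at hB; simp [← hB]
  obtain ⟨e, rfl, rfl⟩ := exists_embedding_map_range hB hi
  simp_rw [h.map]
  exact integral_iidLaw_comp_embedding P e (h.measurable _)

/-- Conditioning on a block that meets the batch in one observation. -/
lemma SymmKernel.integral_mul_of_inter_singleton (h : SymmKernel Ψ K) {S B : Finset ℕ}
    (hB : B.card = s) {i : ℕ} (hSB : S ∩ B = {i}) {f : (ℕ → β) → ℝ} (hf : Measurable f) {L : ℝ}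
    (hL : ∀ d, |f d| ≤ L) (hfS : ∀ d d', (∀ j ∈ S, d j = d' j) → f d = f d') :
    ∫ d, f d * Ψ B d ∂(iidLaw P) = ∫ d, f d * proj P Ψ s (d i) ∂(iidLaw P) := by
  have hi : i ∈ S ∩ B := hSB ▸ Finset.mem_singleton_self i
  rw [Finset.mem_inter] at hi
  rw [integral_iidLaw_piecewise P S (Φ := fun d => f d * Ψ B d) (integrable_of_measurable (hf.mul (h.measurable B))
    (L := L * K) fun d => by
      rw [abs_mul]
      exact mul_le_mul (hL d) (h.abs_le B d) (abs_nonneg _) ((abs_nonneg _).trans (hL d)))]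
  refine integral_congr_ae (Eventually.of_forall fun d => ?_)
  -- With the block `S` frozen, `f` is constant, and the batch sees only one frozen observation, the
  -- one at `i`.
  have h1 : ∀ d', f (S.piecewise d d') * Ψ B (S.piecewise d d')
      = f d * Ψ B (Function.update d' i (d i)) := fun d' => by
    rw [hfS (S.piecewise d d') d fun j hj => by simp [hj]]
    congr 1
    refine h.congr _ _ _ fun j hj => ?_
    by_cases hji : j = i
    · subst hji; simp [hi.1]
    · have : j ∉ S := fun hS => hji (by
        rw [← Finset.mem_singleton, ← hSB]; exact Finset.mem_inter.2 ⟨hS, hj⟩)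
      simp [this, hji]
  simp only [h1]
  rw [integral_const_mul, h.integral_update hB hi.2]

lemma SymmKernel.integral_mul_of_disjoint (h : SymmKernel Ψ K) {S B : Finset ℕ}
    (hSB : Disjoint S B) {f : (ℕ → β) → ℝ} (hf : Measurable f) {L : ℝ}
    (hL : ∀ d, |f d| ≤ L) (hfS : ∀ d d', (∀ j ∈ S, d j = d' j) → f d = f d') :
    ∫ d, f d * Ψ B d ∂(iidLaw P) = (∫ d, f d ∂(iidLaw P)) * ∫ d, Ψ B d ∂(iidLaw P) := by
  rw [integral_iidLaw_piecewise P S (Φ := fun d => f d * Ψ B d) (integrable_of_measurable (hf.mul (h.measurable B))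
    (L := L * K) fun d => by
      rw [abs_mul]
      exact mul_le_mul (hL d) (h.abs_le B d) (abs_nonneg _) ((abs_nonneg _).trans (hL d)))]
  rw [← integral_mul_const]
  refine integral_congr_ae (Eventually.of_forall fun d => ?_)
  have h1 : ∀ d', f (S.piecewise d d') * Ψ B (S.piecewise d d') = f d * Ψ B d' := fun d' => by
    rw [hfS (S.piecewise d d') d fun j hj => by simp [hj]]
    congr 1
    refine h.congr _ _ _ fun j hj => ?_
    have : j ∉ S := fun hS => (Finset.disjoint_left.1 hSB hS) hj
    simp [this]
  simp only [h1]
  rw [integral_const_mul]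

lemma SymmKernel.integral_proj (h : SymmKernel Ψ K) (hs : 0 < s) :
    ∫ x, proj P Ψ s x ∂P = ∫ d, Ψ (Finset.range s) d ∂(iidLaw P) := by
  rw [← integral_iidLaw_eval P 0 h.measurable_proj.aestronglyMeasurable]
  have := h.integral_mul_of_inter_singleton (P := P) (S := {0}) (B := Finset.range s) (i := 0)
    (Finset.card_range s) (by ext j; simp; omega) (f := fun _ => 1) measurable_const (L := 1) (by simp)
    (fun _ _ _ => rfl)
  simpa using this.symm

/-- A bound for the second moment of an average of uniformly bounded variables, of which few
pairs are correlated. -/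
lemma integral_sq_average_le {Ω : Type*} [MeasurableSpace Ω] {μ : Measure Ω}
    [IsProbabilityMeasure μ] {γ : Type*} (J : Finset γ) {Y : γ → Ω → ℝ} {L : ℝ}
    (hY : ∀ b ∈ J, Measurable (Y b)) (hL : ∀ b ∈ J, ∀ ω, |Y b ω| ≤ L) (r : γ → γ → Prop)
    [DecidableRel r] (hr : ∀ b ∈ J, ∀ b' ∈ J, ¬ r b b' → ∫ ω, Y b ω * Y b' ω ∂μ = 0) {N : ℕ}
    (hN : ∀ b ∈ J, (J.filter (r b)).card ≤ N) :
    ∫ ω, ((1 / (J.card : ℝ)) * ∑ b ∈ J, Y b ω) ^ 2 ∂μ ≤ L ^ 2 * (N / J.card) := by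
  have habs : ∀ b ∈ J, ∀ b' ∈ J, ∀ ω, |Y b ω * Y b' ω| ≤ L ^ 2 := fun b hb b' hb' ω => by
    rw [abs_mul, sq]
    exact mul_le_mul (hL b hb ω) (hL b' hb' ω) (abs_nonneg _) ((abs_nonneg _).trans (hL b hb ω))
  have hint : ∀ b ∈ J, ∀ b' ∈ J, Integrable (fun ω => Y b ω * Y b' ω) μ := fun b hb b' hb' =>
    Integrable.of_bound ((hY b hb).mul (hY b' hb')).aestronglyMeasurable (L ^ 2)
      (Eventually.of_forall (habs b hb b' hb'))
  have h1 : ∀ ω, ((1 / (J.card : ℝ)) * ∑ b ∈ J, Y b ω) ^ 2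
      = (1 / (J.card : ℝ)) ^ 2 * ∑ b ∈ J, ∑ b' ∈ J, Y b ω * Y b' ω := fun ω => by
    rw [mul_pow, sq (∑ b ∈ J, Y b ω), Finset.sum_mul_sum]
  simp_rw [h1]
  rw [integral_const_mul, integral_finsetSum _ fun b hb => integrable_finsetSum _ (hint b hb)]
  have h2 : ∀ b ∈ J, ∫ ω, ∑ b' ∈ J, Y b ω * Y b' ω ∂μ ≤ N * L ^ 2 := fun b hb => by
    rw [integral_finsetSum _ (hint b hb)]
    have h3 : ∑ b' ∈ J, ∫ ω, Y b ω * Y b' ω ∂μ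
        = ∑ b' ∈ J.filter (r b), ∫ ω, Y b ω * Y b' ω ∂μ := by
      refine (Finset.sum_subset (Finset.filter_subset _ _) fun b' hb' hnot => ?_).symm
      exact hr b hb b' hb' fun hrb => hnot (Finset.mem_filter.2 ⟨hb', hrb⟩)
    rw [h3]
    calc _ ≤ ∑ b' ∈ J.filter (r b), L ^ 2 := Finset.sum_le_sum fun b' hb' => by
          have hb'' := Finset.mem_of_mem_filter b' hb'
          calc _ ≤ ∫ _, L ^ 2 ∂μ := integral_mono (hint b hb b' hb'') (integrable_const _)
                fun ω => (le_abs_self _).trans (habs b hb b' hb'' ω)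
            _ = L ^ 2 := by simp
      _ = ((J.filter (r b)).card : ℝ) * L ^ 2 := by rw [Finset.sum_const, nsmul_eq_mul]
      _ ≤ N * L ^ 2 := by
          refine mul_le_mul_of_nonneg_right ?_ (sq_nonneg _)
          exact_mod_cast hN b hb
  calc _ ≤ (1 / (J.card : ℝ)) ^ 2 * ∑ b ∈ J, N * L ^ 2 :=
        mul_le_mul_of_nonneg_left (Finset.sum_le_sum h2) (sq_nonneg _)
    _ = ((J.card : ℝ) / J.card) * (L ^ 2 * (N / J.card)) := by
        rw [Finset.sum_const, nsmul_eq_mul]; ring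
    _ ≤ 1 * (L ^ 2 * (N / J.card)) :=
        mul_le_mul_of_nonneg_right (div_self_le_one _) (by positivity)
    _ = _ := one_mul _

end Kernel

/-! ### Counting subsets -/

lemma card_filter_superset_le {A T : Finset ℕ} (s : ℕ) (hA : A ⊆ T) :
    ((T.powersetCard s).filter (A ⊆ ·)).card ≤ (T.card - A.card).choose (s - A.card) := by
  classical
  rw [← Finset.card_sdiff_of_subset hA, ← Finset.card_powersetCard]
  refine Finset.card_le_card_of_injOn (fun B => B \ A) (fun B hB => ?_) fun B hB B' hB' h => ?_
  · simp only [Finset.coe_filter, Finset.mem_powersetCard, mem_ofPred_eq] at hB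
    simp only [Finset.mem_coe, Finset.mem_powersetCard]
    exact ⟨Finset.sdiff_subset_sdiff hB.1.1 subset_rfl, by
      rw [Finset.card_sdiff_of_subset hB.2, hB.1.2]⟩
  · simp only [Finset.coe_filter, Finset.mem_powersetCard, mem_ofPred_eq] at hB hB'
    simp only at h
    rw [← Finset.sdiff_union_of_subset hB.2, h, Finset.sdiff_union_of_subset hB'.2]

lemma card_filter_mem_eq {n s i : ℕ} (hi : i < n) (hs : 0 < s) :
    (((Finset.range n).powersetCard s).filter (i ∈ ·)).card = (n - 1).choose (s - 1) := by
  classical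
  have h1 : n - 1 = ((Finset.range n).erase i).card := by
    rw [Finset.card_erase_of_mem (Finset.mem_range.2 hi), Finset.card_range]
  rw [h1, ← Finset.card_powersetCard]
  refine Finset.card_nbij' (fun B => B.erase i) (fun B => insert i B) ?_ ?_ ?_ ?_
  · intro B hB
    simp only [Finset.coe_filter, Finset.mem_powersetCard, mem_ofPred_eq] at hB
    simp only [Finset.mem_coe, Finset.mem_powersetCard]
    exact ⟨Finset.erase_subset_erase _ hB.1.1, by rw [Finset.card_erase_of_mem hB.2, hB.1.2]⟩
  · intro B hB
    simp only [Finset.mem_coe, Finset.mem_powersetCard] at hB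
    simp only [Finset.coe_filter, Finset.mem_powersetCard, mem_ofPred_eq]
    have hiB : i ∉ B := fun h => (Finset.mem_erase.1 (hB.1 h)).1 rfl
    refine ⟨⟨Finset.insert_subset (Finset.mem_range.2 hi)
      (hB.1.trans (Finset.erase_subset _ _)), ?_⟩, Finset.mem_insert_self _ _⟩
    rw [Finset.card_insert_of_notMem hiB, hB.2]
    omega
  · intro B hB
    simp only [Finset.coe_filter, Finset.mem_powersetCard, mem_ofPred_eq] at hB
    exact Finset.insert_erase hB.2
  · intro B hB
    simp only [Finset.mem_coe, Finset.mem_powersetCard] at hB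
    exact Finset.erase_insert fun h => (Finset.mem_erase.1 (hB.1 h)).1 rfl

/-- Double counting: each observation lies in the same number of batches. -/
lemma sum_powersetCard_sum {n s : ℕ} (hs : 0 < s) (f : ℕ → ℝ) :
    ∑ B ∈ (Finset.range n).powersetCard s, ∑ i ∈ B, f i
      = ((n - 1).choose (s - 1) : ℝ) * ∑ i ∈ Finset.range n, f i := by
  classical
  have h1 : ∀ B ∈ (Finset.range n).powersetCard s, ∑ i ∈ B, f i
      = ∑ i ∈ Finset.range n, if i ∈ B then f i else 0 := fun B hB => by
    rw [← Finset.sum_filter, Finset.filter_mem_eq_inter,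
      Finset.inter_eq_right.2 (Finset.mem_powersetCard.1 hB).1]
  rw [Finset.sum_congr rfl h1, Finset.sum_comm, Finset.mul_sum]
  refine Finset.sum_congr rfl fun i hi => ?_
  rw [← Finset.sum_filter, Finset.sum_const, nsmul_eq_mul,
    card_filter_mem_eq (Finset.mem_range.1 hi) hs]

/-- The probability that a uniformly random batch contains a given observation. -/
lemma choose_ratio_one {n s : ℕ} (hs : 0 < s) (hn : s ≤ n) :
    ((n - 1).choose (s - 1) : ℝ) / n.choose s = s / n := by
  obtain ⟨s, rfl⟩ := Nat.exists_eq_succ_of_ne_zero hs.ne'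
  obtain ⟨n, rfl⟩ := Nat.exists_eq_succ_of_ne_zero (hs.trans_le hn).ne'
  have h := Nat.add_one_mul_choose_eq n s
  have hpos : (0 : ℝ) < (n.succ.choose s.succ : ℝ) := by exact_mod_cast Nat.choose_pos hn
  rw [div_eq_div_iff hpos.ne' (by positivity)]
  simp only [Nat.succ_sub_one]
  have h' : ((n.succ * n.choose s : ℕ) : ℝ) = ((n.succ.choose s.succ * s.succ : ℕ) : ℝ) := by
    rw [h]
  push_cast at h' ⊢
  linarith

/-- The probability that a random batch contains two given observations is `s (s - 1) / (n (n -
1))`; only its order `n⁻²` matters. -/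
lemma choose_ratio_two {n s : ℕ} (hs : 2 ≤ s) (hn : s ≤ n) :
    ((n - 2).choose (s - 2) : ℝ) / n.choose s ≤ (s * s : ℝ) / (n * (n - 1)) := by
  have h1 := choose_ratio_one (by omega : 0 < s) hn
  have h2 := choose_ratio_one (n := n - 1) (s := s - 1) (by omega) (by omega)
  rw [Nat.sub_sub, Nat.sub_sub] at h2
  have hpos : (0 : ℝ) < ((n - 1).choose (s - 1) : ℝ) := by
    exact_mod_cast Nat.choose_pos (by omega)
  have hn' : (2 : ℝ) ≤ n := by exact_mod_cast hs.trans hn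
  have hs' : (2 : ℝ) ≤ s := by exact_mod_cast hs
  have h3 : ((n - 2).choose (s - 2) : ℝ) / n.choose s
      = ((n - 2).choose (s - 2) : ℝ) / (n - 1).choose (s - 1)
        * (((n - 1).choose (s - 1) : ℝ) / n.choose s) := by
    rw [div_mul_div_cancel₀ hpos.ne']
  rw [h3, h1, h2, Nat.cast_sub (by omega), Nat.cast_sub (by omega), div_mul_div_comm,
    mul_comm (n : ℝ)]
  push_cast
  have : (0 : ℝ) < (n - 1) * n := by nlinarith
  gcongr
  linarith

lemma card_filter_not_disjoint_le {n s : ℕ} {B : Finset ℕ}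
    (hB : B ∈ (Finset.range n).powersetCard s) :
    (((Finset.range n).powersetCard s).filter fun B' => ¬ Disjoint B B').card
      ≤ s * (n - 1).choose (s - 1) := by
  classical
  rw [Finset.mem_powersetCard] at hB
  have hsub : ((Finset.range n).powersetCard s).filter (fun B' => ¬ Disjoint B B')
      ⊆ B.biUnion fun i => ((Finset.range n).powersetCard s).filter ({i} ⊆ ·) := fun B' hB' => by
    rw [Finset.mem_filter, Finset.not_disjoint_iff] at hB'
    obtain ⟨h1, i, hi, hi'⟩ := hB'
    exact Finset.mem_biUnion.2 ⟨i, hi, Finset.mem_filter.2 ⟨h1, by simpa using hi'⟩⟩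
  refine (Finset.card_le_card hsub).trans (Finset.card_biUnion_le.trans ?_)
  rw [← hB.2, ← smul_eq_mul]
  refine Finset.sum_le_card_nsmul _ _ _ fun i hi => ?_
  have := card_filter_superset_le (A := {i}) B.card
    (Finset.singleton_subset_iff.2 (hB.1 hi))
  simpa using this

/-- Union bound over the ordered pairs of distinct members of `B` that a second batch may also
contain. -/
lemma card_filter_two_le_inter_le {n s : ℕ} {B : Finset ℕ}
    (hB : B ∈ (Finset.range n).powersetCard s) :
    (((Finset.range n).powersetCard s).filter fun B' => 2 ≤ (B ∩ B').card).card
      ≤ s * s * (n - 2).choose (s - 2) := by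
  classical
  rw [Finset.mem_powersetCard] at hB
  have hsub : ((Finset.range n).powersetCard s).filter (fun B' => 2 ≤ (B ∩ B').card)
      ⊆ B.offDiag.biUnion fun q =>
        ((Finset.range n).powersetCard s).filter (({q.1, q.2} : Finset ℕ) ⊆ ·) := fun B' hB' => by
    rw [Finset.mem_filter] at hB'
    obtain ⟨i, hi, j, hj, hij⟩ := Finset.one_lt_card.1 (show 1 < (B ∩ B').card by omega)
    rw [Finset.mem_inter] at hi hj
    refine Finset.mem_biUnion.2 ⟨(i, j), Finset.mem_offDiag.2 ⟨hi.1, hj.1, hij⟩,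
      Finset.mem_filter.2 ⟨hB'.1, ?_⟩⟩
    simp [Finset.insert_subset_iff, hi.2, hj.2]
  refine (Finset.card_le_card hsub).trans (Finset.card_biUnion_le.trans ?_)
  calc _ ≤ B.offDiag.card • (n - 2).choose (s - 2) := by
        refine Finset.sum_le_card_nsmul _ _ _ fun q hq => ?_
        rw [Finset.mem_offDiag] at hq
        have := card_filter_superset_le (A := {q.1, q.2}) s (T := Finset.range n) (by
          simp only [Finset.insert_subset_iff, Finset.singleton_subset_iff]
          exact ⟨hB.1 hq.1, hB.1 hq.2.1⟩)
        rwa [Finset.card_pair hq.2.2, Finset.card_range] at this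
    _ ≤ _ := by
        rw [smul_eq_mul, Finset.offDiag_card, hB.2]
        exact Nat.mul_le_mul_right _ (Nat.sub_le _ _)

/-! ### Second moments of U-statistics -/

section UStat

variable {β : Type*} [MeasurableSpace β] {P : Measure β} [IsProbabilityMeasure P]
  {Ψ : Finset ℕ → (ℕ → β) → ℝ} {K : ℝ} {s : ℕ}

/-- The average of a kernel over all `s`-subsets of the first `n` observations. -/
def uStat (Ψ : Finset ℕ → (ℕ → β) → ℝ) (s n : ℕ) (d : ℕ → β) : ℝ :=
  (1 / (n.choose s : ℝ)) * ∑ B ∈ (Finset.range n).powersetCard s, Ψ B d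

lemma SymmKernel.measurable_uStat (h : SymmKernel Ψ K) (n : ℕ) : Measurable (uStat Ψ s n) :=
  (Finset.measurable_fun_sum _ fun B _ => h.measurable B).const_mul _

/-- The `b`-th block of length `s`. -/
def block (s b : ℕ) : Finset ℕ := (Finset.range s).map (addLeftEmbedding (b * s))

lemma card_block (s b : ℕ) : (block s b).card = s := by simp [block]

lemma disjoint_block {s b b' : ℕ} (h : b ≠ b') : Disjoint (block s b) (block s b') := by
  rw [Finset.disjoint_left]
  intro i hi hi'
  simp only [block, Finset.mem_map, Finset.mem_range, addLeftEmbedding_apply] at hi hi'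
  obtain ⟨k, hk, rfl⟩ := hi
  obtain ⟨k', hk', h'⟩ := hi'
  have h1 : (b * s + k) / s = b := by
    rw [mul_comm, Nat.mul_add_div (by omega), Nat.div_eq_of_lt hk, add_zero]
  have h2 : (b' * s + k') / s = b' := by
    rw [mul_comm, Nat.mul_add_div (by omega), Nat.div_eq_of_lt hk', add_zero]
  exact h (by rw [← h1, ← h', h2])

/-- The average of a kernel over the first `m` blocks. -/
def blockStat (Ψ : Finset ℕ → (ℕ → β) → ℝ) (s m : ℕ) (d : ℕ → β) : ℝ :=
  (1 / (m : ℝ)) * ∑ b ∈ Finset.range m, Ψ (block s b) d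

lemma SymmKernel.integral_mul_eq_zero_of_disjoint (h : SymmKernel Ψ K) {B B' : Finset ℕ}
    (hB' : B'.card = s) (hdisj : Disjoint B B')
    (h0 : ∫ d, Ψ (Finset.range s) d ∂(iidLaw P) = 0) :
    ∫ d, Ψ B d * Ψ B' d ∂(iidLaw P) = 0 := by
  rw [h.integral_mul_of_disjoint hdisj (h.measurable B) (h.abs_le B) (h.congr B),
    h.integral_eq hB', h0, mul_zero]

lemma SymmKernel.integral_sub_mean (h : SymmKernel Ψ K) :
    ∫ d, (Ψ (Finset.range s) d - ∫ d, Ψ (Finset.range s) d ∂(iidLaw P)) ∂(iidLaw P) = 0 := by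
  rw [integral_sub (integrable_of_measurable (h.measurable _) (h.abs_le _)) (integrable_const _)]
  simp

/-- Disjoint batches are uncorrelated after centring, and a proportion of at most `s * (s / n)` of
the batches meets a given one. Centring doubles the bound on the kernel. -/
lemma SymmKernel.integral_uStat_sub_sq_le (h : SymmKernel Ψ K) (hs : 0 < s) {n : ℕ}
    (hn : s ≤ n) :
    ∫ d, (uStat Ψ s n d - ∫ d, Ψ (Finset.range s) d ∂(iidLaw P)) ^ 2 ∂(iidLaw P)
      ≤ (2 * K) ^ 2 * (s * (s / n)) := by
  classical
  set m := ∫ d, Ψ (Finset.range s) d ∂(iidLaw P) with hm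
  have hmK : |m| ≤ K := by
    have := norm_integral_le_of_norm_le_const (μ := iidLaw P) (C := K)
      (f := Ψ (Finset.range s)) (Eventually.of_forall fun d => h.abs_le _ d)
    simpa using this
  have h' := h.sub_const m
  have hcard : ((Finset.range n).powersetCard s).card = n.choose s := by simp
  have hpos : (0 : ℝ) < (n.choose s : ℝ) := by exact_mod_cast Nat.choose_pos hn
  have := integral_sq_average_le (μ := iidLaw P) ((Finset.range n).powersetCard s)
    (Y := fun B d => Ψ B d - m) (L := 2 * K) (fun B _ => h'.measurable B)
    (fun B _ d => (h'.abs_le B d).trans (by linarith)) (fun B B' => ¬ Disjoint B B')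
    (fun B _ B' hB' hdisj => h'.integral_mul_eq_zero_of_disjoint
      (Finset.mem_powersetCard.1 hB').2 (not_not.1 hdisj) h.integral_sub_mean)
    (fun B hB => card_filter_not_disjoint_le hB)
  rw [hcard] at this
  have heq : ∀ d, uStat Ψ s n d - m
      = (1 / (n.choose s : ℝ)) * ∑ B ∈ (Finset.range n).powersetCard s, (Ψ B d - m) := fun d => by
    rw [Finset.sum_sub_distrib, Finset.sum_const, hcard, nsmul_eq_mul, mul_sub, ← mul_assoc,
      one_div_mul_cancel hpos.ne', one_mul]
    rfl
  simp_rw [heq]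
  refine this.trans (le_of_eq ?_)
  rw [Nat.cast_mul, mul_div_assoc, choose_ratio_one hs hn]

/-- Distinct blocks are disjoint, so each block is correlated only with itself. -/
lemma SymmKernel.integral_blockStat_sub_sq_le (h : SymmKernel Ψ K) {m : ℕ} (hm : 0 < m) :
    ∫ d, (blockStat Ψ s m d - ∫ d, Ψ (Finset.range s) d ∂(iidLaw P)) ^ 2 ∂(iidLaw P)
      ≤ (2 * K) ^ 2 * (1 / m) := by
  classical
  set a := ∫ d, Ψ (Finset.range s) d ∂(iidLaw P) with ha
  have hmK : |a| ≤ K := by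
    have := norm_integral_le_of_norm_le_const (μ := iidLaw P) (C := K)
      (f := Ψ (Finset.range s)) (Eventually.of_forall fun d => h.abs_le _ d)
    simpa using this
  have h' := h.sub_const a
  have hpos : (0 : ℝ) < m := by exact_mod_cast hm
  have := integral_sq_average_le (μ := iidLaw P) (Finset.range m)
    (Y := fun b d => Ψ (block s b) d - a) (L := 2 * K) (fun b _ => h'.measurable _)
    (fun b _ d => (h'.abs_le _ d).trans (by linarith)) (fun b b' => b = b')
    (fun b _ b' _ hdisj => h'.integral_mul_eq_zero_of_disjoint
      (card_block s b') (disjoint_block hdisj) h.integral_sub_mean) (N := 1)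
    (fun b hb => by
      rw [Finset.card_le_one]
      intro i hi j hj
      rw [Finset.mem_filter] at hi hj
      exact hi.2.symm.trans hj.2)
  rw [Finset.card_range, Nat.cast_one] at this
  have heq : ∀ d, blockStat Ψ s m d - a
      = (1 / (m : ℝ)) * ∑ b ∈ Finset.range m, (Ψ (block s b) d - a) := fun d => by
    rw [Finset.sum_sub_distrib, Finset.sum_const, Finset.card_range, nsmul_eq_mul, mul_sub,
      ← mul_assoc, one_div_mul_cancel hpos.ne', one_mul]
    rfl
  simp_rw [heq]
  exact this

/-- Hájek projection: the error is of second order. -/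
lemma SymmKernel.integral_uStat_sub_proj_sq_le (h : SymmKernel Ψ K) (hs : 2 ≤ s)
    (h0 : ∫ d, Ψ (Finset.range s) d ∂(iidLaw P) = 0) {n : ℕ} (hn : s ≤ n) :
    ∫ d, (uStat Ψ s n d - (s / n : ℝ) * ∑ i ∈ Finset.range n, proj P Ψ s (d i)) ^ 2 ∂(iidLaw P)
      ≤ ((s + 1) * K) ^ 2 * (s * s * ((s * s : ℝ) / (n * (n - 1)))) := by
  classical
  set π : β → ℝ := proj P Ψ s with hπ
  have hπm : ∀ i : ℕ, Measurable fun d : ℕ → β => π (d i) := fun i =>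
    h.measurable_proj.comp (measurable_pi_apply i)
  have hπ0 : ∫ x, π x ∂P = 0 := by rw [h.integral_proj (by omega), h0]
  -- The part of the kernel left after subtracting its projections on the single observations.
  let r : Finset ℕ → (ℕ → β) → ℝ := fun B d => Ψ B d - ∑ i ∈ B, π (d i)
  have hrm : ∀ B, Measurable (r B) := fun B =>
    (h.measurable B).sub (Finset.measurable_fun_sum _ fun i _ => hπm i)
  have hr : ∀ B, B.card = s → ∀ d, |r B d| ≤ (s + 1) * K := fun B hB d => by
    refine (abs_sub _ _).trans ?_
    have h1 : |∑ i ∈ B, π (d i)| ≤ s * K := by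
      refine (Finset.abs_sum_le_sum_abs _ _).trans ?_
      rw [← hB, ← nsmul_eq_mul]
      exact Finset.sum_le_card_nsmul _ _ _ fun i _ => h.abs_proj_le _
    have h2 := h.abs_le B d
    linarith
  have hrc : ∀ B d d', (∀ i ∈ B, d i = d' i) → r B d = r B d' := fun B d d' hd => by
    simp only [r]
    rw [h.congr B d d' hd, Finset.sum_congr rfl fun i hi => by rw [hd i hi]]
  have hcard : ((Finset.range n).powersetCard s).card = n.choose s := by simp
  have hpos : (0 : ℝ) < (n.choose s : ℝ) := by exact_mod_cast Nat.choose_pos hn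
  -- pairs of batches with at most one common observation
  have hcov : ∀ B, B.card = s → ∀ B', B'.card = s → ¬ 2 ≤ (B ∩ B').card →
      ∫ d, r B d * r B' d ∂(iidLaw P) = 0 := fun B hB B' hB' hlt => by
    have hprod : ∀ i, Integrable (fun d => r B d * π (d i)) (iidLaw P) := fun i =>
      integrable_of_measurable ((hrm B).mul (hπm i)) (L := ((s + 1) * K) * K) fun d => by
        rw [abs_mul]
        exact mul_le_mul (hr B hB d) (h.abs_proj_le _) (abs_nonneg _)
          ((abs_nonneg _).trans (hr B hB d))
    have hΨ : Integrable (fun d => r B d * Ψ B' d) (iidLaw P) :=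
      integrable_of_measurable ((hrm B).mul (h.measurable B')) (L := ((s + 1) * K) * K)
        fun d => by
        rw [abs_mul]
        exact mul_le_mul (hr B hB d) (h.abs_le _ _) (abs_nonneg _)
          ((abs_nonneg _).trans (hr B hB d))
    -- An observation outside `B` is independent of `r B`, and its projection has mean zero.
    have hout : ∀ i ∉ B, ∫ d, r B d * π (d i) ∂(iidLaw P) = 0 := fun i hi => by
      rw [integral_iidLaw_piecewise P B (hprod i)]
      have h1 : ∀ d d' : ℕ → β, r B (B.piecewise d d') * π (B.piecewise d d' i)
          = r B d * π (d' i) := fun d d' => by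
        rw [hrc B (B.piecewise d d') d fun j hj => by simp [hj], Finset.piecewise_eq_of_notMem _ _ _ hi]
      have h2 : ∫ d : ℕ → β, π (d i) ∂(iidLaw P) = 0 := by
        rw [integral_iidLaw_eval P i h.measurable_proj.aestronglyMeasurable, hπ0]
      simp_rw [h1, integral_const_mul, h2]
      simp
    have hexp : ∀ d, r B d * r B' d = r B d * Ψ B' d - ∑ i ∈ B', r B d * π (d i) := fun d => by
      rw [← Finset.mul_sum, ← mul_sub]
    simp_rw [hexp]
    rw [integral_sub hΨ (integrable_finsetSum _ fun i _ => hprod i),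
      integral_finsetSum _ fun i _ => hprod i]
    -- If the batches are disjoint, every term vanishes. If they share only `i`, conditioning on `B`
    -- turns `Ψ B'` into the projection at `i`, and this cancels the only surviving term of the sum.
    rcases (B ∩ B').eq_empty_or_nonempty with he | ⟨i, hi⟩
    · rw [h.integral_mul_of_disjoint (Finset.disjoint_iff_inter_eq_empty.2 he) (hrm B) (hr B hB)
        (hrc B), h.integral_eq hB', h0, mul_zero, zero_sub, neg_eq_zero]
      refine Finset.sum_eq_zero fun i hi => hout i fun hiB => ?_
      exact Finset.notMem_empty i (he ▸ Finset.mem_inter.2 ⟨hiB, hi⟩)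
    · have hsing : B ∩ B' = {i} := by
        refine Finset.eq_singleton_iff_unique_mem.2 ⟨hi, fun j hj => ?_⟩
        exact Finset.card_le_one.1 (by omega) j hj i hi
      rw [h.integral_mul_of_inter_singleton hB' hsing (hrm B) (hr B hB) (hrc B)]
      rw [Finset.sum_eq_single_of_mem i (Finset.mem_inter.1 hi).2 fun j hj hji => hout j fun hjB =>
        hji ?_, sub_self]
      rw [← Finset.mem_singleton, ← hsing]
      exact Finset.mem_inter.2 ⟨hjB, hj⟩
  have := integral_sq_average_le (μ := iidLaw P) ((Finset.range n).powersetCard s)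
    (Y := r) (L := (s + 1) * K) (fun B _ => hrm B)
    (fun B hB => hr B (Finset.mem_powersetCard.1 hB).2) (fun B B' => 2 ≤ (B ∩ B').card)
    (fun B hB B' hB' => hcov B (Finset.mem_powersetCard.1 hB).2 B'
      (Finset.mem_powersetCard.1 hB').2)
    (fun B hB => card_filter_two_le_inter_le hB)
  rw [hcard] at this
  -- Averaged over all batches, each projection is counted with the weight `s / n`, the probability
  -- that a batch contains the observation.
  have heq : ∀ d, uStat Ψ s n d - (s / n : ℝ) * ∑ i ∈ Finset.range n, π (d i)
      = (1 / (n.choose s : ℝ)) * ∑ B ∈ (Finset.range n).powersetCard s, r B d := fun d => by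
    simp only [r]
    rw [Finset.sum_sub_distrib, sum_powersetCard_sum (by omega) fun i => π (d i), mul_sub,
      ← mul_assoc, one_div_mul_eq_div (n.choose s : ℝ) ((n - 1).choose (s - 1) : ℝ),
      choose_ratio_one (by omega) hn]
    rfl
  simp_rw [heq]
  refine this.trans ?_
  rw [Nat.cast_mul, mul_div_assoc, Nat.cast_mul]
  exact mul_le_mul_of_nonneg_left (mul_le_mul_of_nonneg_left (choose_ratio_two hs hn)
    (by positivity)) (by positivity)

end UStat

/-! ### The compensator of the counting process of observed failures -/

/-- Applied to a Lipschitz function of the cumulative hazard, which is itself only absolutely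
continuous. -/
lemma AbsolutelyContinuousOnInterval.comp_of_dist_le {f g : ℝ → ℝ} {a b K : ℝ}
    (hg : AbsolutelyContinuousOnInterval g a b)
    (hf : ∀ x ∈ uIcc a b, ∀ y ∈ uIcc a b, dist (f x) (f y) ≤ K * dist (g x) (g y)) :
    AbsolutelyContinuousOnInterval f a b := by
  unfold AbsolutelyContinuousOnInterval at hg ⊢
  have h := hg.const_mul K
  rw [mul_zero] at h
  refine squeeze_zero' (Eventually.of_forall fun _ => Finset.sum_nonneg fun _ _ => dist_nonneg) ?_ h
  refine Eventually.filter_mono inf_le_right (mem_principal.2 fun I hI => ?_)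
  simp only [Set.mem_ofPred_eq]
  rw [Finset.mul_sum]
  exact Finset.sum_le_sum fun i hi => hf _ (hI.1 i hi).1 _ (hI.1 i hi).2

/-- The integrand is minus the derivative of `exp (-(e * Λ t))`. As `lam` is merely integrable, this
derivative exists only almost everywhere, and the fundamental theorem is used for absolutely
continuous functions. The function `y ↦ exp (-(e * y))` is `e`-Lipschitz for `y ≥ 0`, which is where
`Λ` takes its values. -/
lemma integral_mul_exp_neg_primitive {lam : ℝ → ℝ} (h0 : ∀ t, 0 ≤ lam t)
    (hint : Integrable lam) {e b : ℝ} (he : 0 ≤ e) (hb : 0 ≤ b) :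
    ∫ t in (0 : ℝ)..b, lam t * e * Real.exp (-(e * ∫ u in (0 : ℝ)..t, lam u))
      = 1 - Real.exp (-(e * ∫ u in (0 : ℝ)..b, lam u)) := by
  set Λ : ℝ → ℝ := fun t => ∫ u in (0 : ℝ)..t, lam u with hΛ
  have hii : IntervalIntegrable lam volume 0 b := hint.intervalIntegrable
  have hΛ0 : ∀ t ∈ uIcc 0 b, 0 ≤ Λ t := fun t ht => by
    rw [uIcc_of_le hb] at ht
    exact intervalIntegral.integral_nonneg ht.1 fun u _ => h0 u
  have hac : AbsolutelyContinuousOnInterval Λ 0 b :=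
    hii.absolutelyContinuousOnInterval_intervalIntegral left_mem_uIcc
  have hlip : ∀ y₁ y₂ : ℝ, 0 ≤ y₁ → y₁ ≤ y₂ →
      |Real.exp (-(e * y₁)) - Real.exp (-(e * y₂))| ≤ e * (y₂ - y₁) := fun y₁ y₂ h1 h2 => by
    have h3 : Real.exp (-(e * y₂)) = Real.exp (-(e * y₁)) * Real.exp (-(e * (y₂ - y₁))) := by
      rw [← Real.exp_add]; congr 1; ring
    have h4 : Real.exp (-(e * y₁)) ≤ 1 := Real.exp_le_one_iff.2 (by nlinarith)
    have h5 := Real.add_one_le_exp (-(e * (y₂ - y₁)))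
    have h6 : Real.exp (-(e * (y₂ - y₁))) ≤ 1 :=
      Real.exp_le_one_iff.2 (by have := mul_nonneg he (sub_nonneg.2 h2); linarith)
    have h7 := Real.exp_pos (-(e * y₁))
    have h8 : Real.exp (-(e * y₁)) - Real.exp (-(e * y₂))
        = Real.exp (-(e * y₁)) * (1 - Real.exp (-(e * (y₂ - y₁)))) := by rw [h3]; ring
    rw [h8, abs_of_nonneg (mul_nonneg h7.le (by linarith))]
    nlinarith
  have hac2 : AbsolutelyContinuousOnInterval (fun t => Real.exp (-(e * Λ t))) 0 b := by
    refine AbsolutelyContinuousOnInterval.comp_of_dist_le hac (K := e) fun x hx y hy => ?_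
    rw [Real.dist_eq, Real.dist_eq]
    rcases le_total (Λ x) (Λ y) with h | h
    · rw [abs_sub_comm (Λ x), abs_of_nonneg (sub_nonneg.2 h)]
      exact hlip _ _ (hΛ0 x hx) h
    · rw [abs_of_nonneg (sub_nonneg.2 h), abs_sub_comm]
      exact hlip _ _ (hΛ0 y hy) h
  have hder : ∀ᵐ t, t ∈ uIcc 0 b →
      lam t * e * Real.exp (-(e * Λ t)) = -deriv (fun t => Real.exp (-(e * Λ t))) t := by
    filter_upwards [hii.ae_hasDerivAt_integral] with t ht htb
    have h1 : HasDerivAt (fun t => Real.exp (-(e * Λ t)))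
        (Real.exp (-(e * Λ t)) * -(e * lam t)) t :=
      ((ht htb 0 left_mem_uIcc).const_mul e).neg.exp
    rw [h1.deriv]
    ring
  rw [intervalIntegral.integral_congr_ae (hder.mono fun t ht htb => ht (uIoc_subset_uIcc htb)),
    intervalIntegral.integral_neg, hac2.integral_deriv_eq_sub]
  simp [hΛ]

/-! ### The law of a failure time under conditionally independent censoring. -/

section CondIndep

variable {Ω : Type*} [MeasurableSpace Ω] {μ : Measure Ω} [IsProbabilityMeasure μ] {p : ℕ}
  {X : Ω → EuclideanSpace ℝ (Fin p)} {T C : Ω → ℝ≥0∞}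

/-- Conditional independence, tested on functions of the conditioning variable. -/
lemma CondIndepGiven.integral_mul_indicator (hX : Measurable X) (hT : Measurable T)
    (hC : Measurable C) (h : CondIndepGiven μ X T C) {I B : Set ℝ≥0∞} (hI : MeasurableSet I)
    (hB : MeasurableSet B) {φ g : EuclideanSpace ℝ (Fin p) → ℝ} (hφ : Measurable φ)
    (hφi : Integrable (fun ω => φ (X ω)) μ)
    (hg : μ⟦T ⁻¹' I | MeasurableSpace.comap X inferInstance⟧ =ᵐ[μ] fun ω => g (X ω))
    (hgm : Measurable g) {L : ℝ} (hgL : ∀ x, |g x| ≤ L) :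
    ∫ ω, φ (X ω) * (T ⁻¹' I ∩ C ⁻¹' B).indicator (fun _ => (1 : ℝ)) ω ∂μ
      = ∫ ω, φ (X ω) * g (X ω) * (C ⁻¹' B).indicator (fun _ => (1 : ℝ)) ω ∂μ := by
  have hm : MeasurableSpace.comap X inferInstance ≤ ‹MeasurableSpace Ω› := hX.comap_le
  have hXm : ∀ f : EuclideanSpace ℝ (Fin p) → ℝ, Measurable f →
      StronglyMeasurable[MeasurableSpace.comap X inferInstance] fun ω => f (X ω) := fun f hf =>
    (hf.comp (comap_measurable X)).stronglyMeasurable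
  have hind : ∀ S : Set Ω, MeasurableSet S →
      Integrable (S.indicator fun _ => (1 : ℝ)) μ := fun S hS =>
    (integrable_const 1).indicator hS
  have hbdd : ∀ S : Set Ω, ∀ᵐ ω ∂μ, ‖S.indicator (fun _ => (1 : ℝ)) ω‖ ≤ 1 := fun S =>
    Eventually.of_forall fun ω => by
      by_cases hω : ω ∈ S <;> simp [hω]
  -- A function of `X` is taken out of the conditional expectation, so an indicator can be exchanged
  -- for its conditional probability.
  have pull : ∀ (f : EuclideanSpace ℝ (Fin p) → ℝ), Measurable f →
      Integrable (fun ω => f (X ω)) μ → ∀ S : Set Ω, MeasurableSet S →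
      ∫ ω, f (X ω) * (S.indicator (fun _ => (1 : ℝ))) ω ∂μ
        = ∫ ω, f (X ω) * (μ⟦S | MeasurableSpace.comap X inferInstance⟧) ω ∂μ :=
    fun f hf hfi S hS => by
      have h1 := condExp_mul_of_stronglyMeasurable_left (μ := μ) (hXm f hf)
        (g := S.indicator fun _ => (1 : ℝ))
        (hfi.mul_bdd (hind S hS).1 (hbdd S)) (hind S hS)
      rw [← integral_condExp hm]
      exact integral_congr_ae h1
  have hφg : Integrable (fun ω => φ (X ω) * g (X ω)) μ :=
    hφi.mul_bdd (hgm.comp hX).aestronglyMeasurable (Eventually.of_forall fun ω => hgL (X ω))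
  rw [pull φ hφ hφi _ ((hT hI).inter (hC hB)),
    pull (fun x => φ x * g x) (hφ.mul hgm) hφg _ (hC hB)]
  refine integral_congr_ae ?_
  filter_upwards [h I B hI hB, hg] with ω h1 h2
  rw [h1, Pi.mul_apply, h2, mul_assoc]

/-- The model for one subject: given the covariate `X`, which is bounded, the failure time has hazard
`lam t * exp ⟪θ₀, X⟫` on `[0, τ]`, with `lam` nonnegative and integrable on the line, and is
independent of the censoring time. -/
structure HazardModel (μ : Measure Ω) (τ : ℝ) (lam : ℝ → ℝ) (θ₀ : EuclideanSpace ℝ (Fin p))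
    (X : Ω → EuclideanSpace ℝ (Fin p)) (T C : Ω → ℝ≥0∞) (R : ℝ) : Prop where
  measurable_X : Measurable X
  measurable_T : Measurable T
  measurable_C : Measurable C
  measurable_lam : Measurable lam
  lam_nonneg : ∀ t, 0 ≤ lam t
  integrable_lam : Integrable lam
  norm_le : ∀ᵐ ω ∂μ, ‖X ω‖ ≤ R
  condIndep : CondIndepGiven μ X T C
  survival : ∀ t ∈ Icc 0 τ,
    μ⟦T ⁻¹' Ioi (ENNReal.ofReal t) | MeasurableSpace.comap X inferInstance⟧
      =ᵐ[μ] fun ω => Real.exp (-(Real.exp ⟪θ₀, X ω⟫ * ∫ u in (0 : ℝ)..t, lam u))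

namespace HazardModel

variable {τ R : ℝ} {lam : ℝ → ℝ} {θ₀ : EuclideanSpace ℝ (Fin p)}

lemma measurable_exp_inner (θ₀ : EuclideanSpace ℝ (Fin p)) :
    Measurable fun x : EuclideanSpace ℝ (Fin p) => Real.exp ⟪θ₀, x⟫ :=
  Real.measurable_exp.comp (measurable_const.inner measurable_id)

lemma exp_inner_le {x : EuclideanSpace ℝ (Fin p)} (hx : ‖x‖ ≤ R) :
    Real.exp ⟪θ₀, x⟫ ≤ Real.exp (‖θ₀‖ * R) :=
  Real.exp_le_exp.2 ((real_inner_le_norm _ _).trans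
    (mul_le_mul_of_nonneg_left hx (norm_nonneg _)))

lemma integrable_exp_inner (h : HazardModel μ τ lam θ₀ X T C R) :
    Integrable (fun ω => Real.exp ⟪θ₀, X ω⟫) μ := by
  refine Integrable.of_bound ((measurable_exp_inner θ₀).comp h.measurable_X).aestronglyMeasurable
    (Real.exp (‖θ₀‖ * R)) ?_
  filter_upwards [h.norm_le] with ω hω
  rw [Real.norm_of_nonneg (Real.exp_pos _).le]
  exact exp_inner_le hω

lemma primitive_nonneg (h : HazardModel μ τ lam θ₀ X T C R) {t : ℝ} (ht : 0 ≤ t) :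
    0 ≤ ∫ u in (0 : ℝ)..t, lam u :=
  intervalIntegral.integral_nonneg ht fun u _ => h.lam_nonneg u

lemma measurable_primitive (h : HazardModel μ τ lam θ₀ X T C R) :
    Measurable fun t : ℝ => ∫ u in (0 : ℝ)..t, lam u :=
  (intervalIntegral.continuous_primitive (fun _ _ => h.integrable_lam.intervalIntegrable)
    0).measurable

/-- Survival beyond `t` may be replaced by its conditional probability given `X` even on events of
the censoring time. The form with nonnegative integrals prepares the exchange of time and
probability. -/
lemma lintegral_survival (h : HazardModel μ τ lam θ₀ X T C R)
    {A : Set (EuclideanSpace ℝ (Fin p))} (hA : MeasurableSet A) {B : Set ℝ≥0∞}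
    (hB : MeasurableSet B) {t : ℝ} (ht : t ∈ Icc 0 τ) {φ : EuclideanSpace ℝ (Fin p) → ℝ}
    (hφ : Measurable φ) (hφ0 : ∀ x, 0 ≤ φ x) (hφi : Integrable (fun ω => φ (X ω)) μ) :
    ∫⁻ ω in X ⁻¹' A ∩ C ⁻¹' B, ENNReal.ofReal (φ (X ω)) *
        (T ⁻¹' Ioi (ENNReal.ofReal t)).indicator 1 ω ∂μ
      = ∫⁻ ω in X ⁻¹' A ∩ C ⁻¹' B, ENNReal.ofReal (φ (X ω) *
        Real.exp (-(Real.exp ⟪θ₀, X ω⟫ * ∫ u in (0 : ℝ)..t, lam u))) ∂μ := by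
  set g : EuclideanSpace ℝ (Fin p) → ℝ :=
    fun x => Real.exp (-(Real.exp ⟪θ₀, x⟫ * ∫ u in (0 : ℝ)..t, lam u)) with hg
  have hgm : Measurable g :=
    Real.measurable_exp.comp (((measurable_exp_inner θ₀).mul_const _).neg)
  have hg0 : ∀ x, 0 ≤ g x := fun x => (Real.exp_pos _).le
  have hg1 : ∀ x, |g x| ≤ 1 := fun x => by
    rw [abs_of_nonneg (hg0 x)]
    exact Real.exp_le_one_iff.2 (neg_nonpos.2
      (mul_nonneg (Real.exp_pos _).le (h.primitive_nonneg ht.1)))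
  have hAi : ∀ ω, A.indicator φ (X ω) = (X ⁻¹' A).indicator (fun ω => φ (X ω)) ω := fun ω => rfl
  have hφAi : Integrable (fun ω => A.indicator φ (X ω)) μ := by
    simp_rw [hAi]
    exact hφi.indicator (h.measurable_X hA)
  have hφA0 : ∀ x, 0 ≤ A.indicator φ x := fun x => indicator_nonneg (fun x _ => hφ0 x) x
  have hTI := h.measurable_T (measurableSet_Ioi (a := ENNReal.ofReal t))
  have key := h.condIndep.integral_mul_indicator h.measurable_X h.measurable_T h.measurable_C
    (measurableSet_Ioi (a := ENNReal.ofReal t)) hB (hφ.indicator hA) hφAi (h.survival t ht) hgm hg1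
  have hind : ∀ S : Set Ω, ∀ ω, 0 ≤ S.indicator (fun _ => (1 : ℝ)) ω := fun S =>
    indicator_nonneg fun _ _ => zero_le_one
  have hbdd : ∀ S : Set Ω, ∀ᵐ ω ∂μ, ‖S.indicator (fun _ => (1 : ℝ)) ω‖ ≤ 1 := fun S =>
    Eventually.of_forall fun ω => by by_cases hω : ω ∈ S <;> simp [hω]
  have hm : ∀ S : Set Ω, MeasurableSet S →
      AEStronglyMeasurable (S.indicator fun _ => (1 : ℝ)) μ := fun S hS =>
    (measurable_const.indicator hS).aestronglyMeasurable
  have hφg : Integrable (fun ω => A.indicator φ (X ω) * g (X ω)) μ :=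
    hφAi.mul_bdd (hgm.comp h.measurable_X).aestronglyMeasurable
      (Eventually.of_forall fun ω => hg1 (X ω))
  have key' := congrArg ENNReal.ofReal key
  rw [ofReal_integral_eq_lintegral_ofReal
      (hφAi.mul_bdd (hm _ (hTI.inter (h.measurable_C hB))) (hbdd _))
      (Eventually.of_forall fun ω => mul_nonneg (hφA0 _) (hind _ _)),
    ofReal_integral_eq_lintegral_ofReal
      (hφg.mul_bdd (hm _ (h.measurable_C hB)) (hbdd _))
      (Eventually.of_forall fun ω => mul_nonneg (mul_nonneg (hφA0 _) (hg0 _)) (hind _ _))] at key'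
  rw [← lintegral_indicator ((h.measurable_X hA).inter (h.measurable_C hB)),
    ← lintegral_indicator ((h.measurable_X hA).inter (h.measurable_C hB))]
  convert key' using 1
  · refine lintegral_congr fun ω => ?_
    by_cases h1 : X ω ∈ A <;> by_cases h2 : C ω ∈ B <;>
      by_cases h3 : T ω ∈ Ioi (ENNReal.ofReal t) <;>
      simp only [indicator, mem_inter_iff, mem_preimage, h1, h2, h3] <;> simp
  · refine lintegral_congr fun ω => ?_
    by_cases h1 : X ω ∈ A <;> by_cases h2 : C ω ∈ B <;>
      simp only [indicator, mem_inter_iff, mem_preimage, h1, h2] <;> simp [g]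

/-- A random variable has at most countably many atoms. Negative `t` are excluded since
`ENNReal.ofReal` sends them all to `0`, which may be an atom. -/
lemma ae_level_null (hT : Measurable T) :
    ∀ᵐ t : ℝ, 0 < t → μ {ω | T ω = ENNReal.ofReal t} = 0 := by
  have hc := Measure.countable_meas_level_set_pos (μ := μ) (g := fun ω => (T ω).toReal)
    hT.ennreal_toReal
  filter_upwards [hc.ae_notMem volume] with t ht h0
  simp only [not_lt, nonpos_iff_eq_zero] at ht
  refine measure_mono_null (fun ω hω => ?_) ht
  simp only [Set.mem_ofPred_eq] at hω ⊢
  rw [hω, ENNReal.toReal_ofReal h0.le]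

lemma measurable_survival (h : HazardModel μ τ lam θ₀ X T C R) :
    Measurable fun q : Ω × ℝ =>
      Real.exp (-(Real.exp ⟪θ₀, X q.1⟫ * ∫ u in (0 : ℝ)..q.2, lam u)) :=
  Real.measurable_exp.comp
    ((((measurable_exp_inner θ₀).comp (h.measurable_X.comp measurable_fst)).mul
      (h.measurable_primitive.comp measurable_snd)).neg)

lemma survival_le_one (h : HazardModel μ τ lam θ₀ X T C R) {t : ℝ} (ht : 0 ≤ t) (ω : Ω) :
    Real.exp (-(Real.exp ⟪θ₀, X ω⟫ * ∫ u in (0 : ℝ)..t, lam u)) ≤ 1 :=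
  Real.exp_le_one_iff.2 (neg_nonpos.2 (mul_nonneg (Real.exp_pos _).le (h.primitive_nonneg ht)))

lemma measure_sdiff_eq_lintegral {V W : Set Ω} (hV : MeasurableSet V) (hVW : V ⊆ W) {g : Ω → ℝ}
    (hg : Measurable g) (hg0 : ∀ ω, 0 ≤ g ω) (hg1 : ∀ ω, g ω ≤ 1)
    (h : μ V = ∫⁻ ω in W, ENNReal.ofReal (g ω) ∂μ) :
    μ (W \ V) = ∫⁻ ω in W, ENNReal.ofReal (1 - g ω) ∂μ := by
  have h3 : ∀ ω, ENNReal.ofReal (1 - g ω) = 1 - ENNReal.ofReal (g ω) := fun ω => by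
    rw [ENNReal.ofReal_sub _ (hg0 ω), ENNReal.ofReal_one]
  simp_rw [h3]
  rw [measure_sdiff hVW hV.nullMeasurableSet (measure_ne_top _ _), h,
    lintegral_sub hg.ennreal_ofReal, setLIntegral_one]
  · rw [← h]; exact measure_ne_top _ _
  · exact Eventually.of_forall fun ω => by simpa using hg1 ω

lemma measure_failure_le_eq (h : HazardModel μ τ lam θ₀ X T C R)
    {A : Set (EuclideanSpace ℝ (Fin p))} (hA : MeasurableSet A) {B : Set ℝ≥0∞}
    (hB : MeasurableSet B) {b : ℝ} (hb : b ∈ Icc 0 τ) :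
    μ (X ⁻¹' A ∩ C ⁻¹' B ∩ T ⁻¹' Iic (ENNReal.ofReal b))
      = ∫⁻ ω in X ⁻¹' A ∩ C ⁻¹' B, ENNReal.ofReal
        (1 - Real.exp (-(Real.exp ⟪θ₀, X ω⟫ * ∫ u in (0 : ℝ)..b, lam u))) ∂μ := by
  have hW : MeasurableSet (X ⁻¹' A ∩ C ⁻¹' B) :=
    (h.measurable_X hA).inter (h.measurable_C hB)
  have hTm := h.measurable_T (measurableSet_Ioi (a := ENNReal.ofReal b))
  have h1 := h.lintegral_survival hA hB hb (φ := fun _ => 1) measurable_const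
    (fun _ => zero_le_one) (integrable_const _)
  have h1' : μ (T ⁻¹' Ioi (ENNReal.ofReal b) ∩ (X ⁻¹' A ∩ C ⁻¹' B))
      = ∫⁻ ω in X ⁻¹' A ∩ C ⁻¹' B, ENNReal.ofReal
        (Real.exp (-(Real.exp ⟪θ₀, X ω⟫ * ∫ u in (0 : ℝ)..b, lam u))) ∂μ := by
    rw [← Measure.restrict_apply hTm, ← lintegral_indicator_one hTm]
    simpa only [ENNReal.ofReal_one, one_mul] using h1
  have h2 : X ⁻¹' A ∩ C ⁻¹' B ∩ T ⁻¹' Iic (ENNReal.ofReal b)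
      = (X ⁻¹' A ∩ C ⁻¹' B) \ (T ⁻¹' Ioi (ENNReal.ofReal b) ∩ (X ⁻¹' A ∩ C ⁻¹' B)) := by
    ext ω
    simp only [mem_inter_iff, mem_preimage, mem_Iic, Set.mem_sdiff, mem_Ioi, not_and]
    constructor
    · exact fun hω => ⟨hω.1, fun hlt => absurd hω.2 (not_le.2 hlt)⟩
    · exact fun hω => ⟨hω.1, not_lt.1 fun hlt => hω.2 hlt hω.1.1 hω.1.2⟩
  rw [h2]
  have hgm : Measurable fun ω =>
      Real.exp (-(Real.exp ⟪θ₀, X ω⟫ * ∫ u in (0 : ℝ)..b, lam u)) :=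
    Real.measurable_exp.comp
      ((((measurable_exp_inner θ₀).comp h.measurable_X).mul_const _).neg)
  exact measure_sdiff_eq_lintegral (hTm.inter hW) inter_subset_right hgm
    (fun ω => (Real.exp_pos _).le) (fun ω => h.survival_le_one hb.1 ω) h1'

/-- Being at risk means `t ≤ T`, while the survival function concerns `t < T`; the two events differ
by a null set for almost every `t`. -/
lemma setLIntegral_atRisk (h : HazardModel μ τ lam θ₀ X T C R)
    {A : Set (EuclideanSpace ℝ (Fin p))} (hA : MeasurableSet A) {B : Set ℝ≥0∞}
    (hB : MeasurableSet B) : ∀ᵐ t : ℝ, t ∈ Ioc 0 τ →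
      ENNReal.ofReal (lam t) * ∫⁻ ω in X ⁻¹' A ∩ C ⁻¹' B,
        ENNReal.ofReal (Real.exp ⟪θ₀, X ω⟫) *
          (T ⁻¹' Ici (ENNReal.ofReal t)).indicator 1 ω ∂μ
      = ∫⁻ ω in X ⁻¹' A ∩ C ⁻¹' B, ENNReal.ofReal (lam t * Real.exp ⟪θ₀, X ω⟫ *
          Real.exp (-(Real.exp ⟪θ₀, X ω⟫ * ∫ u in (0 : ℝ)..t, lam u))) ∂μ := by
  filter_upwards [ae_level_null (μ := μ) h.measurable_T] with t ht htb
  have h1 := h.lintegral_survival hA hB ⟨htb.1.le, htb.2⟩ (measurable_exp_inner θ₀)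
    (fun x => (Real.exp_pos _).le) h.integrable_exp_inner
  have h2 : ∫⁻ ω in X ⁻¹' A ∩ C ⁻¹' B, ENNReal.ofReal (Real.exp ⟪θ₀, X ω⟫) *
        (T ⁻¹' Ici (ENNReal.ofReal t)).indicator 1 ω ∂μ
      = ∫⁻ ω in X ⁻¹' A ∩ C ⁻¹' B, ENNReal.ofReal (Real.exp ⟪θ₀, X ω⟫) *
        (T ⁻¹' Ioi (ENNReal.ofReal t)).indicator 1 ω ∂μ := by
    refine lintegral_congr_ae (ae_restrict_of_ae ?_)
    have h3 : ∀ᵐ ω ∂μ, T ω ≠ ENNReal.ofReal t := by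
      rw [ae_iff]; simpa using ht htb.1
    filter_upwards [h3] with ω hω
    simp only [indicator, mem_preimage, mem_Ici, mem_Ioi, (Ne.symm hω).le_iff_lt]
  rw [h2, h1, ← lintegral_const_mul' _ _ ENNReal.ofReal_ne_top]
  refine lintegral_congr fun ω => ?_
  rw [mul_assoc, ENNReal.ofReal_mul (h.lam_nonneg t)]

/-- The compensator identity for a failure before `b`. After Tonelli, the time integral for a fixed
subject is that of its density, `1 - exp (-(e * Λ b))`. -/
lemma measure_failure_le (h : HazardModel μ τ lam θ₀ X T C R)
    {A : Set (EuclideanSpace ℝ (Fin p))} (hA : MeasurableSet A) {B : Set ℝ≥0∞}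
    (hB : MeasurableSet B) {b : ℝ} (hb : b ∈ Icc 0 τ) :
    μ (X ⁻¹' A ∩ C ⁻¹' B ∩ T ⁻¹' Iic (ENNReal.ofReal b))
      = ∫⁻ t in Ioc 0 b, ENNReal.ofReal (lam t) * ∫⁻ ω in X ⁻¹' A ∩ C ⁻¹' B,
        ENNReal.ofReal (Real.exp ⟪θ₀, X ω⟫) *
          (T ⁻¹' Ici (ENNReal.ofReal t)).indicator 1 ω ∂μ := by
  rw [h.measure_failure_le_eq hA hB hb]
  have hR := (h.setLIntegral_atRisk hA hB).mono
    fun t ht (htb : t ∈ Ioc 0 b) => ht ⟨htb.1, htb.2.trans hb.2⟩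
  rw [setLIntegral_congr_fun_ae measurableSet_Ioc hR, lintegral_lintegral_swap]
  · refine lintegral_congr fun ω => ?_
    rw [← integral_mul_exp_neg_primitive h.lam_nonneg h.integrable_lam (Real.exp_pos _).le hb.1,
      intervalIntegral.integral_of_le hb.1, ofReal_integral_eq_lintegral_ofReal]
    · refine ((h.integrable_lam.integrableOn).mul_const _).mul_bdd (c := 1) ?_ ?_
      · exact (h.measurable_survival.comp
          (measurable_const.prodMk measurable_id)).aestronglyMeasurable
      · rw [ae_restrict_iff' measurableSet_Ioc]
        refine Eventually.of_forall fun t ht => ?_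
        rw [Real.norm_of_nonneg (Real.exp_pos _).le]
        exact h.survival_le_one ht.1.le ω
    · exact Eventually.of_forall fun t => mul_nonneg
        (mul_nonneg (h.lam_nonneg t) (Real.exp_pos _).le) (Real.exp_pos _).le
  · have h1 : Measurable fun q : ℝ × Ω => lam q.1 := h.measurable_lam.comp measurable_fst
    have h2 : Measurable fun q : ℝ × Ω => Real.exp ⟪θ₀, X q.2⟫ :=
      (measurable_exp_inner θ₀).comp (h.measurable_X.comp measurable_snd)
    have h3 := h.measurable_survival.comp (measurable_swap (α := ℝ) (β := Ω))
    exact ((h1.mul h2).mul h3).ennreal_ofReal.aemeasurable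

end HazardModel

end CondIndep

/-! ### The joint law of covariate, censoring time and failure time. -/

namespace HazardModel

variable {Ω : Type*} [MeasurableSpace Ω] {μ : Measure Ω} [IsProbabilityMeasure μ] {p : ℕ}
  {X : Ω → EuclideanSpace ℝ (Fin p)} {T C : Ω → ℝ≥0∞}
variable {τ R : ℝ} {lam : ℝ → ℝ} {θ₀ : EuclideanSpace ℝ (Fin p)}

/-- The intensity of the failure process at time `q.1`. -/
def intensity (lam : ℝ → ℝ) (θ₀ : EuclideanSpace ℝ (Fin p)) (X : Ω → EuclideanSpace ℝ (Fin p))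
    (T : Ω → ℝ≥0∞) (q : ℝ × Ω) : ℝ≥0∞ :=
  ENNReal.ofReal (lam q.1) * (ENNReal.ofReal (Real.exp ⟪θ₀, X q.2⟫) *
    (T ⁻¹' Ici (ENNReal.ofReal q.1)).indicator 1 q.2)


lemma measurable_intensity (h : HazardModel μ τ lam θ₀ X T C R) :
    Measurable (intensity lam θ₀ X T) := by
  have h1 : Measurable fun q : ℝ × Ω => lam q.1 := h.measurable_lam.comp measurable_fst
  have h2 : Measurable fun q : ℝ × Ω => Real.exp ⟪θ₀, X q.2⟫ :=
    (measurable_exp_inner θ₀).comp (h.measurable_X.comp measurable_snd)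
  have h3 : MeasurableSet {q : ℝ × Ω | ENNReal.ofReal q.1 ≤ T q.2} :=
    measurableSet_le measurable_fst.ennreal_ofReal (h.measurable_T.comp measurable_snd)
  exact h1.ennreal_ofReal.mul (h2.ennreal_ofReal.mul
    ((measurable_const (a := (1 : ℝ≥0∞))).indicator h3))

/-- The law of covariate, censoring time and failure time, up to the end of the study. -/
lemma map_failure_eq (h : HazardModel μ τ lam θ₀ X T C R) (hτ : 0 ≤ τ) :
    (μ.restrict (T ⁻¹' Iic (ENNReal.ofReal τ))).map (fun ω => (X ω, C ω, (T ω).toReal))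
      = (((volume.restrict (Ioc 0 τ)).prod μ).withDensity (intensity lam θ₀ X T)).map
        (fun q => (X q.2, C q.2, q.1)) := by
  have hm1 : Measurable fun ω => (X ω, C ω, (T ω).toReal) :=
    h.measurable_X.prodMk (h.measurable_C.prodMk h.measurable_T.ennreal_toReal)
  have hm2 : Measurable fun q : ℝ × Ω => (X q.2, C q.2, q.1) :=
    (h.measurable_X.comp measurable_snd).prodMk
      ((h.measurable_C.comp measurable_snd).prodMk measurable_fst)
  set M₁ := (μ.restrict (T ⁻¹' Iic (ENNReal.ofReal τ))).map
    (fun ω => (X ω, C ω, (T ω).toReal)) with hM₁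
  set M₂ := (((volume.restrict (Ioc 0 τ)).prod μ).withDensity (intensity lam θ₀ X T)).map
    (fun q => (X q.2, C q.2, q.1)) with hM₂
  refine Measure.ext_prod₃ fun {A B U} hA hB hU => ?_
  have hAB : MeasurableSet (A ×ˢ B) := hA.prod hB
  have hassoc : ∀ V : Set ℝ, A ×ˢ B ×ˢ V
      = (A ×ˢ B ×ˢ univ) ∩ (fun z : _ × ℝ≥0∞ × ℝ => z.2.2) ⁻¹' V := fun V => by
    ext z; simp [and_assoc]
  have hm3 : Measurable fun z : EuclideanSpace ℝ (Fin p) × ℝ≥0∞ × ℝ => z.2.2 :=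
    measurable_snd.snd
  have hS : MeasurableSet (A ×ˢ B ×ˢ (univ : Set ℝ)) := hA.prod (hB.prod MeasurableSet.univ)
  -- For fixed `A` and `B` both sides are finite measures on the time axis, which half-lines
  -- determine. For `b < 0` both vanish; otherwise the half-line is cut at `min b τ`.
  have key : (M₁.restrict (A ×ˢ B ×ˢ univ)).map (fun z => z.2.2)
      = (M₂.restrict (A ×ˢ B ×ˢ univ)).map (fun z => z.2.2) := by
    refine Measure.ext_of_Iic _ _ fun b => ?_
    rw [Measure.map_apply hm3 measurableSet_Iic, Measure.map_apply hm3 measurableSet_Iic,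
      Measure.restrict_apply (hm3 measurableSet_Iic), Measure.restrict_apply (hm3 measurableSet_Iic),
      inter_comm, ← hassoc]
    have hAbB : MeasurableSet (A ×ˢ B ×ˢ Iic b) := hA.prod (hB.prod measurableSet_Iic)
    have hpre : (fun q : ℝ × Ω => (X q.2, C q.2, q.1)) ⁻¹' (A ×ˢ B ×ˢ Iic b)
        = Iic b ×ˢ (X ⁻¹' A ∩ C ⁻¹' B) := by
      ext q; simp only [mem_preimage, mem_prod, mem_inter_iff]; tauto
    have hr : M₂ (A ×ˢ B ×ˢ Iic b) = ∫⁻ t in Iic b ∩ Ioc 0 τ, ENNReal.ofReal (lam t) *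
        ∫⁻ ω in X ⁻¹' A ∩ C ⁻¹' B, ENNReal.ofReal (Real.exp ⟪θ₀, X ω⟫) *
          (T ⁻¹' Ici (ENNReal.ofReal t)).indicator 1 ω ∂μ := by
      rw [hM₂, Measure.map_apply hm2 hAbB, withDensity_apply _ (hm2 hAbB), hpre,
        ← Measure.prod_restrict, Measure.restrict_restrict measurableSet_Iic,
        lintegral_prod _ h.measurable_intensity.aemeasurable]
      refine lintegral_congr fun t => ?_
      rw [← lintegral_const_mul' _ _ ENNReal.ofReal_ne_top]
      rfl
    rw [hr, hM₁, Measure.map_apply hm1 hAbB, Measure.restrict_apply (hm1 hAbB)]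
    rcases lt_or_ge b 0 with hb | hb
    · have e1 : Iic b ∩ Ioc 0 τ = ∅ := by
        ext t; simp only [mem_inter_iff, mem_Iic, mem_Ioc, mem_empty_iff_false, iff_false]
        intro ht; linarith [ht.1, ht.2.1]
      have e2 : (fun ω => (X ω, C ω, (T ω).toReal)) ⁻¹' (A ×ˢ B ×ˢ Iic b)
          ∩ T ⁻¹' Iic (ENNReal.ofReal τ) = ∅ := by
        ext ω
        simp only [mem_inter_iff, mem_preimage, mem_prod, mem_Iic, mem_empty_iff_false, iff_false]
        intro hω
        exact absurd (hω.1.2.2.trans_lt hb) (not_lt.2 ENNReal.toReal_nonneg)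
      rw [e1, e2]; simp
    · have e1 : Iic b ∩ Ioc 0 τ = Ioc 0 (min b τ) := by
        ext t; simp only [mem_inter_iff, mem_Iic, mem_Ioc, le_min_iff]; tauto
      have e2 : (fun ω => (X ω, C ω, (T ω).toReal)) ⁻¹' (A ×ˢ B ×ˢ Iic b)
          ∩ T ⁻¹' Iic (ENNReal.ofReal τ)
          = X ⁻¹' A ∩ C ⁻¹' B ∩ T ⁻¹' Iic (ENNReal.ofReal (min b τ)) := by
        ext ω
        simp only [mem_inter_iff, mem_preimage, mem_prod, mem_Iic]
        rw [ENNReal.ofReal_min, le_min_iff]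
        constructor
        · rintro ⟨⟨h1, h2, h3⟩, h4⟩
          exact ⟨⟨h1, h2⟩, ENNReal.le_ofReal_iff_toReal_le (h4.trans_lt ENNReal.ofReal_lt_top).ne hb
            |>.2 h3, h4⟩
        · rintro ⟨⟨h1, h2⟩, h3, h4⟩
          exact ⟨⟨h1, h2, ENNReal.toReal_le_of_le_ofReal hb h3⟩, h4⟩
      rw [e1, e2, h.measure_failure_le hA hB ⟨le_min hb hτ, min_le_right _ _⟩]
  have := congrArg (fun ρ : Measure ℝ => ρ U) key
  simp only [Measure.map_apply hm3 hU, Measure.restrict_apply (hm3 hU)] at this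
  rw [inter_comm, ← hassoc] at this
  rw [this]

/-- The compensator of the counting process of observed failures: a sum over observed failures
has the expectation of an integral of the intensity over the subjects at risk. -/
lemma integral_failure (h : HazardModel μ τ lam θ₀ X T C R) (hτ : 0 ≤ τ)
    (hCτ : ∀ᵐ ω ∂μ, C ω ≤ ENNReal.ofReal τ) {f : EuclideanSpace ℝ (Fin p) × ℝ → ℝ}
    (hf : Measurable f) {K : ℝ} (hK : ∀ z, |f z| ≤ K) :
    ∫ ω, {ω | T ω ≤ C ω}.indicator (fun ω => f (X ω, (min (T ω) (C ω)).toReal)) ω ∂μ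
      = ∫ t in Ioc 0 τ, lam t * ∫ ω, {ω | ENNReal.ofReal t ≤ min (T ω) (C ω)}.indicator
          (fun ω => Real.exp ⟪θ₀, X ω⟫ * f (X ω, t)) ω ∂μ := by
  have hm1 : Measurable fun ω => (X ω, C ω, (T ω).toReal) :=
    h.measurable_X.prodMk (h.measurable_C.prodMk h.measurable_T.ennreal_toReal)
  have hm2 : Measurable fun q : ℝ × Ω => (X q.2, C q.2, q.1) :=
    (h.measurable_X.comp measurable_snd).prodMk
      ((h.measurable_C.comp measurable_snd).prodMk measurable_fst)
  -- The restriction to observed failures is built into a function of covariate, censoring time and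
  -- failure time, so that both sides are integrals of `F` against the two descriptions of the law.
  set F : EuclideanSpace ℝ (Fin p) × ℝ≥0∞ × ℝ → ℝ :=
    {z | ENNReal.ofReal z.2.2 ≤ z.2.1}.indicator fun z => f (z.1, z.2.2) with hF
  have hset : MeasurableSet {z : EuclideanSpace ℝ (Fin p) × ℝ≥0∞ × ℝ |
      ENNReal.ofReal z.2.2 ≤ z.2.1} :=
    measurableSet_le measurable_snd.snd.ennreal_ofReal measurable_snd.fst
  have hFm : Measurable F :=
    (hf.comp (measurable_fst.prodMk measurable_snd.snd)).indicator hset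
  have hFK : ∀ z, ‖F z‖ ≤ K := fun z =>
    (norm_indicator_le_norm_self _ _).trans (hK _)
  have h1 := congrArg (fun ρ => ∫ z, F z ∂ρ) (h.map_failure_eq hτ)
  rw [integral_map hm1.aemeasurable hFm.aestronglyMeasurable,
    integral_map hm2.aemeasurable hFm.aestronglyMeasurable,
    integral_withDensity_eq_integral_toReal_smul h.measurable_intensity
      (Eventually.of_forall fun q => ?_)] at h1
  swap
  · refine ENNReal.mul_lt_top ENNReal.ofReal_lt_top (ENNReal.mul_lt_top ENNReal.ofReal_lt_top ?_)
    exact lt_of_le_of_lt (indicator_le_self' (by simp) _) (by simp)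
  have hreal : ∀ q, (intensity lam θ₀ X T q).toReal
      = (lam q.1 * Real.exp ⟪θ₀, X q.2⟫)
        * {q : ℝ × Ω | ENNReal.ofReal q.1 ≤ T q.2}.indicator (fun _ => (1 : ℝ)) q := fun q => by
    rw [intensity, ENNReal.toReal_mul, ENNReal.toReal_mul, ENNReal.toReal_ofReal (h.lam_nonneg _),
      ENNReal.toReal_ofReal (Real.exp_pos _).le, mul_assoc]
    by_cases hq : ENNReal.ofReal q.1 ≤ T q.2 <;> simp [indicator, hq]
  -- An observed failure satisfies `T ≤ C ≤ τ` almost surely, so restricting to `T ≤ τ` loses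
  -- nothing.
  have hl : ∫ ω in T ⁻¹' Iic (ENNReal.ofReal τ), F (X ω, C ω, (T ω).toReal) ∂μ
      = ∫ ω, {ω | T ω ≤ C ω}.indicator (fun ω => f (X ω, (min (T ω) (C ω)).toReal)) ω ∂μ := by
    rw [← integral_indicator (h.measurable_T measurableSet_Iic)]
    refine integral_congr_ae ?_
    filter_upwards [hCτ] with ω hω
    by_cases hTC : T ω ≤ C ω
    · have h2 : T ω ≤ ENNReal.ofReal τ := hTC.trans hω
      have h3 : ENNReal.ofReal (T ω).toReal = T ω :=
        ENNReal.ofReal_toReal (h2.trans_lt ENNReal.ofReal_lt_top).ne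
      simp [indicator, hTC, h2, hF, h3]
    · by_cases h2 : T ω ≤ ENNReal.ofReal τ
      · have h3 : ENNReal.ofReal (T ω).toReal = T ω :=
          ENNReal.ofReal_toReal (h2.trans_lt ENNReal.ofReal_lt_top).ne
        simp [indicator, hTC, h2, hF, h3]
      · simp [indicator, hTC, h2]
  rw [hl] at h1
  rw [h1]
  simp_rw [hreal]
  rw [integral_prod]
  · refine integral_congr_ae (Eventually.of_forall fun t => ?_)
    simp only
    rw [← integral_const_mul]
    refine integral_congr_ae (Eventually.of_forall fun ω => ?_)
    by_cases h2 : ENNReal.ofReal t ≤ T ω <;> by_cases h3 : ENNReal.ofReal t ≤ C ω <;>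
      simp [indicator, hF, h2, h3, mul_assoc]
  · have h2 : Integrable (fun q : ℝ × Ω => lam q.1 * Real.exp ⟪θ₀, X q.2⟫)
        ((volume.restrict (Ioc 0 τ)).prod μ) :=
      h.integrable_lam.integrableOn.mul_prod h.integrable_exp_inner
    have h3 : MeasurableSet {q : ℝ × Ω | ENNReal.ofReal q.1 ≤ T q.2} :=
      measurableSet_le measurable_fst.ennreal_ofReal (h.measurable_T.comp measurable_snd)
    refine (h2.mul_bdd (c := 1)
      ((measurable_const (a := (1 : ℝ))).indicator h3).aestronglyMeasurable
      (Eventually.of_forall fun q => ?_)).mul_bdd (c := K)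
      (hFm.comp hm2).aestronglyMeasurable (Eventually.of_forall fun q => hFK _)
    exact (norm_indicator_le_norm_self _ _).trans (by simp)

end HazardModel

/-! ### The law of one observation -/

section Law

variable {p : ℕ}

/-- The observation with its covariate reset to `0` where its norm exceeds `R`. -/
def truncate (R : ℝ) (z : Datum p) : Datum p := (if ‖z.1‖ ≤ R then z.1 else 0, z.2)

lemma norm_truncate_le {R : ℝ} (hR : 0 ≤ R) (z : Datum p) : ‖(truncate R z).1‖ ≤ R := by
  unfold truncate; split_ifs with h
  · exact h
  · simpa using hR

lemma measurable_truncate (R : ℝ) : Measurable (truncate (p := p) R) := by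
  refine Measurable.prodMk (Measurable.ite ?_ measurable_fst measurable_const) measurable_snd
  exact measurableSet_le measurable_fst.norm measurable_const

lemma truncate_eq_self {R : ℝ} {z : Datum p} (h : ‖z.1‖ ≤ R) : truncate R z = z := by
  simp [truncate, h]

/-- `1` if the subject is at risk at time `t`. -/
def atRisk (t : ℝ) (z : Datum p) : ℝ := if t ≤ z.2.1 then 1 else 0

lemma atRisk_nonneg (t : ℝ) (z : Datum p) : 0 ≤ atRisk t z := by
  unfold atRisk; split_ifs <;> norm_num

lemma atRisk_le_one (t : ℝ) (z : Datum p) : atRisk t z ≤ 1 := by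
  unfold atRisk; split_ifs <;> norm_num

lemma measurable_atRisk : Measurable fun q : ℝ × Datum p => atRisk q.1 q.2 := by
  unfold atRisk
  exact Measurable.ite (measurableSet_le (by fun_prop) (by fun_prop)) measurable_const
    measurable_const

/-- The relative risk of a subject. -/
def relRisk (R : ℝ) (θ₀ : EuclideanSpace ℝ (Fin p)) (z : Datum p) : ℝ :=
  Real.exp ⟪θ₀, (truncate R z).1⟫

lemma measurable_relRisk (R : ℝ) (θ₀ : EuclideanSpace ℝ (Fin p)) :
    Measurable (relRisk R θ₀) :=
  (HazardModel.measurable_exp_inner θ₀).comp (measurable_truncate R).fst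

lemma relRisk_nonneg (R : ℝ) (θ₀ : EuclideanSpace ℝ (Fin p)) (z : Datum p) :
    0 ≤ relRisk R θ₀ z := (Real.exp_pos _).le

lemma relRisk_le {R : ℝ} (hR : 0 ≤ R) (θ₀ : EuclideanSpace ℝ (Fin p)) (z : Datum p) :
    relRisk R θ₀ z ≤ Real.exp (‖θ₀‖ * R) :=
  HazardModel.exp_inner_le (norm_truncate_le hR z)

/-- What is needed of the law of one observation in the Cox model with bounded covariates. -/
structure CoxLaw (P : Measure (Datum p)) (τ R : ℝ) (lam : ℝ → ℝ)
    (θ₀ : EuclideanSpace ℝ (Fin p)) : Prop where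
  radius_nonneg : 0 ≤ R
  norm_le : ∀ᵐ z ∂P, ‖z.1‖ ≤ R
  integrable_lam : Integrable lam
  compensator : ∀ (f : EuclideanSpace ℝ (Fin p) × ℝ → ℝ) (K : ℝ), Measurable f →
    (∀ z, |f z| ≤ K) → ∫ z, eventIndicator z * f (z.1, z.2.1) ∂P
      = ∫ t in Ioc 0 τ, lam t * ∫ z, atRisk t z * relRisk R θ₀ z * f (z.1, t) ∂P
  event_pos : P {z | z.2.2 = true} ≠ 0
  hyperplane : ∀ v : EuclideanSpace ℝ (Fin p), v ≠ 0 → ∀ a : ℝ, P {z | ⟪z.1, v⟫ = a} = 0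

lemma measurable_observe {Ω : Type*} [MeasurableSpace Ω] {X : Ω → EuclideanSpace ℝ (Fin p)}
    {T C : Ω → ℝ≥0∞} (hX : Measurable X) (hT : Measurable T) (hC : Measurable C) :
    Measurable (observe X T C) :=
  hX.prodMk ((hT.min hC).ennreal_toReal.prodMk
    (measurable_to_bool (by
      have : (fun ω => decide (T ω ≤ C ω)) ⁻¹' {true} = {ω | T ω ≤ C ω} := by ext ω; simp
      convert measurableSet_le hT hC)))

lemma volume_hyperplane {v : EuclideanSpace ℝ (Fin p)} (hv : v ≠ 0) (a : ℝ) :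
    volume {x : EuclideanSpace ℝ (Fin p) | ⟪x, v⟫ = a} = 0 := by
  have h1 : {x : EuclideanSpace ℝ (Fin p) | ⟪x, v⟫ = a}
      = (fun x => x + -((a / ‖v‖ ^ 2) • v)) ⁻¹' ((ℝ ∙ v)ᗮ : Submodule ℝ _) := by
    ext x
    have hn : ‖v‖ ^ 2 ≠ 0 := by simpa using hv
    simp only [mem_preimage, SetLike.mem_coe, Submodule.mem_orthogonal_singleton_iff_inner_left,
      inner_add_left, inner_neg_left, real_inner_smul_left, real_inner_self_eq_norm_sq,
      Set.mem_ofPred_eq]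
    rw [div_mul_cancel₀ _ hn, ← sub_eq_add_neg, sub_eq_zero]
  rw [h1, measure_preimage_add_right]
  refine Measure.addHaar_submodule _ _ fun htop => hv ?_
  have : v ∈ (ℝ ∙ v)ᗮ := htop ▸ Submodule.mem_top
  rw [Submodule.mem_orthogonal_singleton_iff_inner_left] at this
  exact inner_self_eq_zero.1 this

lemma norm_le_of_mem_cube {x : EuclideanSpace ℝ (Fin p)} (hx : x ∈ cube p) : ‖x‖ ≤ √(p : ℝ) := by
  rw [EuclideanSpace.norm_eq]
  refine Real.sqrt_le_sqrt ?_
  calc ∑ i, ‖x i‖ ^ 2 ≤ ∑ _i : Fin p, (1 : ℝ) := Finset.sum_le_sum fun i _ => by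
        rw [Real.norm_of_nonneg (hx i).1]
        exact pow_le_one₀ (hx i).1 (hx i).2
    _ = p := by simp

lemma measurableSet_cube : MeasurableSet (cube p) := by
  have : cube p = ⋂ j, {x : EuclideanSpace ℝ (Fin p) | x j ∈ Icc (0 : ℝ) 1} := by
    ext x; simp [cube]
  rw [this]
  exact MeasurableSet.iInter fun j =>
    (by fun_prop : Measurable fun x : EuclideanSpace ℝ (Fin p) => x j) measurableSet_Icc

variable {Ω : Type*} [MeasurableSpace Ω] {μ : Measure Ω} [IsProbabilityMeasure μ]
  {X : Ω → EuclideanSpace ℝ (Fin p)} {T C : Ω → ℝ≥0∞} {τ δ : ℝ} {lam : ℝ → ℝ}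
  {θ₀ : EuclideanSpace ℝ (Fin p)}

lemma CovariateDensity.ae_mem_cube (h : CovariateDensity μ X) (hX : Measurable X) :
    ∀ᵐ ω ∂μ, X ω ∈ cube p := by
  obtain ⟨c, f, hc, hf, hcf, hm⟩ := h
  refine ae_of_ae_map hX.aemeasurable (p := fun x => x ∈ cube p) ?_
  rw [hm]
  exact (withDensity_absolutelyContinuous _ _) (ae_restrict_mem measurableSet_cube)

lemma CovariateDensity.absolutelyContinuous (h : CovariateDensity μ X) :
    μ.map X ≪ volume := by
  obtain ⟨c, f, hc, hf, hcf, hm⟩ := h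
  rw [hm]
  exact (withDensity_absolutelyContinuous _ _).trans Measure.absolutelyContinuous_restrict

/-- The hazard of the model is given on `[0, τ]` only. It is replaced by a version that is
measurable, nonnegative and integrable on the whole line, with the same cumulative hazard up to `τ`.
-/
lemma CoxModel.exists_hazardModel (h : CoxModel μ τ lam θ₀ X T) (hτ : 0 < τ)
    (hX : Measurable X) (hT : Measurable T) (hC : Measurable C) (hci : CondIndepGiven μ X T C)
    (hd : CovariateDensity μ X) :
    ∃ lam' : ℝ → ℝ, HazardModel μ τ lam' θ₀ X T C √(p : ℝ) := by
  obtain ⟨h0, hint, hs⟩ := h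
  have hint' : Integrable ((Ioc 0 τ).indicator lam) :=
    (integrable_indicator_iff measurableSet_Ioc).2
      ((intervalIntegrable_iff_integrableOn_Ioc_of_le hτ.le).1 hint)
  -- The measurable representative need only be nonnegative almost everywhere; the maximum with `0`
  -- repairs the rest.
  set lam' : ℝ → ℝ := fun t => max (hint'.1.mk _ t) 0 with hlam'
  have hae : lam' =ᵐ[volume] (Ioc 0 τ).indicator lam := by
    filter_upwards [hint'.1.ae_eq_mk] with t ht
    rw [hlam']
    simp only
    rw [← ht, max_eq_left]
    exact indicator_nonneg (fun t ht => h0 t ⟨ht.1.le, ht.2⟩) t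
  refine ⟨lam', hX, hT, hC, hint'.1.measurable_mk.max measurable_const,
    fun t => le_max_right _ _, hint'.congr hae.symm, ?_, hci, fun t ht => ?_⟩
  · exact (hd.ae_mem_cube hX).mono fun ω hω => norm_le_of_mem_cube hω
  · have h1 : ∫ u in (0 : ℝ)..t, lam' u = ∫ u in (0 : ℝ)..t, lam u := by
      refine intervalIntegral.integral_congr_ae ?_
      filter_upwards [hae] with u hu hut
      rw [uIoc_of_le ht.1] at hut
      have hu' : u ∈ Ioc 0 τ := ⟨hut.1, hut.2.trans ht.2⟩
      rw [hu, indicator_of_mem hu']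
    rw [h1]
    exact hs t ht

lemma eventIndicator_observe (ω : Ω) :
    eventIndicator (observe X T C ω) = {ω | T ω ≤ C ω}.indicator (fun _ => (1 : ℝ)) ω := by
  classical
  by_cases h : T ω ≤ C ω <;> simp [eventIndicator, observe, h]

lemma StudyEnd.event_ne_zero (h : StudyEnd μ τ δ X T C) (hδ : 0 < δ) (hX : Measurable X)
    (hT : Measurable T) (hC : Measurable C) : μ {ω | T ω ≤ C ω} ≠ 0 := by
  intro h0
  have h1 : ∫ ω, (μ⟦{ω' | T ω' ≤ C ω'} | MeasurableSpace.comap X inferInstance⟧) ω ∂μ = 0 := by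
    rw [integral_condExp hX.comap_le, integral_indicator (measurableSet_le hT hC),
      Measure.restrict_eq_zero.2 h0, integral_zero_measure]
  have h2 : ∫ _ω, δ ∂μ ≤ 0 := by
    rw [← h1]
    exact integral_mono_ae (integrable_const _) integrable_condExp h.2.1
  simp at h2
  linarith

/-- Censoring by `τ` keeps the observed time finite, so passing to real numbers preserves the
at-risk event, and the truncation is inactive. -/
lemma atRisk_mul_relRisk_observe {R : ℝ} {ω : Ω} (hω : C ω ≤ ENNReal.ofReal τ) (hR : ‖X ω‖ ≤ R)
    (t : ℝ) (f : Ω → ℝ) :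
    atRisk t (observe X T C ω) * relRisk R θ₀ (observe X T C ω) * f ω
      = {ω | ENNReal.ofReal t ≤ min (T ω) (C ω)}.indicator
        (fun ω => Real.exp ⟪θ₀, X ω⟫ * f ω) ω := by
  classical
  have h4 : min (T ω) (C ω) ≠ ⊤ :=
    ((min_le_right _ _).trans hω |>.trans_lt ENNReal.ofReal_lt_top).ne
  have h5 : ENNReal.ofReal t ≤ min (T ω) (C ω) ↔ t ≤ (min (T ω) (C ω)).toReal :=
    ENNReal.ofReal_le_iff_le_toReal h4
  have h6 : relRisk R θ₀ (observe X T C ω) = Real.exp ⟪θ₀, X ω⟫ := by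
    have h : truncate R (observe X T C ω) = observe X T C ω := truncate_eq_self hR
    rw [relRisk, h]
    rfl
  have h7 : atRisk t (observe X T C ω) = if t ≤ (min (T ω) (C ω)).toReal then 1 else 0 := rfl
  rw [h6, h7, indicator_apply]
  by_cases h8 : t ≤ (min (T ω) (C ω)).toReal
  · rw [if_pos h8, one_mul]
    exact (if_pos (h5.2 h8)).symm
  · rw [if_neg h8, zero_mul, zero_mul]
    exact (if_neg fun h => h8 (h5.1 h)).symm

/-- One observation of the Cox model. -/
lemma CoxModel.exists_coxLaw (h : CoxModel μ τ lam θ₀ X T) (hτ : 0 < τ)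
    (hX : Measurable X) (hT : Measurable T) (hC : Measurable C) (hci : CondIndepGiven μ X T C)
    (hδ : 0 < δ) (hend : StudyEnd μ τ δ X T C) (hd : CovariateDensity μ X) :
    ∃ lam' : ℝ → ℝ, CoxLaw (μ.map (observe X T C)) τ √(p : ℝ) lam' θ₀ := by
  obtain ⟨lam', hm⟩ := h.exists_hazardModel hτ hX hT hC hci hd
  have hO := measurable_observe hX hT hC
  refine ⟨lam', Real.sqrt_nonneg _, ?_, hm.integrable_lam, fun f K hf hK => ?_, ?_,
    fun v hv a => ?_⟩
  · rw [ae_map_iff hO.aemeasurable (measurableSet_le measurable_fst.norm measurable_const)]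
    exact hm.norm_le
  · have hft : ∀ t, Measurable fun z : Datum p => f (z.1, t) := fun t =>
      hf.comp (measurable_fst.prodMk measurable_const)
    have hfz : Measurable fun z : Datum p => f (z.1, z.2.1) :=
      hf.comp (measurable_fst.prodMk measurable_snd.fst)
    have h0 : Measurable fun z : Datum p => eventIndicator z * f (z.1, z.2.1) :=
      measurable_eventIndicator.mul hfz
    rw [integral_map hO.aemeasurable h0.aestronglyMeasurable]
    have h1 : ∀ t, ∫ z, atRisk t z * relRisk √(p : ℝ) θ₀ z * f (z.1, t) ∂(μ.map (observe X T C))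
        = ∫ ω, atRisk t (observe X T C ω) * relRisk √(p : ℝ) θ₀ (observe X T C ω)
          * f (X ω, t) ∂μ := fun t => by
      have hr : Measurable fun z : Datum p => atRisk t z :=
        measurable_atRisk.comp (measurable_const.prodMk measurable_id)
      exact integral_map hO.aemeasurable
        ((hr.mul (measurable_relRisk _ θ₀)).mul (hft t)).aestronglyMeasurable
    have h2 := hm.integral_failure hτ.le hend.1 hf hK
    have h3 : ∀ ω, eventIndicator (observe X T C ω)
          * f ((observe X T C ω).1, (observe X T C ω).2.1)
        = {ω | T ω ≤ C ω}.indicator (fun ω => f (X ω, (min (T ω) (C ω)).toReal)) ω := fun ω => by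
      rw [eventIndicator_observe]
      by_cases hω : T ω ≤ C ω <;> simp [observe, hω]
    simp_rw [h3, h1]
    rw [h2]
    refine setIntegral_congr_fun measurableSet_Ioc fun t ht => ?_
    congr 1
    refine integral_congr_ae ?_
    filter_upwards [hend.1, hm.norm_le] with ω hω hR
    exact (atRisk_mul_relRisk_observe hω hR t _).symm
  · rw [Measure.map_apply hO (measurableSet_eq_fun (by fun_prop) (by fun_prop))]
    convert hend.event_ne_zero hδ hX hT hC using 3
    classical
    ext ω
    simp [observe]
  · have h1 : MeasurableSet {x : EuclideanSpace ℝ (Fin p) | ⟪x, v⟫ = a} :=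
      measurableSet_eq_fun (measurable_id.inner measurable_const) measurable_const
    have h2 := hd.absolutelyContinuous (volume_hyperplane hv a)
    rw [Measure.map_apply hX h1] at h2
    have h3 : MeasurableSet {z : Datum p | ⟪z.1, v⟫ = a} := measurable_fst h1
    rw [Measure.map_apply hO h3]
    exact h2

end Law

/-! ### The score has mean zero -/

section MeanZero

lemma map_update_iidLaw {β : Type*} [MeasurableSpace β] (P : Measure β) [IsProbabilityMeasure P]
    (i : ℕ) : ((iidLaw P).prod P).map (fun q => Function.update q.1 i q.2) = iidLaw P := by
  have h1 := map_piecewise_iidLaw P {i}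
  have h2 := (measurePreserving_eval_infinitePi (fun _ : ℕ => P) i)
  have h3 : (iidLaw P).prod P = ((iidLaw P).prod (iidLaw P)).map
      (fun q : (ℕ → β) × (ℕ → β) => (q.2, q.1 i)) := by
    have h4 := (((MeasurePreserving.id (iidLaw P)).prod h2).comp
      (Measure.measurePreserving_swap (μ := iidLaw P) (ν := iidLaw P)))
    exact h4.map_eq.symm
  have h5 : Measurable fun q : (ℕ → β) × (ℕ → β) => (q.2, q.1 i) :=
    measurable_snd.prodMk ((measurable_pi_apply i).comp measurable_fst)
  rw [h3, Measure.map_map (measurable_update_prod i) h5]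
  conv_rhs => rw [← h1]
  congr 1
  funext q
  simp [piecewise_singleton_eq_update]

lemma integral_iidLaw_update {β : Type*} [MeasurableSpace β] (P : Measure β)
    [IsProbabilityMeasure P] (i : ℕ) {Φ : (ℕ → β) → ℝ} (hΦ : Integrable Φ (iidLaw P)) :
    ∫ d, Φ d ∂(iidLaw P) = ∫ d, ∫ z, Φ (Function.update d i z) ∂P ∂(iidLaw P) := by
  have hm := map_update_iidLaw P i
  rw [← hm] at hΦ
  conv_lhs => rw [← hm]
  rw [integral_map (measurable_update_prod i).aemeasurable hΦ.1]
  exact integral_prod _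
    ((integrable_map_measure hΦ.1 (measurable_update_prod i).aemeasurable).1 hΦ)

variable {p : ℕ} {P : Measure (Datum p)} [IsProbabilityMeasure P] {τ R : ℝ} {lam : ℝ → ℝ}
  {θ₀ : EuclideanSpace ℝ (Fin p)}

/-- The compensator identity in the presence of the other observations. -/
lemma CoxLaw.integral_event_mul (h : CoxLaw P τ R lam θ₀) (i : ℕ)
    {Φ : ℝ × (ℕ → Datum p) → ℝ} (hΦ : Measurable Φ) {K : ℝ} (hK : ∀ q, |Φ q| ≤ K)
    (hrisk : ∀ (d : ℕ → Datum p) (z : Datum p) (t : ℝ), t ≤ z.2.1 →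
      Φ (t, Function.update d i z) = Φ (t, Function.update d i (z.1, t, true))) :
    ∫ d, eventIndicator (d i) * Φ ((d i).2.1, d) ∂(iidLaw P)
      = ∫ t in Ioc 0 τ, lam t *
        ∫ d, atRisk t (d i) * relRisk R θ₀ (d i) * Φ (t, d) ∂(iidLaw P) := by
  have hK0 : 0 ≤ K := (abs_nonneg _).trans (hK (0, fun _ => (0, 0, true)))
  set L := Real.exp (‖θ₀‖ * R) with hL
  have hL0 : 0 ≤ L := (Real.exp_pos _).le
  have hw : ∀ t (z : Datum p), |atRisk t z * relRisk R θ₀ z| ≤ L := fun t z => by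
    rw [abs_of_nonneg (mul_nonneg (atRisk_nonneg _ _) (relRisk_nonneg _ _ _))]
    calc _ ≤ 1 * L := mul_le_mul (atRisk_le_one _ _) (relRisk_le h.radius_nonneg _ _)
          (relRisk_nonneg _ _ _) zero_le_one
      _ = L := one_mul L
  have hwΦ : ∀ t (z : Datum p) q, |atRisk t z * relRisk R θ₀ z * Φ q| ≤ L * K := fun t z q => by
    rw [abs_mul]
    exact mul_le_mul (hw t z) (hK q) (abs_nonneg _) hL0
  have hev : Measurable fun d : ℕ → Datum p => eventIndicator (d i) * Φ ((d i).2.1, d) := by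
    have h1 : Measurable fun d : ℕ → Datum p => (d i).2.1 := by fun_prop
    have h2 : Measurable fun d : ℕ → Datum p => ((d i).2.1, d) := h1.prodMk measurable_id
    have h3 : Measurable fun d : ℕ → Datum p => eventIndicator (d i) :=
      measurable_eventIndicator.comp (measurable_pi_apply i)
    exact h3.mul (hΦ.comp h2)
  have hri : Measurable fun q : ℝ × (ℕ → Datum p) =>
      atRisk q.1 (q.2 i) * relRisk R θ₀ (q.2 i) * Φ q := by
    have hi : Measurable fun q : ℝ × (ℕ → Datum p) => q.2 i := by fun_prop
    exact ((measurable_atRisk.comp (measurable_fst.prodMk hi)).mul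
      ((measurable_relRisk R θ₀).comp hi)).mul hΦ
  have hl : ∀ d : ℕ → Datum p,
      ∫ z, eventIndicator z * Φ (z.2.1, Function.update d i z) ∂P
        = ∫ t in Ioc 0 τ, lam t *
          ∫ z, atRisk t z * relRisk R θ₀ z * Φ (t, Function.update d i z) ∂P := fun d => by
    -- By `hrisk`, the observation `i` enters only through its covariate as long as it is at risk.
    -- It may therefore be reset to `(x, t, true)`, which yields a function of covariate and time as
    -- the compensator identity requires.
    have hf : Measurable fun y : EuclideanSpace ℝ (Fin p) × ℝ =>
        Φ (y.2, Function.update d i (y.1, y.2, true)) := by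
      refine hΦ.comp (measurable_snd.prodMk ((measurable_update_prod i).comp
        (measurable_const.prodMk ?_)))
      exact measurable_fst.prodMk (measurable_snd.prodMk measurable_const)
    have h1 := h.compensator _ K hf fun y => hK _
    convert h1 using 2
    · funext z
      by_cases hz : z.2.2 = true
      · rw [hrisk d z z.2.1 le_rfl]
      · simp [eventIndicator, hz]
    · funext t
      congr 2
      funext z
      by_cases hz : t ≤ z.2.1
      · rw [hrisk d z t hz]
      · simp [atRisk, hz]
  rw [integral_iidLaw_update P i (SymmKernel.integrable_of_measurable hev (L := K) fun d => ?_)]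
  swap
  · rw [abs_mul, abs_of_nonneg (eventIndicator_nonneg _)]
    exact (mul_le_of_le_one_left (abs_nonneg _) (eventIndicator_le_one _)).trans (hK _)
  simp only [Function.update_self, hl]
  have hjoint : Measurable fun q : ((ℕ → Datum p) × ℝ) × Datum p =>
      atRisk q.1.2 q.2 * relRisk R θ₀ q.2 * Φ (q.1.2, Function.update q.1.1 i q.2) := by
    have h1 : Measurable fun q : ((ℕ → Datum p) × ℝ) × Datum p =>
        Function.update q.1.1 i q.2 :=
      (measurable_update_prod i).comp (measurable_fst.fst.prodMk measurable_snd)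
    have h2 := hri.comp (measurable_fst.snd.prodMk h1)
    convert h2 using 2 with q
    simp [Function.comp]
  rw [integral_integral_swap]
  · refine integral_congr_ae (Eventually.of_forall fun t => ?_)
    simp only
    have hrt : Measurable fun d : ℕ → Datum p =>
        atRisk t (d i) * relRisk R θ₀ (d i) * Φ (t, d) :=
      hri.comp (measurable_const.prodMk measurable_id)
    rw [integral_const_mul, integral_iidLaw_update P i (SymmKernel.integrable_of_measurable
      hrt (L := L * K) fun d => hwΦ _ _ _)]
    simp only [Function.update_self]
  · have h1 : Integrable (fun q : (ℕ → Datum p) × ℝ => lam q.2)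
        ((iidLaw P).prod (volume.restrict (Ioc 0 τ))) := by
      have := (integrable_const (μ := iidLaw P) (1 : ℝ)).mul_prod
        (h.integrable_lam.integrableOn (s := Ioc 0 τ))
      simpa using this
    refine h1.mul_bdd (c := L * K) hjoint.stronglyMeasurable.integral_prod_right.aestronglyMeasurable
      (Eventually.of_forall fun q => ?_)
    have := norm_integral_le_of_norm_le_const (μ := P) (C := L * K)
      (f := fun z => atRisk q.2 z * relRisk R θ₀ z * Φ (q.2, Function.update q.1 i z))
      (Eventually.of_forall fun z => hwΦ _ _ _)
    simpa using this

/-- Weighted deviations from the weighted mean cancel. -/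
lemma sum_mul_exp_smul_softMean_sub {ι E : Type*} [NormedAddCommGroup E] [InnerProductSpace ℝ E]
    {B : Finset ι} {w : ι → ℝ} (hw : ∀ j ∈ B, 0 ≤ w j) (x : ι → E) (θ : E) :
    ∑ j ∈ B, (w j * Real.exp ⟪θ, x j⟫) • (softMean B w x θ - x j) = 0 := by
  simp only [smul_sub, Finset.sum_sub_distrib]
  rw [← Finset.sum_smul, sub_eq_zero, softMean, Finset.smul_sum]
  refine Finset.sum_congr rfl fun j hj => ?_
  rw [smul_smul, softmax]
  rcases eq_or_ne (∑ k ∈ B, w k * Real.exp ⟪θ, x k⟫) 0 with h0 | h0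
  · rw [(Finset.sum_eq_zero_iff_of_nonneg fun k hk =>
      mul_nonneg (hw k hk) (Real.exp_pos _).le).1 h0 j hj]
    simp
  · rw [mul_div_cancel₀ _ h0]

/-- The kernel of the score: the gradient at `θ₀`, evaluated at truncated observations. -/
def scoreKernel (R : ℝ) (θ₀ : EuclideanSpace ℝ (Fin p)) (a : Fin p) (B : Finset ℕ)
    (d : ℕ → Datum p) : ℝ := score B (truncate R ∘ d) θ₀ a

/-- The kernel of the Hessian. -/
def hessKernel (R : ℝ) (θ₀ : EuclideanSpace ℝ (Fin p)) (a b : Fin p) (B : Finset ℕ)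
    (d : ℕ → Datum p) : ℝ := hessMat B (truncate R ∘ d) θ₀ a b

lemma measurable_truncate_comp (R : ℝ) :
    Measurable fun d : ℕ → Datum p => truncate R ∘ d :=
  measurable_pi_lambda _ fun i => (measurable_truncate R).comp (measurable_pi_apply i)

/-- Without truncation the bound would hold only almost surely, and the kernel would not be bounded
at every data sequence. -/
lemma symmKernel_score (hR : 0 ≤ R) (θ₀ : EuclideanSpace ℝ (Fin p)) (a : Fin p) :
    SymmKernel (scoreKernel R θ₀ a) (2 * R) where
  measurable B := (by fun_prop : Measurable fun v : EuclideanSpace ℝ (Fin p) => v a).comp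
    ((measurable_score θ₀).comp (measurable_truncate_comp R))
  abs_le B d := (PiLp.norm_apply_le (score B (truncate R ∘ d) θ₀) a).trans
    (norm_score_le hR (fun i _ => norm_truncate_le hR _) θ₀)
  congr B d d' h := by
    rw [scoreKernel, scoreKernel, score_congr (d' := truncate R ∘ d') fun i hi => by simp [h i hi]]
  map B e d := by rw [scoreKernel, scoreKernel, score_map]; rfl

lemma symmKernel_hess (hR : 0 ≤ R) (θ₀ : EuclideanSpace ℝ (Fin p)) (a b : Fin p) :
    SymmKernel (hessKernel R θ₀ a b) (2 * R ^ 2) where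
  measurable B := (measurable_hessMat θ₀ a b).comp (measurable_truncate_comp R)
  abs_le B d := abs_hessMat_le hR (fun i _ => norm_truncate_le hR _) θ₀ a b
  congr B d d' h := by
    rw [hessKernel, hessKernel,
      hessMat_congr (d' := truncate R ∘ d') fun i hi => by simp [h i hi]]
  map B e d := by rw [hessKernel, hessKernel, hessMat_map]; rfl

/-- The compensator identity replaces each observed failure by a time integral over the subjects at
risk, weighted by the hazard. These weights are proportional to the softmax weights at `θ₀`, so at
each time the deviations from the risk-set mean cancel. Nothing depends on the batch being large. -/
lemma CoxLaw.integral_scoreKernel (h : CoxLaw P τ R lam θ₀) (a : Fin p) (B : Finset ℕ) :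
    ∫ d, scoreKernel R θ₀ a B d ∂(iidLaw P) = 0 := by
  have hR := h.radius_nonneg
  set x : (ℕ → Datum p) → ℕ → EuclideanSpace ℝ (Fin p) := fun d j => (truncate R (d j)).1 with hx
  set m : ℝ → (ℕ → Datum p) → EuclideanSpace ℝ (Fin p) :=
    fun t d => softMean B (fun j => atRisk t (d j)) (x d) θ₀ with hm
  set Φ : ℕ → ℝ × (ℕ → Datum p) → ℝ := fun i q => m q.1 q.2 a - x q.2 i a with hΦ
  have hcoord : Measurable fun v : EuclideanSpace ℝ (Fin p) => v a := by fun_prop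
  have hxm : ∀ j, Measurable fun q : ℝ × (ℕ → Datum p) => x q.2 j := fun j =>
    (measurable_truncate R).fst.comp (by fun_prop : Measurable fun q : ℝ × (ℕ → Datum p) => q.2 j)
  have hwm : ∀ j, Measurable fun q : ℝ × (ℕ → Datum p) => atRisk q.1 (q.2 j) := fun j =>
    measurable_atRisk.comp (measurable_fst.prodMk
      (by fun_prop : Measurable fun q : ℝ × (ℕ → Datum p) => q.2 j))
  have hΦm : ∀ i, Measurable (Φ i) := fun i =>
    (hcoord.comp (measurable_softMean hwm hxm θ₀)).sub (hcoord.comp (hxm i))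
  have hΦK : ∀ i q, |Φ i q| ≤ 2 * R := fun i q => by
    have h1 := (PiLp.norm_apply_le (m q.1 q.2) a).trans
      (norm_softMean_le (fun j _ => atRisk_nonneg _ _) hR (fun j _ => norm_truncate_le hR _) θ₀)
    have h2 := (PiLp.norm_apply_le (x q.2 i) a).trans (norm_truncate_le hR _)
    rw [Real.norm_eq_abs] at h1 h2
    refine (abs_sub _ _).trans ?_
    linarith
  -- For `t ≤ z.2.1`, lowering the observed time of `i` to `t` leaves it at risk at `t`, and the
  -- event indicator does not enter `Φ`.
  have hrisk : ∀ i (d : ℕ → Datum p) (z : Datum p) (t : ℝ), t ≤ z.2.1 →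
      Φ i (t, Function.update d i z) = Φ i (t, Function.update d i (z.1, t, true)) :=
    fun i d z t ht => by
    have h1 : ∀ j, x (Function.update d i z) j = x (Function.update d i (z.1, t, true)) j :=
      fun j => by
        by_cases hj : j = i
        · subst hj; simp [hx, truncate]
        · simp [hx, hj]
    have h2 : ∀ j, atRisk t (Function.update d i z j)
        = atRisk t (Function.update d i (z.1, t, true) j) := fun j => by
        by_cases hj : j = i
        · subst hj; simp [atRisk, ht]
        · simp [hj]
    simp only [hΦ, hm]
    rw [h1 i, funext h1, funext h2]
  have h1 : ∀ d, scoreKernel R θ₀ a B d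
      = (1 / (B.card : ℝ)) * ∑ i ∈ B, eventIndicator (d i) * Φ i ((d i).2.1, d) := fun d => by
    simp only [scoreKernel, score, PiLp.smul_apply, smul_eq_mul]
    congr 1
    simp only [WithLp.ofLp_sum, Finset.sum_apply, PiLp.smul_apply, smul_eq_mul]
    rfl
  have hm' : ∀ i, Measurable fun d : ℕ → Datum p => eventIndicator (d i) * Φ i ((d i).2.1, d) :=
    fun i => by
      have h1 : Measurable fun d : ℕ → Datum p => (d i).2.1 := by fun_prop
      have h2 : Measurable fun d : ℕ → Datum p => ((d i).2.1, d) := h1.prodMk measurable_id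
      have h3 : Measurable fun d : ℕ → Datum p => eventIndicator (d i) :=
        measurable_eventIndicator.comp (measurable_pi_apply i)
      exact h3.mul ((hΦm i).comp h2)
  have hm2 : ∀ i (t : ℝ), Measurable fun d : ℕ → Datum p =>
      atRisk t (d i) * relRisk R θ₀ (d i) * Φ i (t, d) := fun i t =>
    (((hwm i).comp (measurable_const.prodMk measurable_id)).mul
      ((measurable_relRisk R θ₀).comp (measurable_pi_apply i))).mul
      ((hΦm i).comp (measurable_const.prodMk measurable_id))
  set L := Real.exp (‖θ₀‖ * R) with hL
  have hK2 : ∀ i t d, |atRisk t (d i) * relRisk R θ₀ (d i) * Φ i (t, d)| ≤ 1 * L * (2 * R) :=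
    fun i t d => by
      rw [abs_mul, abs_of_nonneg (mul_nonneg (atRisk_nonneg _ _) (relRisk_nonneg _ _ _))]
      exact mul_le_mul (mul_le_mul (atRisk_le_one _ _) (relRisk_le hR _ _)
        (relRisk_nonneg _ _ _) zero_le_one) (hΦK _ _) (abs_nonneg _)
        (mul_nonneg zero_le_one (Real.exp_pos _).le)
  simp_rw [h1]
  rw [integral_const_mul, integral_finsetSum _ fun i _ =>
    SymmKernel.integrable_of_measurable (hm' i) (L := 2 * R) fun d => ?_]
  swap
  · rw [abs_mul, abs_of_nonneg (eventIndicator_nonneg _)]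
    exact (mul_le_of_le_one_left (abs_nonneg _) (eventIndicator_le_one _)).trans (hΦK _ _)
  rw [Finset.sum_congr rfl fun i _ => h.integral_event_mul i (hΦm i) (hΦK i) (hrisk i)]
  rw [← integral_finsetSum _ fun i _ => ?_]
  swap
  · refine (h.integrable_lam.integrableOn (s := Ioc 0 τ)).mul_bdd (c := 1 * L * (2 * R)) ?_
      (Eventually.of_forall fun t => ?_)
    · have : Measurable fun q : ℝ × (ℕ → Datum p) =>
          atRisk q.1 (q.2 i) * relRisk R θ₀ (q.2 i) * Φ i q :=
        ((hwm i).mul ((measurable_relRisk R θ₀).comp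
          (by fun_prop : Measurable fun q : ℝ × (ℕ → Datum p) => q.2 i))).mul (hΦm i)
      exact this.stronglyMeasurable.integral_prod_right.aestronglyMeasurable
    · have := norm_integral_le_of_norm_le_const (μ := iidLaw P) (C := 1 * L * (2 * R))
        (f := fun d => atRisk t (d i) * relRisk R θ₀ (d i) * Φ i (t, d))
        (Eventually.of_forall fun d => hK2 _ _ _)
      simpa using this
  -- The cancellation holds for every `d`, before any expectation is taken.
  have h2 : ∀ t, ∑ i ∈ B, lam t *
      ∫ d, atRisk t (d i) * relRisk R θ₀ (d i) * Φ i (t, d) ∂(iidLaw P) = 0 := fun t => by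
    rw [← Finset.mul_sum, ← integral_finsetSum _ fun i _ =>
      SymmKernel.integrable_of_measurable (hm2 i t) (hK2 i t)]
    have h3 : ∀ d, ∑ i ∈ B, atRisk t (d i) * relRisk R θ₀ (d i) * Φ i (t, d) = 0 := fun d => by
      have h4 := congrArg (fun v : EuclideanSpace ℝ (Fin p) => v a)
        (sum_mul_exp_smul_softMean_sub (B := B) (w := fun j => atRisk t (d j))
          (fun j _ => atRisk_nonneg _ _) (x d) θ₀)
      simp only [WithLp.ofLp_sum, Finset.sum_apply, PiLp.smul_apply, smul_eq_mul, PiLp.sub_apply,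
        PiLp.zero_apply] at h4
      exact h4
    simp [h3]
  simp [h2]

end MeanZero

/-! ### The mean Hessian is positive definite -/

section PosDef

variable {p : ℕ} {ι : Type*}

lemma inner_hessOp (B : Finset ι) (d : ι → Datum p) (θ v : EuclideanSpace ℝ (Fin p)) :
    ⟪v, hessOp B d θ v⟫ = (1 / (B.card : ℝ)) * ∑ i ∈ B, eventIndicator (d i) *
      ∑ j ∈ B, softmax B (riskWeight d i) (fun j => (d j).1) θ j *
        ⟪(d j).1 - riskMean B d θ i, v⟫ ^ 2 := by
  simp only [hessOp, smul_apply, sum_apply, inner_smul_right, inner_sum]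
  congr 1
  refine Finset.sum_congr rfl fun i hi => ?_
  rw [inner_softCov (fun j _ => riskWeight_nonneg d i j) (sum_riskWeight_pos d hi)]
  rfl

lemma softmax_sum_sq_nonneg (B : Finset ι) (d : ι → Datum p) (θ v : EuclideanSpace ℝ (Fin p))
    (i : ι) : ∀ j ∈ B, 0 ≤ softmax B (riskWeight d i) (fun j => (d j).1) θ j *
        ⟪(d j).1 - riskMean B d θ i, v⟫ ^ 2 := fun j hj =>
  mul_nonneg (softmax_nonneg (fun j _ => riskWeight_nonneg d i j) θ hj) (sq_nonneg _)

lemma inner_hessOp_nonneg (B : Finset ι) (d : ι → Datum p) (θ v : EuclideanSpace ℝ (Fin p)) :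
    0 ≤ ⟪v, hessOp B d θ v⟫ := by
  rw [inner_hessOp]
  exact mul_nonneg (by positivity) (Finset.sum_nonneg fun i _ =>
    mul_nonneg (eventIndicator_nonneg _) (Finset.sum_nonneg (softmax_sum_sq_nonneg B d θ v i)))

/-- The Hessian is positive in a direction that separates an observed failure from another subject
at risk. -/
lemma inner_hessOp_pos {B : Finset ι} {d : ι → Datum p} (θ : EuclideanSpace ℝ (Fin p))
    {v : EuclideanSpace ℝ (Fin p)} {i j : ι} (hi : i ∈ B) (hj : j ∈ B) (he : (d i).2.2 = true)
    (hij : (d i).2.1 ≤ (d j).2.1) (hv : ⟪(d i).1, v⟫ ≠ ⟪(d j).1, v⟫) :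
    0 < ⟪v, hessOp B d θ v⟫ := by
  have hB : (0 : ℝ) < B.card := by exact_mod_cast Finset.card_pos.2 ⟨i, hi⟩
  have h0 := softmax_sum_sq_nonneg B d θ v i
  rw [inner_hessOp]
  refine mul_pos (by positivity) (Finset.sum_pos' (fun i _ =>
    mul_nonneg (eventIndicator_nonneg _) (Finset.sum_nonneg (softmax_sum_sq_nonneg B d θ v i)))
    ⟨i, hi, ?_⟩)
  have hE : eventIndicator (d i) = 1 := by simp [eventIndicator, he]
  rw [hE, one_mul]
  refine lt_of_le_of_ne (Finset.sum_nonneg h0) fun hz => hv ?_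
  have hz' := (Finset.sum_eq_zero_iff_of_nonneg h0).1 hz.symm
  have hpos : ∀ k ∈ B, riskWeight d i k = 1 →
      0 < softmax B (riskWeight d i) (fun j => (d j).1) θ k := fun k hk hw => by
    unfold softmax
    rw [hw]
    exact div_pos (by positivity)
      (sum_mul_exp_pos (fun j _ => riskWeight_nonneg d i j) (sum_riskWeight_pos d hi) _)
  have hzero : ∀ k ∈ B, riskWeight d i k = 1 → ⟪(d k).1, v⟫ = ⟪riskMean B d θ i, v⟫ :=
    fun k hk hw => by
      have := (mul_eq_zero.1 (hz' k hk)).resolve_left (hpos k hk hw).ne'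
      rw [sq_eq_zero_iff, inner_sub_left, sub_eq_zero] at this
      exact this
  rw [hzero i hi (riskWeight_self d i), hzero j hj (by simp [riskWeight, hij])]

lemma inner_hessOp_eq_sum (B : Finset ι) (d : ι → Datum p) (θ v : EuclideanSpace ℝ (Fin p)) :
    ⟪v, hessOp B d θ v⟫ = ∑ a, ∑ b, v a * v b * hessMat B d θ a b := by
  have h1 : hessOp B d θ v = ∑ b, v b • hessOp B d θ (EuclideanSpace.single b 1) := by
    conv_lhs => rw [← (EuclideanSpace.basisFun (Fin p) ℝ).sum_repr v]
    simp
  rw [h1, inner_sum]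
  simp only [inner_smul_right, PiLp.inner_apply, hessMat, Matrix.of_apply, Finset.mul_sum]
  rw [Finset.sum_comm]
  refine Finset.sum_congr rfl fun a _ => Finset.sum_congr rfl fun b _ => ?_
  simp
  ring

variable {P : Measure (Datum p)} [IsProbabilityMeasure P] {τ R : ℝ} {lam : ℝ → ℝ}
  {θ₀ : EuclideanSpace ℝ (Fin p)}

/-- The mean Hessian of the loss of a mini-batch of size `s`. -/
def meanHess (P : Measure (Datum p)) [IsProbabilityMeasure P] (R : ℝ)
    (θ₀ : EuclideanSpace ℝ (Fin p)) (s : ℕ) : Matrix (Fin p) (Fin p) ℝ :=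
  Matrix.of fun a b => ∫ d, hessKernel R θ₀ a b (Finset.range s) d ∂(iidLaw P)

/-- Two independent observations both fail with positive probability; given the first, the covariate
of the second avoids the hyperplane through the first almost surely. -/
lemma CoxLaw.measure_separated_ne_zero (h : CoxLaw P τ R lam θ₀) {v : EuclideanSpace ℝ (Fin p)}
    (hv : v ≠ 0) : iidLaw P {d | (d 0).2.2 = true ∧ (d 1).2.2 = true ∧
      ⟪(d 0).1, v⟫ ≠ ⟪(d 1).1, v⟫} ≠ 0 := by
  have hE : MeasurableSet {z : Datum p | z.2.2 = true} :=
    measurableSet_eq_fun (by fun_prop) (by fun_prop)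
  have h1 : iidLaw P (Set.pi ((Finset.range 2 : Finset ℕ) : Set ℕ)
      fun _ => {z : Datum p | z.2.2 = true}) ≠ 0 := by
    rw [Measure.infinitePi_pi _ fun i _ => hE]
    exact Finset.prod_ne_zero_iff.2 fun i _ => h.event_pos
  have h2 : iidLaw P {d | ⟪(d 0).1, v⟫ = ⟪(d 1).1, v⟫} = 0 := by
    have hS : MeasurableSet {d : ℕ → Datum p | ⟪(d 0).1, v⟫ = ⟪(d 1).1, v⟫} := by
      have hx : ∀ i, Measurable fun d : ℕ → Datum p => ⟪(d i).1, v⟫ := fun i =>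
        (by fun_prop : Measurable fun d : ℕ → Datum p => (d i).1).inner measurable_const
      exact measurableSet_eq_fun (hx 0) (hx 1)
    have hS' := measurable_update_prod (β := Datum p) 1 hS
    rw [← map_update_iidLaw P 1, Measure.map_apply (measurable_update_prod 1) hS,
      Measure.measure_prod_null hS']
    refine Eventually.of_forall fun d => ?_
    have := h.hyperplane v hv ⟪(d 0).1, v⟫
    simpa [preimage, eq_comm] using this
  intro h0
  refine h1 (measure_mono_null (fun d hd => ?_) (measure_union_null h0 h2))
  have h3 : (d 0).2.2 = true := hd 0 (by simp)
  have h4 : (d 1).2.2 = true := hd 1 (by simp)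
  by_cases h5 : ⟪(d 0).1, v⟫ = ⟪(d 1).1, v⟫
  · exact Or.inr h5
  · exact Or.inl ⟨h3, h4, h5⟩

lemma inner_toEuclideanCLM (M : Matrix (Fin p) (Fin p) ℝ) (v : EuclideanSpace ℝ (Fin p)) :
    ⟪Matrix.toEuclideanCLM (𝕜 := ℝ) M v, v⟫ = ∑ a, ∑ b, v a * v b * M a b := by
  simp only [PiLp.inner_apply, Matrix.ofLp_toEuclideanCLM, Matrix.mulVec, dotProduct]
  refine Finset.sum_congr rfl fun a _ => ?_
  simp only [RCLike.inner_apply, conj_trivial, Finset.mul_sum]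
  exact Finset.sum_congr rfl fun b _ => by ring

/-- The quadratic form is nonnegative for all data, so its mean can vanish only if it is zero almost
surely. It is positive whenever two members of the batch are observed failures separated by `v`. -/
lemma CoxLaw.integral_inner_hessOp_pos (h : CoxLaw P τ R lam θ₀) {s : ℕ} (hs : 2 ≤ s)
    {v : EuclideanSpace ℝ (Fin p)} (hv : v ≠ 0) :
    0 < ⟪Matrix.toEuclideanCLM (𝕜 := ℝ) (meanHess P R θ₀ s) v, v⟫ := by
  have hint : ∀ a b, Integrable (fun d => v a * v b * hessKernel R θ₀ a b (Finset.range s) d)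
      (iidLaw P) := fun a b =>
    (SymmKernel.integrable_of_measurable ((symmKernel_hess h.radius_nonneg θ₀ a b).measurable _)
      ((symmKernel_hess h.radius_nonneg θ₀ a b).abs_le _)).const_mul _
  have hsum : ∀ d : ℕ → Datum p, ⟪v, hessOp (Finset.range s) (truncate R ∘ d) θ₀ v⟫
      = ∑ a, ∑ b, v a * v b * hessKernel R θ₀ a b (Finset.range s) d := fun d =>
    inner_hessOp_eq_sum _ _ _ _
  have h1 : ⟪Matrix.toEuclideanCLM (𝕜 := ℝ) (meanHess P R θ₀ s) v, v⟫
      = ∫ d, ⟪v, hessOp (Finset.range s) (truncate R ∘ d) θ₀ v⟫ ∂(iidLaw P) := by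
    rw [inner_toEuclideanCLM]
    simp only [hsum]
    rw [integral_finsetSum _ fun a _ => integrable_finsetSum _ fun b _ => hint a b]
    refine Finset.sum_congr rfl fun a _ => ?_
    rw [integral_finsetSum _ fun b _ => hint a b]
    refine Finset.sum_congr rfl fun b _ => ?_
    rw [integral_const_mul]
    rfl
  have hint' : Integrable
      (fun d => ⟪v, hessOp (Finset.range s) (truncate R ∘ d) θ₀ v⟫) (iidLaw P) := by
    simp only [hsum]
    exact integrable_finsetSum _ fun a _ => integrable_finsetSum _ fun b _ => hint a b
  rw [h1, integral_pos_iff_support_of_nonneg (fun d => inner_hessOp_nonneg _ _ _ _) hint']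
  refine pos_iff_ne_zero.2 fun h0 => h.measure_separated_ne_zero hv ?_
  have hR : ∀ᵐ d ∂(iidLaw P), ∀ i : ℕ, ‖(d i).1‖ ≤ R := by
    rw [ae_all_iff]
    intro i
    have hm := measurePreserving_eval_infinitePi (fun _ : ℕ => P) i
    exact hm.quasiMeasurePreserving.ae h.norm_le
  rw [ae_iff] at hR
  refine measure_mono_null (fun d hd => ?_) (measure_union_null h0 hR)
  by_cases hd' : ∀ i : ℕ, ‖(d i).1‖ ≤ R
  · refine Or.inl ?_
    have ht : truncate R ∘ d = d := funext fun i => truncate_eq_self (hd' i)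
    rw [Function.mem_support, ht]
    obtain ⟨he0, he1, hne⟩ := hd
    have m0 : 0 ∈ Finset.range s := Finset.mem_range.2 (by omega)
    have m1 : 1 ∈ Finset.range s := Finset.mem_range.2 (by omega)
    -- Whichever fails first has the other at risk. Requiring both to be failures removes any need
    -- to control the order.
    rcases le_total (d 0).2.1 (d 1).2.1 with hle | hle
    · exact (inner_hessOp_pos θ₀ m0 m1 he0 hle hne).ne'
    · exact (inner_hessOp_pos θ₀ m1 m0 he1 hle (Ne.symm hne)).ne'
  · exact Or.inr hd'

lemma exists_coercive {A : EuclideanSpace ℝ (Fin p) →L[ℝ] EuclideanSpace ℝ (Fin p)}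
    (hA : ∀ v, v ≠ 0 → 0 < ⟪A v, v⟫) : ∃ c : ℝ, 0 < c ∧ ∀ v, c * ‖v‖ ^ 2 ≤ ⟪A v, v⟫ := by
  -- The unit sphere is empty in dimension `0`; otherwise the constant is the minimum of the form
  -- over this compact set.
  rcases (Metric.sphere (0 : EuclideanSpace ℝ (Fin p)) 1).eq_empty_or_nonempty with h | h
  · refine ⟨1, one_pos, fun v => ?_⟩
    have hv : v = 0 := by
      by_contra hv
      have : (‖v‖⁻¹ • v) ∈ Metric.sphere (0 : EuclideanSpace ℝ (Fin p)) 1 := by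
        simp [norm_smul, hv]
      rw [h] at this
      exact this
    simp [hv]
  · obtain ⟨u, hu, hmin⟩ := (isCompact_sphere (0 : EuclideanSpace ℝ (Fin p)) 1).exists_isMinOn h
      (f := fun v => ⟪A v, v⟫) (by fun_prop)
    have hu1 : ‖u‖ = 1 := by simpa using hu
    refine ⟨⟪A u, u⟫, hA u (by rintro rfl; simp at hu1), fun v => ?_⟩
    rcases eq_or_ne v 0 with rfl | hv
    · simp
    · have hn : ‖v‖ ≠ 0 := by simpa using hv
      have hs : (‖v‖⁻¹ • v) ∈ Metric.sphere (0 : EuclideanSpace ℝ (Fin p)) 1 := by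
        simp [norm_smul, hv]
      have h1 : ⟪A u, u⟫ ≤ ⟪A (‖v‖⁻¹ • v), ‖v‖⁻¹ • v⟫ := hmin hs
      rw [map_smul, real_inner_smul_left, real_inner_smul_right] at h1
      calc _ ≤ (‖v‖⁻¹ * (‖v‖⁻¹ * ⟪A v, v⟫)) * ‖v‖ ^ 2 :=
            mul_le_mul_of_nonneg_right h1 (sq_nonneg _)
        _ = _ := by field_simp

lemma CoxLaw.exists_coercive_meanHess (h : CoxLaw P τ R lam θ₀) {s : ℕ} (hs : 2 ≤ s) :
    ∃ c : ℝ, 0 < c ∧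
      ∀ v, c * ‖v‖ ^ 2 ≤ ⟪Matrix.toEuclideanCLM (𝕜 := ℝ) (meanHess P R θ₀ s) v, v⟫ :=
  exists_coercive fun _ hv => h.integral_inner_hessOp_pos hs hv

lemma isUnit_det_of_coercive {M : Matrix (Fin p) (Fin p) ℝ} {c : ℝ} (hc : 0 < c)
    (h : ∀ v, c * ‖v‖ ^ 2 ≤ ⟪Matrix.toEuclideanCLM (𝕜 := ℝ) M v, v⟫) : IsUnit M.det := by
  rw [← Matrix.isUnit_iff_isUnit_det, ← Matrix.mulVec_injective_iff_isUnit]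
  refine (injective_iff_map_eq_zero (Matrix.mulVecLin M)).2 fun v hv => ?_
  have h1 := h (WithLp.toLp 2 v)
  rw [Matrix.toEuclideanCLM_toLp] at h1
  rw [Matrix.mulVecLin_apply] at hv
  rw [hv] at h1
  simp only [WithLp.toLp_zero, inner_zero_left] at h1
  have h2 : ‖WithLp.toLp 2 v‖ ^ 2 ≤ 0 := by
    by_contra! h3
    nlinarith
  have h3 : WithLp.toLp 2 v = (0 : EuclideanSpace ℝ (Fin p)) := by
    rw [← norm_eq_zero]; nlinarith [norm_nonneg (WithLp.toLp 2 v : EuclideanSpace ℝ (Fin p))]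
  simpa using h3

end PosDef

/-! ### Central limit theorem in several dimensions -/

section CLT

variable {p : ℕ} {Ω : Type*} [MeasurableSpace Ω] {μ : Measure Ω} [IsProbabilityMeasure μ]

/-- Cramér–Wold: the characteristic function at `t` is that of the projections on `t` at the number
`1`, where the scalar theorem applies. The covariance `V` may be singular. -/
lemma tendstoInDistribution_inv_sqrt_smul_sum {Y : ℕ → Ω → EuclideanSpace ℝ (Fin p)}
    (hY : ∀ i, Measurable (Y i)) {K : ℝ} (hK : ∀ ω, ‖Y 0 ω‖ ≤ K) (hind : iIndepFun Y μ)
    (hid : ∀ i, IdentDistrib (Y i) (Y 0) μ μ) (hmean : ∀ t, ∫ ω, ⟪Y 0 ω, t⟫ ∂μ = 0)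
    {V : Matrix (Fin p) (Fin p) ℝ} (hV : V.PosSemidef)
    (hcov : ∀ t : EuclideanSpace ℝ (Fin p),
      ∫ ω, ⟪Y 0 ω, t⟫ ^ 2 ∂μ = t.ofLp ⬝ᵥ V.mulVec t.ofLp) :
    TendstoInDistribution (fun (n : ℕ) ω => (√(n : ℝ))⁻¹ • ∑ i ∈ Finset.range n, Y i ω) atTop id
      (fun _ => μ) (multivariateGaussian 0 V) where
  forall_aemeasurable n := by
    have := (Finset.measurable_fun_sum (Finset.range n) fun i _ => hY i).const_smul (√(n : ℝ))⁻¹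
    exact this.aemeasurable
  tendsto := by
    refine ProbabilityMeasure.tendsto_iff_tendsto_charFun.2 fun t => ?_
    have hinner : Measurable fun y : EuclideanSpace ℝ (Fin p) => ⟪y, t⟫ :=
      measurable_id.inner measurable_const
    have h0 : Measurable fun ω => ⟪Y 0 ω, t⟫ := hinner.comp (hY 0)
    have hvar : Var[fun ω => ⟪Y 0 ω, t⟫; μ] = t.ofLp ⬝ᵥ V.mulVec t.ofLp := by
      rw [variance_eq_integral h0.aemeasurable, hmean]
      simpa using hcov t
    have h1 := tendstoInDistribution_inv_sqrt_mul_sum_sub (P := μ)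
      (X := fun i ω => ⟪Y i ω, t⟫) (Y := id)
      (P' := gaussianReal 0 Var[fun ω => ⟪Y 0 ω, t⟫; μ].toNNReal) HasLaw.id
      (MemLp.of_bound h0.aestronglyMeasurable (K * ‖t‖) (Eventually.of_forall fun ω =>
        (abs_real_inner_le_norm _ _).trans (mul_le_mul_of_nonneg_right (hK ω) (norm_nonneg t))))
      (hind.comp (fun _ y => ⟪y, t⟫) fun _ => hinner)
      (fun i => (hid i).comp hinner)
    have h2 := (ProbabilityMeasure.tendsto_iff_tendsto_charFun.1 h1.tendsto) 1
    simp only [ProbabilityMeasure.coe_mk, Measure.map_id] at h2 ⊢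
    rw [charFun_gaussianReal, hvar] at h2
    rw [charFun_multivariateGaussian hV]
    have hlim : Complex.exp (((1 : ℝ) : ℂ) * ((0 : ℝ) : ℂ) * Complex.I
          - (((t.ofLp ⬝ᵥ V.mulVec t.ofLp).toNNReal : ℝ) : ℂ) * ((1 : ℝ) : ℂ) ^ 2 / 2)
        = Complex.exp (((inner ℝ t (0 : EuclideanSpace ℝ (Fin p)) : ℝ) : ℂ) * Complex.I
          - ((t.ofLp ⬝ᵥ V.mulVec t.ofLp : ℝ) : ℂ) / 2) := by
      rw [Real.coe_toNNReal _ (by rw [← hvar]; exact variance_nonneg _ _), inner_zero_right]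
      simp
    rw [← hlim]
    refine h2.congr fun n => ?_
    have hsum : Measurable fun ω => (√(n : ℝ))⁻¹ • ∑ i ∈ Finset.range n, Y i ω := by
      have := (Finset.measurable_fun_sum (Finset.range n) fun i _ => hY i).const_smul
        (√(n : ℝ))⁻¹
      exact this
    have hsum' : AEMeasurable (fun ω => (√(n : ℝ))⁻¹ *
        (∑ i ∈ Finset.range n, ⟪Y i ω, t⟫ - n * ∫ ω, ⟪Y 0 ω, t⟫ ∂μ)) μ :=
      h1.forall_aemeasurable n
    rw [charFun_apply_real, charFun_apply, integral_map hsum' (by fun_prop),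
      integral_map hsum.aemeasurable]
    · refine integral_congr_ae (Eventually.of_forall fun ω => ?_)
      simp only [hmean, real_inner_smul_left, sum_inner]
      simp
    · have : Continuous fun x : EuclideanSpace ℝ (Fin p) =>
          Complex.exp (((⟪x, t⟫ : ℝ) : ℂ) * Complex.I) :=
        Complex.continuous_exp.comp ((Complex.continuous_ofReal.comp
          (continuous_id.inner continuous_const)).mul continuous_const)
      exact this.aestronglyMeasurable

end CLT

/-! ### Modes of convergence -/

section Modes

variable {Ω : Type*} [MeasurableSpace Ω] {μ : Measure Ω} [IsProbabilityMeasure μ]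

lemma tendstoInMeasure_of_integral_sq {X : ℕ → Ω → ℝ}
    (hint : ∀ᶠ n in atTop, Integrable (fun ω => X n ω ^ 2) μ)
    (h : Tendsto (fun n => ∫ ω, X n ω ^ 2 ∂μ) atTop (𝓝 0)) :
    TendstoInMeasure μ X atTop fun _ => 0 := by
  rw [tendstoInMeasure_iff_norm]
  intro ε hε
  have hb : Tendsto (fun n => ENNReal.ofReal ((ε ^ 2)⁻¹ * ∫ ω, X n ω ^ 2 ∂μ)) atTop (𝓝 0) := by
    have := ENNReal.tendsto_ofReal (h.const_mul (ε ^ 2)⁻¹)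
    simpa using this
  refine tendsto_of_tendsto_of_tendsto_of_le_of_le' tendsto_const_nhds hb
    (Eventually.of_forall fun _ => zero_le) (hint.mono fun n hn => ?_)
  have h1 := mul_meas_ge_le_integral_of_nonneg (Eventually.of_forall fun ω => sq_nonneg (X n ω))
    hn (ε ^ 2)
  have h2 : {ω | ε ≤ ‖X n ω - 0‖} ⊆ {ω | ε ^ 2 ≤ X n ω ^ 2} := fun ω hω => by
    simp only [sub_zero, Set.mem_ofPred_eq, Real.norm_eq_abs] at hω ⊢
    rw [← sq_abs (X n ω)]
    exact pow_le_pow_left₀ hε.le hω 2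
  refine (measure_mono h2).trans ?_
  rw [← ofReal_measureReal]
  refine ENNReal.ofReal_le_ofReal ?_
  rw [le_inv_mul_iff₀ (by positivity)]
  exact h1

lemma tendstoInMeasure_sum_zero {ι : Type*} (J : Finset ι) {X : ι → ℕ → Ω → ℝ}
    (h : ∀ i ∈ J, TendstoInMeasure μ (X i) atTop fun _ => 0) :
    TendstoInMeasure μ (fun n ω => ∑ i ∈ J, |X i n ω|) atTop fun _ => 0 := by
  rw [tendstoInMeasure_iff_norm]
  intro ε hε
  simp only [tendstoInMeasure_iff_norm] at h
  set δ := ε / (J.card + 1) with hδ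
  have hδ0 : 0 < δ := by positivity
  have h1 : Tendsto (fun n => ∑ i ∈ J, μ {ω | δ ≤ ‖X i n ω - 0‖}) atTop (𝓝 0) := by
    have := tendsto_finsetSum J fun i hi => h i hi δ hδ0
    simpa using this
  refine tendsto_of_tendsto_of_tendsto_of_le_of_le tendsto_const_nhds h1
    (fun _ => zero_le) fun n => ?_
  refine le_trans (measure_mono fun ω hω => ?_) (measure_biUnion_finset_le J _)
  simp only [Set.mem_ofPred_eq, sub_zero, mem_iUnion, exists_prop] at hω ⊢
  by_contra! hlt
  rw [Real.norm_of_nonneg (Finset.sum_nonneg fun _ _ => abs_nonneg _)] at hω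
  have h2 : ∑ i ∈ J, |X i n ω| ≤ J.card * δ := by
    rw [← nsmul_eq_mul]
    exact Finset.sum_le_card_nsmul _ _ _ fun i hi => (hlt i hi).le
  have h3 : (J.card : ℝ) * δ < (J.card + 1) * δ := by linarith
  have h4 : ((J.card : ℝ) + 1) * δ = ε := by rw [hδ]; field_simp
  linarith

variable {E : Type*} [NormedAddCommGroup E] [MeasurableSpace E] [BorelSpace E]

/-- Tightness from convergence: the closed tails `k ≤ ‖x‖` decrease to the empty set under the limit
law, and the portmanteau theorem transfers a small tail to the sequence. -/
lemma exists_measure_norm_gt_le {X : ℕ → Ω → E} {Ω' : Type*}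
    [MeasurableSpace Ω'] {μ' : Measure Ω'} [IsProbabilityMeasure μ'] {Z : Ω' → E}
    (h : TendstoInDistribution X atTop Z (fun _ => μ) μ') {ε : ℝ} (hε : 0 < ε) :
    ∃ K : ℝ, 0 < K ∧ ∀ᶠ n in atTop, μ {ω | K < ‖X n ω‖} ≤ ENNReal.ofReal ε := by
  have hanti : Tendsto (fun k : ℕ => (μ'.map Z) {x | (k : ℝ) ≤ ‖x‖}) atTop (𝓝 0) := by
    have hempty : ⋂ k : ℕ, {x : E | (k : ℝ) ≤ ‖x‖} = ∅ := by
      ext x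
      simp only [mem_iInter, Set.mem_ofPred_eq, mem_empty_iff_false, iff_false, not_forall, not_le]
      exact exists_nat_gt ‖x‖
    have := Measure.isProbabilityMeasure_map h.aemeasurable_limit
    rw [← measure_empty (μ := μ'.map Z), ← hempty]
    refine tendsto_measure_iInter_atTop (fun k => ?_) (fun a b hab x hx => ?_)
      ⟨0, measure_ne_top _ _⟩
    · exact (isClosed_le continuous_const continuous_norm).measurableSet.nullMeasurableSet
    · exact le_trans (Nat.cast_le.2 hab) (show (b : ℝ) ≤ ‖x‖ from hx)
  obtain ⟨k, hk⟩ := ((tendsto_order.1 hanti).2 (ENNReal.ofReal ε) (by simpa using hε)).exists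
  have hcl : IsClosed {x : E | (k : ℝ) ≤ ‖x‖} := isClosed_le continuous_const continuous_norm
  have h1 := ProbabilityMeasure.limsup_measure_closed_le_of_tendsto h.tendsto hcl
  have h2 := eventually_lt_of_limsup_lt (h1.trans_lt hk)
  -- Any larger radius serves as well; adding `1` makes it positive.
  refine ⟨k + 1, by positivity, h2.mono fun n hn => ?_⟩
  have hn' : (μ.map (X n)) {x : E | (k : ℝ) ≤ ‖x‖} < ENNReal.ofReal ε := hn
  rw [Measure.map_apply_of_aemeasurable (h.forall_aemeasurable n) hcl.measurableSet] at hn'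
  refine (measure_mono fun ω hω => ?_).trans hn'.le
  simp only [Set.mem_ofPred_eq, mem_preimage] at hω ⊢
  linarith

/-- Convergence in distribution of an estimator whose error is equivalent to a linear statistic. -/
lemma tendstoInDistribution_of_expansion [SecondCountableTopology E] [NormedSpace ℝ E]
    {a : ℕ → ℝ} (ha0 : ∀ n, 0 ≤ a n)
    (ha : Tendsto a atTop atTop) {U W : ℕ → Ω → E} {η : ℕ → Ω → ℝ} {Ω' : Type*}
    [MeasurableSpace Ω'] {μ' : Measure Ω'} [IsProbabilityMeasure μ'] {Z : Ω' → E}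
    (hU : ∀ n, AEMeasurable (U n) μ)
    (hW : TendstoInDistribution (fun n ω => a n • W n ω) atTop Z (fun _ => μ) μ')
    (hη : TendstoInMeasure μ η atTop fun _ => 0) {c₁ c₂ k₁ k₂ : ℝ} (hc₁ : 0 < c₁) (hc₂ : 0 < c₂)
    (hk₁ : 0 ≤ k₁) (hk₂ : 0 ≤ k₂)
    (hexp : ∀ n, ∀ᵐ ω ∂μ, η n ω ≤ c₁ → ‖W n ω‖ < c₂ →
      ‖U n ω - W n ω‖ ≤ (k₁ * ‖W n ω‖ + |η n ω|) * (k₂ * ‖W n ω‖)) :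
    TendstoInDistribution (fun n ω => a n • U n ω) atTop Z (fun _ => μ) μ' := by
  refine tendstoInDistribution_of_tendstoInMeasure_sub _ _ hW ?_ fun n => (hU n).const_smul _
  rw [tendstoInMeasure_iff_norm] at hη ⊢
  intro ε hε
  rw [ENNReal.tendsto_atTop_zero]
  intro ρ hρ
  rcases eq_or_ne ρ ⊤ with rfl | hρtop
  · exact ⟨0, fun _ _ => le_top⟩
  have hρ' : 0 < ρ.toReal / 2 := half_pos (ENNReal.toReal_pos hρ.ne' hρtop)
  obtain ⟨K, hK0, hK⟩ := exists_measure_norm_gt_le hW hρ'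
  -- Where `|η n| < ζ` and `‖a n • W n‖ ≤ K`, the part of the scaled error due to `η` is at most `ε
  -- / 4`.
  set ζ := min c₁ (ε / (4 * (k₂ * K + 1))) with hζ
  have hζ0 : 0 < ζ := lt_min hc₁ (by positivity)
  have hη' := (ENNReal.tendsto_atTop_zero.1 (hη ζ hζ0)) (ENNReal.ofReal (ρ.toReal / 2))
    (by simpa using hρ')
  obtain ⟨N₁, hN₁⟩ := hη'
  -- For such `a n`, the bound `‖W n‖ ≤ K / a n` gives `‖W n‖ < c₂` and makes the quadratic part of
  -- the scaled error at most `ε / 4`.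
  have hbig : ∀ᶠ n in atTop, max (K / c₂ + 1) (4 * (k₁ * K * (k₂ * K)) / ε + 1) ≤ a n :=
    ha.eventually_ge_atTop _
  obtain ⟨N, hN⟩ := eventually_atTop.1 (hK.and (hbig.and (eventually_ge_atTop N₁)))
  refine ⟨N, fun n hn => ?_⟩
  obtain ⟨h1, h2, h3⟩ := hN n hn
  have ha1 : K / c₂ < a n := lt_of_lt_of_le (by linarith) ((le_max_left _ _).trans h2)
  have ha2 : 4 * (k₁ * K * (k₂ * K)) / ε < a n :=
    lt_of_lt_of_le (by linarith) ((le_max_right _ _).trans h2)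
  have hapos : 0 < a n := lt_of_le_of_lt (by positivity) ha1
  have hsum : ENNReal.ofReal (ρ.toReal / 2) + ENNReal.ofReal (ρ.toReal / 2) = ρ := by
    rw [← ENNReal.ofReal_add hρ'.le hρ'.le, add_halves, ENNReal.ofReal_toReal hρtop]
  rw [← hsum]
  have hae := hexp n
  rw [ae_iff] at hae
  have hsub : {ω | ε ≤ ‖((fun n ω => a n • U n ω) - fun n ω => a n • W n ω) n ω
        - (0 : ℕ → Ω → E) n ω‖}
      ⊆ ({ω | K < ‖a n • W n ω‖} ∪ {ω | ζ ≤ ‖η n ω - 0‖})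
        ∪ {ω | ¬ (η n ω ≤ c₁ → ‖W n ω‖ < c₂ →
          ‖U n ω - W n ω‖ ≤ (k₁ * ‖W n ω‖ + |η n ω|) * (k₂ * ‖W n ω‖))} := by
    intro ω hω
    by_contra hnot
    simp only [mem_union, Set.mem_ofPred_eq, not_or, not_lt, not_le, not_not, sub_zero] at hnot
    obtain ⟨⟨g1, g2⟩, g3⟩ := hnot
    have hωe : ε ≤ a n * ‖U n ω - W n ω‖ := by
      have : ε ≤ ‖a n • U n ω - a n • W n ω - 0‖ := hω
      rwa [sub_zero, ← smul_sub, norm_smul, Real.norm_of_nonneg (ha0 n)] at this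
    rw [norm_smul, Real.norm_of_nonneg (ha0 n)] at g1
    rw [Real.norm_eq_abs] at g2
    have g4 : ‖W n ω‖ ≤ K / a n := by rwa [le_div_iff₀ hapos, mul_comm]
    have g5 : ‖W n ω‖ < c₂ := by
      refine g4.trans_lt ?_
      rw [div_lt_iff₀ hapos]
      rwa [div_lt_iff₀ hc₂, mul_comm] at ha1
    have g6 := g3 ((le_abs_self _).trans (g2.le.trans (min_le_left _ _))) g5
    have hζ2 : |η n ω| ≤ ε / (4 * (k₂ * K + 1)) := g2.le.trans (min_le_right _ _)
    have g7 : a n * ‖U n ω - W n ω‖ ≤ (k₁ * (K / a n) + ε / (4 * (k₂ * K + 1))) * (k₂ * K) := by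
      calc a n * ‖U n ω - W n ω‖
          ≤ a n * ((k₁ * ‖W n ω‖ + |η n ω|) * (k₂ * ‖W n ω‖)) :=
            mul_le_mul_of_nonneg_left g6 (ha0 n)
        _ = (k₁ * ‖W n ω‖ + |η n ω|) * (k₂ * (a n * ‖W n ω‖)) := by ring
        _ ≤ _ := by gcongr
    have g8 : k₁ * (K / a n) * (k₂ * K) ≤ ε / 4 := by
      rw [div_lt_iff₀ hε] at ha2
      have : k₁ * (K / a n) * (k₂ * K) = (k₁ * K * (k₂ * K)) / a n := by ring
      rw [this, div_le_iff₀ hapos]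
      linarith
    have g9 : ε / (4 * (k₂ * K + 1)) * (k₂ * K) ≤ ε / 4 := by
      have hk : 0 ≤ k₂ * K := by positivity
      rw [div_mul_eq_mul_div, div_le_div_iff₀ (by positivity) (by norm_num)]
      nlinarith
    linarith
  refine (measure_mono hsub).trans ((measure_union_le _ _).trans ?_)
  rw [hae, add_zero]
  exact (measure_union_le _ _).trans (add_le_add h1 (hN₁ n h3))

/-- Convergence in distribution depends on the laws only. -/
lemma tendstoInDistribution_comp_of_map_eq {β : Type*} [MeasurableSpace β] {ν : Measure β}
    [IsProbabilityMeasure ν] {d : ℕ → Ω → β} (hd : ∀ n, AEMeasurable (d n) μ)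
    (hdν : ∀ n, μ.map (d n) = ν) {X : ℕ → β → E} (hX : ∀ n, Measurable (X n)) {Ω' : Type*}
    [MeasurableSpace Ω'] {μ' : Measure Ω'} [IsProbabilityMeasure μ'] {Z : Ω' → E}
    (h : TendstoInDistribution X atTop Z (fun _ => ν) μ') :
    TendstoInDistribution (fun n ω => X n (d n ω)) atTop Z (fun _ => μ) μ' where
  forall_aemeasurable n := (hX n).comp_aemeasurable (hd n)
  aemeasurable_limit := h.aemeasurable_limit
  tendsto := by
    refine h.tendsto.congr fun n => ?_
    ext1
    simp only [ProbabilityMeasure.coe_mk]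
    rw [← hdν n, AEMeasurable.map_map_of_aemeasurable (hX n).aemeasurable (hd n)]
    rfl

end Modes

/-! ### Second-moment matrices -/

section Gram

variable {p : ℕ} {Ω : Type*} [MeasurableSpace Ω] {μ : Measure Ω} [IsProbabilityMeasure μ]

/-- The matrix of second moments of a random vector. -/
def gram (μ : Measure Ω) (Y : Ω → EuclideanSpace ℝ (Fin p)) : Matrix (Fin p) (Fin p) ℝ :=
  Matrix.of fun a b => ∫ ω, Y ω a * Y ω b ∂μ

variable {Y : Ω → EuclideanSpace ℝ (Fin p)} {K : ℝ}

lemma integrable_coord_mul (hY : Measurable Y) (hK : ∀ ω, ‖Y ω‖ ≤ K) (a b : Fin p) :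
    Integrable (fun ω => Y ω a * Y ω b) μ := by
  have hm : ∀ a, Measurable fun ω => Y ω a := fun a =>
    (by fun_prop : Measurable fun v : EuclideanSpace ℝ (Fin p) => v a).comp hY
  have hb : ∀ a ω, ‖Y ω a‖ ≤ K := fun a ω => (PiLp.norm_apply_le (Y ω) a).trans (hK ω)
  refine Integrable.of_bound ((hm a).mul (hm b)).aestronglyMeasurable (K * K)
    (Eventually.of_forall fun ω => ?_)
  rw [norm_mul]
  exact mul_le_mul (hb a ω) (hb b ω) (norm_nonneg _) ((norm_nonneg _).trans (hb a ω))

lemma integral_inner_sq (hY : Measurable Y) (hK : ∀ ω, ‖Y ω‖ ≤ K)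
    (t : EuclideanSpace ℝ (Fin p)) :
    ∫ ω, ⟪Y ω, t⟫ ^ 2 ∂μ = t.ofLp ⬝ᵥ (gram μ Y).mulVec t.ofLp := by
  have h1 : ∀ ω, ⟪Y ω, t⟫ ^ 2 = ∑ a, ∑ b, t a * t b * (Y ω a * Y ω b) := fun ω => by
    rw [sq, PiLp.inner_apply, Finset.sum_mul_sum]
    refine Finset.sum_congr rfl fun a _ => Finset.sum_congr rfl fun b _ => ?_
    simp only [RCLike.inner_apply, conj_trivial]
    ring
  have hint := fun a b => (integrable_coord_mul (μ := μ) hY hK a b).const_mul (t a * t b)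
  simp_rw [h1]
  rw [integral_finsetSum _ fun a _ => integrable_finsetSum _ fun b _ => hint a b]
  simp only [dotProduct, Matrix.mulVec, Finset.mul_sum]
  refine Finset.sum_congr rfl fun a _ => ?_
  rw [integral_finsetSum _ fun b _ => hint a b]
  refine Finset.sum_congr rfl fun b _ => ?_
  rw [integral_const_mul]
  simp only [gram, Matrix.of_apply]
  ring

lemma posSemidef_gram (hY : Measurable Y) (hK : ∀ ω, ‖Y ω‖ ≤ K) : (gram μ Y).PosSemidef := by
  refine Matrix.PosSemidef.of_dotProduct_mulVec_nonneg ?_ fun x => ?_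
  · ext a b
    simp only [gram, Matrix.conjTranspose_apply, Matrix.of_apply, star_trivial]
    exact integral_congr_ae (Eventually.of_forall fun ω => mul_comm _ _)
  · have := integral_inner_sq (μ := μ) hY hK (WithLp.toLp 2 x)
    rw [star_trivial]
    rw [← this]
    exact integral_nonneg fun ω => sq_nonneg _

lemma gram_smul_toEuclideanCLM (hY : Measurable Y) (hK : ∀ ω, ‖Y ω‖ ≤ K) (c : ℝ)
    (A : Matrix (Fin p) (Fin p) ℝ) :
    gram μ (fun ω => c • Matrix.toEuclideanCLM (𝕜 := ℝ) A (Y ω))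
      = c ^ 2 • (A * gram μ Y * A.transpose) := by
  ext a b
  have h1 : ∀ ω, (c • Matrix.toEuclideanCLM (𝕜 := ℝ) A (Y ω)) a
        * (c • Matrix.toEuclideanCLM (𝕜 := ℝ) A (Y ω)) b
      = ∑ i, ∑ j, c ^ 2 * (A a i * A b j) * (Y ω i * Y ω j) := fun ω => by
    simp only [PiLp.smul_apply, smul_eq_mul, Matrix.ofLp_toEuclideanCLM, Matrix.mulVec, dotProduct]
    rw [mul_mul_mul_comm, Finset.sum_mul_sum, Finset.mul_sum]
    refine Finset.sum_congr rfl fun i _ => ?_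
    rw [Finset.mul_sum]
    exact Finset.sum_congr rfl fun j _ => by ring
  have hint := fun i j => (integrable_coord_mul (μ := μ) hY hK i j).const_mul
    (c ^ 2 * (A a i * A b j))
  simp only [gram, Matrix.of_apply, Matrix.smul_apply, smul_eq_mul, Matrix.mul_apply,
    Matrix.transpose_apply, h1]
  rw [integral_finsetSum _ fun i _ => integrable_finsetSum _ fun j _ => hint i j]
  simp only [Finset.sum_mul, Finset.mul_sum]
  rw [Finset.sum_comm]
  refine Finset.sum_congr rfl fun j _ => ?_
  rw [integral_finsetSum _ fun k _ => hint j k]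
  refine Finset.sum_congr rfl fun k _ => ?_
  rw [integral_const_mul]
  ring

end Gram

/-! ### Blocks of an i.i.d. sequence -/

section Blocks

variable {β : Type*} [MeasurableSpace β] (P : Measure β) [IsProbabilityMeasure P]

/-- The observations of the `b`-th block. -/
def blockData (s b : ℕ) (d : ℕ → β) (k : Fin s) : β := d (b * s + k)

lemma measurable_blockData (s b : ℕ) : Measurable (blockData (β := β) s b) :=
  measurable_pi_lambda _ fun _ => measurable_pi_apply _

lemma injective_mul_add (s : ℕ) : Function.Injective fun q : ℕ × Fin s => q.1 * s + (q.2 : ℕ) := by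
  rintro ⟨b, k⟩ ⟨b', k'⟩ h
  have hs : 0 < s := k.pos
  have h1 := congrArg (· / s) h
  have h2 : b = b' := by
    simpa [Nat.add_div_of_dvd_right, Nat.div_eq_of_lt k.2, Nat.div_eq_of_lt k'.2, hs] using h1
  subst h2
  simp only [Nat.add_left_cancel_iff, Fin.val_inj] at h
  rw [h]

/-- Reindexing along the injection `(b, k) ↦ b * s + k` and currying turn an i.i.d. sequence of
observations into an i.i.d. sequence of blocks. -/
lemma map_blockData (s : ℕ) : (iidLaw P).map (fun d b => blockData s b d)
    = Measure.infinitePi fun _ : ℕ => Measure.infinitePi fun _ : Fin s => P := by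
  have h1 := Measure.map_infinitePi_infinitePi_of_inj (P := fun _ : ℕ => P) (injective_mul_add s)
  have h2 := Measure.infinitePi_map_curry (fun (_ : ℕ) (_ : Fin s) => P)
  have h3 : Measurable fun (d : ℕ → β) (q : ℕ × Fin s) => d (q.1 * s + (q.2 : ℕ)) :=
    measurable_pi_lambda _ fun _ => measurable_pi_apply _
  rw [← h2, ← h1, Measure.map_map (by fun_prop) h3]
  rfl

lemma iIndepFun_blockData (s : ℕ) : iIndepFun (fun b => blockData (β := β) s b) (iidLaw P) ∧
    ∀ b, IdentDistrib (blockData (β := β) s b) (blockData s 0) (iidLaw P) (iidLaw P) := by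
  have h := map_blockData P s
  have hm : Measurable fun (d : ℕ → β) b => blockData s b d :=
    measurable_pi_lambda _ fun b => measurable_blockData s b
  have hb : ∀ b, (iidLaw P).map (blockData s b) = Measure.infinitePi fun _ : Fin s => P :=
    fun b => by
      have h1 := (measurePreserving_eval_infinitePi
        (fun _ : ℕ => Measure.infinitePi fun _ : Fin s => P) b).map_eq
      rw [← h, Measure.map_map (measurable_pi_apply b) hm] at h1
      exact h1
  refine ⟨?_, fun b => ⟨(measurable_blockData s b).aemeasurable,
    (measurable_blockData s 0).aemeasurable, by rw [hb, hb]⟩⟩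
  rw [iIndepFun_iff_map_fun_eq_infinitePi_map fun b => measurable_blockData s b, h]
  simp_rw [hb]

lemma block_eq_map (s b : ℕ) : block s b
    = (Finset.univ : Finset (Fin s)).map (Fin.valEmbedding.trans (addLeftEmbedding (b * s))) := by
  rw [← Finset.map_map, Fin.map_valEmbedding_univ, Nat.Iio_eq_range]
  rfl

end Blocks

/-! ### Asymptotic normality of the average score -/

section Normality

variable {p : ℕ} {P : Measure (Datum p)} [IsProbabilityMeasure P] {τ R : ℝ} {lam : ℝ → ℝ}
  {θ₀ : EuclideanSpace ℝ (Fin p)}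

lemma norm_le_sum_abs (w : EuclideanSpace ℝ (Fin p)) : ‖w‖ ≤ ∑ i, |w i| := by
  rw [EuclideanSpace.norm_eq]
  refine Real.sqrt_le_iff.2 ⟨Finset.sum_nonneg fun i _ => abs_nonneg _, ?_⟩
  simpa using Finset.sum_sq_le_sq_sum_of_nonneg (s := Finset.univ) (f := fun i => |w i|)
    fun i _ => abs_nonneg _

/-- The conditional expectation of the score given one observation of the mini-batch. -/
def scoreProj (P : Measure (Datum p)) [IsProbabilityMeasure P] (R : ℝ)
    (θ₀ : EuclideanSpace ℝ (Fin p)) (s : ℕ) (x : Datum p) : EuclideanSpace ℝ (Fin p) :=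
  WithLp.toLp 2 fun a => proj P (scoreKernel R θ₀ a) s x

/-- The average of the truncated scores of the mini-batches in `J`. -/
def avgScore (R : ℝ) (θ₀ : EuclideanSpace ℝ (Fin p)) (J : Finset (Finset ℕ)) (d : ℕ → Datum p) :
    EuclideanSpace ℝ (Fin p) :=
  (1 / (J.card : ℝ)) • ∑ B ∈ J, score B (truncate R ∘ d) θ₀

lemma measurable_avgScore (R : ℝ) (θ₀ : EuclideanSpace ℝ (Fin p)) (J : Finset (Finset ℕ)) :
    Measurable (avgScore R θ₀ J) := by
  have := (Finset.measurable_fun_sum J fun B _ =>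
    (measurable_score (B := B) θ₀).comp (measurable_truncate_comp R)).const_smul (1 / (J.card : ℝ))
  exact this

lemma measurable_toLp {α : Type*} [MeasurableSpace α] {f : α → Fin p → ℝ}
    (hf : ∀ a, Measurable fun x => f x a) :
    Measurable fun x => (WithLp.toLp 2 (f x) : EuclideanSpace ℝ (Fin p)) :=
  (MeasurableEquiv.toLp 2 (Fin p → ℝ)).measurable.comp (measurable_pi_lambda _ hf)

lemma measurable_scoreProj (hR : 0 ≤ R) (s : ℕ) : Measurable (scoreProj P R θ₀ s) :=
  measurable_toLp fun a => (symmKernel_score hR θ₀ a).measurable_proj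

lemma norm_scoreProj_le (hR : 0 ≤ R) (s : ℕ) (x : Datum p) :
    ‖scoreProj P R θ₀ s x‖ ≤ p * (2 * R) := by
  refine (norm_le_sum_abs _).trans ?_
  have : ∑ a, |scoreProj P R θ₀ s x a| ≤ ∑ _a : Fin p, 2 * R :=
    Finset.sum_le_sum fun a _ => (symmKernel_score hR θ₀ a).abs_proj_le x
  simpa using this

/-- All mini-batches of size `s` from the first `n` observations. -/
abbrev allBatches (s n : ℕ) : Finset (Finset ℕ) := (Finset.range n).powersetCard s

lemma avgScore_allBatches (s n : ℕ) (d : ℕ → Datum p) (a : Fin p) :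
    avgScore R θ₀ (allBatches s n) d a = uStat (scoreKernel R θ₀ a) s n d := by
  simp only [avgScore, uStat, PiLp.smul_apply, smul_eq_mul, WithLp.ofLp_sum, Finset.sum_apply,
    Finset.card_powersetCard, Finset.card_range, scoreKernel]

/-- After the Hájek projection, the scaled average score is `n ^ (-1/2)` times a sum of i.i.d. terms
`s • L (π (d i))`. The factor `s` is the origin of `s ^ 2` in the covariance. -/
lemma CoxLaw.tendsto_avgScore_allBatches (h : CoxLaw P τ R lam θ₀) {s : ℕ} (hs : 2 ≤ s)
    (A : Matrix (Fin p) (Fin p) ℝ) :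
    TendstoInDistribution (fun (n : ℕ) d => √(n : ℝ) •
        Matrix.toEuclideanCLM (𝕜 := ℝ) A (avgScore R θ₀ (allBatches s n) d)) atTop id
      (fun _ => iidLaw P) (multivariateGaussian 0
        ((s : ℝ) ^ 2 • (A * gram P (scoreProj P R θ₀ s) * A.transpose))) := by
  have hR := h.radius_nonneg
  set L := Matrix.toEuclideanCLM (𝕜 := ℝ) A with hL
  set π := scoreProj P R θ₀ s with hπ
  have hπm : Measurable π := measurable_scoreProj hR s
  have hπK : ∀ x, ‖π x‖ ≤ p * (2 * R) := norm_scoreProj_le hR s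
  set y : Datum p → EuclideanSpace ℝ (Fin p) := fun x => (s : ℝ) • L (π x) with hy
  have hym : Measurable y := by
    have := (L.continuous.measurable.comp hπm).const_smul (s : ℝ)
    exact this
  have hyK : ∀ x, ‖y x‖ ≤ s * (‖L‖ * (p * (2 * R))) := fun x => by
    rw [hy, norm_smul, Real.norm_of_nonneg (Nat.cast_nonneg s)]
    exact mul_le_mul_of_nonneg_left ((L.le_opNorm _).trans
      (mul_le_mul_of_nonneg_left (hπK x) (norm_nonneg _))) (Nat.cast_nonneg s)
  rw [← gram_smul_toEuclideanCLM hπm hπK (s : ℝ) A]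
  have hev : ∀ i : ℕ, MeasurePreserving (fun d : ℕ → Datum p => d i) (iidLaw P) P :=
    measurePreserving_eval_infinitePi (fun _ : ℕ => P)
  have hyi : ∀ i, Measurable fun d : ℕ → Datum p => y (d i) := fun i =>
    hym.comp (measurable_pi_apply i)
  have hgram : gram (iidLaw P) (fun d => y (d 0)) = gram P y := by
    ext a b
    have hc : ∀ a, Measurable fun x => y x a := fun a =>
      (by fun_prop : Measurable fun v : EuclideanSpace ℝ (Fin p) => v a).comp hym
    exact integral_iidLaw_eval P 0 (f := fun x => y x a * y x b)
      ((hc a).mul (hc b)).aestronglyMeasurable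
  have hmean : ∀ t, ∫ d, ⟪y (d 0), t⟫ ∂(iidLaw P) = 0 := fun t => by
    have h1 : ∀ x, ⟪y x, t⟫ = ∑ a, ((s : ℝ) * (L.adjoint t) a) * π x a := fun x => by
      rw [hy, real_inner_smul_left, ← ContinuousLinearMap.adjoint_inner_right, PiLp.inner_apply,
        Finset.mul_sum]
      refine Finset.sum_congr rfl fun a _ => ?_
      simp only [RCLike.inner_apply, conj_trivial]
      ring
    have hc : ∀ a, Measurable fun x => π x a := fun a =>
      (symmKernel_score hR θ₀ a).measurable_proj
    have h2 : ∀ a, ∫ x, π x a ∂P = 0 := fun a => by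
      have := (symmKernel_score hR θ₀ a).integral_proj (P := P) (s := s) (by omega)
      rw [h.integral_scoreKernel] at this
      exact this
    have h3 : ∀ a, Integrable (fun x => π x a) P := fun a =>
      Integrable.of_bound (hc a).aestronglyMeasurable (2 * R) (Eventually.of_forall
        fun x => (symmKernel_score hR θ₀ a).abs_proj_le x)
    rw [integral_iidLaw_eval P 0 (f := fun x => ⟪y x, t⟫)
      (hym.inner measurable_const).aestronglyMeasurable]
    simp_rw [h1]
    rw [integral_finsetSum _ fun a _ => (h3 a).const_mul _]
    simp [integral_const_mul, h2]
  have hclt := tendstoInDistribution_inv_sqrt_smul_sum (μ := iidLaw P) (Y := fun i d => y (d i))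
    hyi (fun d => hyK _)
    (iIndepFun_infinitePi (P := fun _ : ℕ => P) (X := fun _ => y) fun _ => hym)
    (fun i => ⟨(hyi i).aemeasurable, (hyi 0).aemeasurable, by
      have h1 := Measure.map_map (μ := iidLaw P) hym (hev i).measurable
      have h2 := Measure.map_map (μ := iidLaw P) hym (hev 0).measurable
      rw [(hev i).map_eq] at h1
      rw [(hev 0).map_eq] at h2
      exact h1.symm.trans h2⟩)
    hmean (V := gram P y) (hgram ▸ posSemidef_gram (hyi 0) fun d => hyK _)
    (fun t => by rw [← hgram]; exact integral_inner_sq (hyi 0) (fun d => hyK _) t)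
  refine tendstoInDistribution_of_tendstoInMeasure_sub _ _ hclt ?_ fun n => ?_
  · set X : Fin p → ℕ → (ℕ → Datum p) → ℝ := fun a n d => √(n : ℝ) *
      (uStat (scoreKernel R θ₀ a) s n d - (s / n : ℝ) * ∑ i ∈ Finset.range n, π (d i) a) with hX
    have hX0 : ∀ a, TendstoInMeasure (iidLaw P) (X a) atTop fun _ => 0 := fun a => by
      have hk := symmKernel_score hR θ₀ a
      refine tendstoInMeasure_of_integral_sq (Eventually.of_forall fun n => ?_) ?_
      · have hm : Measurable (X a n) := by
          refine ((hk.measurable_uStat n).sub (Measurable.const_mul ?_ _)).const_mul _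
          exact Finset.measurable_fun_sum _ fun i _ =>
            (hk.measurable_proj (P := P)).comp (measurable_pi_apply i)
        refine SymmKernel.integrable_of_measurable (hm.pow_const 2)
          (L := (√(n : ℝ) * (2 * R + (s / n : ℝ) * (n * (2 * R)))) ^ 2) fun d => ?_
        rw [abs_pow]
        refine pow_le_pow_left₀ (abs_nonneg _) ?_ 2
        rw [hX, abs_mul, abs_of_nonneg (Real.sqrt_nonneg _)]
        refine mul_le_mul_of_nonneg_left ((abs_sub _ _).trans (add_le_add ?_ ?_))
          (Real.sqrt_nonneg _)
        · rw [← avgScore_allBatches]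
          refine (PiLp.norm_apply_le (avgScore R θ₀ (allBatches s n) d) a).trans ?_
          exact norm_one_div_card_smul_sum_le (by positivity) fun B _ =>
            norm_score_le hR (fun i _ => norm_truncate_le hR _) θ₀
        · rw [abs_mul, abs_of_nonneg (by positivity : (0 : ℝ) ≤ s / n)]
          refine mul_le_mul_of_nonneg_left ((Finset.abs_sum_le_sum_abs _ _).trans ?_)
            (by positivity)
          have := Finset.sum_le_sum fun i (_ : i ∈ Finset.range n) =>
            hk.abs_proj_le (P := P) (s := s) (d i)
          simp only [Finset.sum_const, Finset.card_range, nsmul_eq_mul] at this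
          exact this
      -- The projection error has second moment of order `1 / (n * (n - 1))`, and the scaling
      -- multiplies it by `n`.
      · have hb : Tendsto (fun n : ℕ => ((s + 1 : ℝ) * (2 * R)) ^ 2 * (s * s * (s * s)) *
            (1 / ((n : ℝ) - 1))) atTop (𝓝 0) := by
          have h1 : Tendsto (fun n : ℕ => (n : ℝ) - 1) atTop atTop :=
            tendsto_atTop_add_const_right _ _ tendsto_natCast_atTop_atTop
          have := (tendsto_const_nhds (x := (1 : ℝ))).div_atTop h1
          simpa using this.const_mul (((s + 1 : ℝ) * (2 * R)) ^ 2 * (s * s * (s * s)))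
        refine squeeze_zero' (Eventually.of_forall fun n => integral_nonneg fun d => sq_nonneg _)
          ((eventually_ge_atTop s).mono fun n hn => ?_) hb
        have h1 := hk.integral_uStat_sub_proj_sq_le hs (h.integral_scoreKernel a _) hn
        simp only [hX, mul_pow]
        rw [integral_const_mul, Real.sq_sqrt (Nat.cast_nonneg n)]
        have hn2 : (2 : ℝ) ≤ n := by exact_mod_cast hs.trans hn
        refine (mul_le_mul_of_nonneg_left h1 (Nat.cast_nonneg n)).trans (le_of_eq ?_)
        have : (n : ℝ) - 1 ≠ 0 := by linarith
        field_simp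
    have hsum := tendstoInMeasure_sum_zero Finset.univ fun a _ => hX0 a
    rw [tendstoInMeasure_iff_norm] at hsum ⊢
    intro ε hε
    -- One is added because `L` may be zero.
    have hL0 : 0 < ‖L‖ + 1 := by positivity
    refine tendsto_of_tendsto_of_tendsto_of_le_of_le tendsto_const_nhds
      (hsum (ε / (‖L‖ + 1)) (by positivity)) (fun _ => zero_le) fun n => measure_mono fun d hd => ?_
    simp only [Set.mem_ofPred_eq, sub_zero] at hd ⊢
    rw [Real.norm_of_nonneg (Finset.sum_nonneg fun _ _ => abs_nonneg _), div_le_iff₀ hL0]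
    set v : EuclideanSpace ℝ (Fin p) := WithLp.toLp 2 fun a => X a n d with hv
    have hd' : ε ≤ ‖√(n : ℝ) • L (avgScore R θ₀ (allBatches s n) d)
        - (√(n : ℝ))⁻¹ • ∑ i ∈ Finset.range n, y (d i)‖ := by
      simpa using hd
    have heq : √(n : ℝ) • L (avgScore R θ₀ (allBatches s n) d)
        - (√(n : ℝ))⁻¹ • ∑ i ∈ Finset.range n, y (d i) = L v := by
      have h1 : v = √(n : ℝ) • (avgScore R θ₀ (allBatches s n) d
          - (s / n : ℝ) • ∑ i ∈ Finset.range n, π (d i)) := by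
        ext a
        simp only [hv, hX, PiLp.smul_apply, PiLp.sub_apply, smul_eq_mul, WithLp.ofLp_sum,
          Finset.sum_apply, avgScore_allBatches]
      rw [h1, map_smul, map_sub, smul_sub, map_smul, map_sum, smul_smul, hy, ← Finset.smul_sum,
        smul_smul]
      congr 2
      rcases Nat.eq_zero_or_pos n with rfl | hn
      · simp
      · have hn' : (0 : ℝ) < n := by exact_mod_cast hn
        have : √(n : ℝ) ≠ 0 := (Real.sqrt_pos.2 hn').ne'
        field_simp
        rw [Real.sq_sqrt hn'.le]
    rw [heq] at hd'
    calc ε ≤ ‖L‖ * ‖v‖ := hd'.trans (L.le_opNorm v)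
      _ ≤ (‖L‖ + 1) * ∑ a, |X a n d| :=
        mul_le_mul (by linarith) (norm_le_sum_abs v) (norm_nonneg _) hL0.le
      _ = _ := mul_comm _ _
  · have := (L.continuous.measurable.comp
      (measurable_avgScore R θ₀ (allBatches s n))).const_smul √(n : ℝ)
    exact this.aemeasurable

/-- The first `m` blocks. -/
def blocks (s m : ℕ) : Finset (Finset ℕ) := (Finset.range m).image (block s)

lemma injective_block {s : ℕ} (hs : 0 < s) : Function.Injective (block s) := fun b b' h => by
  by_contra hne
  have h1 := disjoint_block (s := s) hne
  rw [← h, Finset.disjoint_self_iff_empty] at h1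
  have h2 := card_block s b
  rw [h1] at h2
  simp at h2
  omega

lemma card_blocks {s : ℕ} (hs : 0 < s) (m : ℕ) : (blocks s m).card = m := by
  rw [blocks, Finset.card_image_of_injective _ (injective_block hs), Finset.card_range]

lemma sum_blocks {s : ℕ} (hs : 0 < s) (m : ℕ) {F : Type*} [AddCommMonoid F]
    (f : Finset ℕ → F) : ∑ B ∈ blocks s m, f B = ∑ b ∈ Finset.range m, f (block s b) :=
  Finset.sum_image fun _ _ _ _ h => injective_block hs h

/-- The block scores are i.i.d., and `√(m * s) / m` equals `√s / √m`. The factor `√s` is absorbed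
into the summands and becomes the `s` of the covariance. -/
lemma CoxLaw.tendsto_avgScore_blocks (h : CoxLaw P τ R lam θ₀) {s : ℕ} (hs : 0 < s)
    (A : Matrix (Fin p) (Fin p) ℝ) :
    TendstoInDistribution (fun (m : ℕ) d => √((m * s : ℕ) : ℝ) •
        Matrix.toEuclideanCLM (𝕜 := ℝ) A (avgScore R θ₀ (blocks s m) d)) atTop id
      (fun _ => iidLaw P) (multivariateGaussian 0 ((s : ℝ) • (A *
        gram (iidLaw P) (fun d => score (Finset.range s) (truncate R ∘ d) θ₀) * A.transpose))) := by
  have hR := h.radius_nonneg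
  set L := Matrix.toEuclideanCLM (𝕜 := ℝ) A with hL
  set g : (ℕ → Datum p) → EuclideanSpace ℝ (Fin p) :=
    fun d => score (Finset.range s) (truncate R ∘ d) θ₀ with hg
  have hgm : Measurable g := (measurable_score θ₀).comp (measurable_truncate_comp R)
  have hgK : ∀ d, ‖g d‖ ≤ 2 * R := fun d =>
    norm_score_le hR (fun i _ => norm_truncate_le hR _) θ₀
  set u : (Fin s → Datum p) → EuclideanSpace ℝ (Fin p) :=
    fun x => √(s : ℝ) • L (score Finset.univ (truncate R ∘ x) θ₀) with hu
  have htr : Measurable fun x : Fin s → Datum p => truncate R ∘ x :=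
    measurable_pi_lambda _ fun i => (measurable_truncate R).comp (measurable_pi_apply i)
  have hum : Measurable u := by
    have := (L.continuous.measurable.comp
      ((measurable_score (B := Finset.univ) θ₀).comp htr)).const_smul √(s : ℝ)
    exact this
  have huK : ∀ x, ‖u x‖ ≤ √(s : ℝ) * (‖L‖ * (2 * R)) := fun x => by
    rw [hu, norm_smul, Real.norm_of_nonneg (Real.sqrt_nonneg _)]
    exact mul_le_mul_of_nonneg_left ((L.le_opNorm _).trans (mul_le_mul_of_nonneg_left
      (norm_score_le hR (fun i _ => norm_truncate_le hR _) θ₀) (norm_nonneg _)))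
      (Real.sqrt_nonneg _)
  have hblock : ∀ b (d : ℕ → Datum p), score (block s b) (truncate R ∘ d) θ₀
      = score Finset.univ (truncate R ∘ blockData s b d) θ₀ := fun b d => by
    rw [block_eq_map, score_map]
    rfl
  have hzero : block s 0 = Finset.range s := by
    ext i; simp [block]
  have hu0 : ∀ d, u (blockData s 0 d) = √(s : ℝ) • L (g d) := fun d => by
    rw [hu]
    simp only
    rw [← hblock, hzero]
  have hsq : √(s : ℝ) ^ 2 = s := Real.sq_sqrt (Nat.cast_nonneg s)
  have hV : (s : ℝ) • (A * gram (iidLaw P) g * A.transpose)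
      = gram (iidLaw P) fun d => u (blockData s 0 d) := by
    rw [← hsq, ← gram_smul_toEuclideanCLM hgm hgK √(s : ℝ) A]
    simp_rw [hu0]
    rfl
  have hmean : ∀ t, ∫ d, ⟪u (blockData s 0 d), t⟫ ∂(iidLaw P) = 0 := fun t => by
    have h1 : ∀ d, ⟪u (blockData s 0 d), t⟫ = ∑ a, (√(s : ℝ) * (L.adjoint t) a) *
        scoreKernel R θ₀ a (Finset.range s) d := fun d => by
      rw [hu0, real_inner_smul_left, ← ContinuousLinearMap.adjoint_inner_right, PiLp.inner_apply,
        Finset.mul_sum]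
      refine Finset.sum_congr rfl fun a _ => ?_
      simp only [RCLike.inner_apply, conj_trivial, scoreKernel, hg]
      ring
    simp_rw [h1]
    rw [integral_finsetSum _ fun a _ => (SymmKernel.integrable_of_measurable
      ((symmKernel_score hR θ₀ a).measurable _) ((symmKernel_score hR θ₀ a).abs_le _)).const_mul _]
    simp [integral_const_mul, h.integral_scoreKernel]
  have hym : ∀ b, Measurable fun d : ℕ → Datum p => u (blockData s b d) := fun b =>
    hum.comp (measurable_blockData s b)
  obtain ⟨hind, hid⟩ := iIndepFun_blockData P s
  rw [hV]
  have hclt := tendstoInDistribution_inv_sqrt_smul_sum (μ := iidLaw P)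
    (Y := fun b d => u (blockData s b d)) hym (fun d => huK _)
    (hind.comp (fun _ => u) fun _ => hum) (fun b => (hid b).comp hum) hmean
    (posSemidef_gram (hym 0) fun d => huK _)
    (fun t => integral_inner_sq (hym 0) (fun d => huK _) t)
  convert hclt using 3 with m d
  rw [avgScore, card_blocks hs, sum_blocks hs, map_smul, map_sum, smul_smul]
  simp only [hu, hblock, ← Finset.smul_sum, smul_smul]
  congr 1
  rcases Nat.eq_zero_or_pos m with rfl | hm
  · simp
  · have hm' : (0 : ℝ) < m := by exact_mod_cast hm
    have : √(m : ℝ) ≠ 0 := (Real.sqrt_pos.2 hm').ne'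
    rw [Nat.cast_mul, Real.sqrt_mul hm'.le]
    field_simp
    rw [Real.sq_sqrt hm'.le]

end Normality

/-! ### Minimizers of averages of mini-batch losses -/

section Estimator

variable {p : ℕ} {P : Measure (Datum p)} [IsProbabilityMeasure P] {τ R : ℝ} {lam : ℝ → ℝ}
  {θ₀ : EuclideanSpace ℝ (Fin p)}

/-- The average of the losses of the mini-batches in `J`. -/
def avgLoss (J : Finset (Finset ℕ)) (d : ℕ → Datum p) (θ : EuclideanSpace ℝ (Fin p)) : ℝ :=
  (1 / (J.card : ℝ)) * ∑ B ∈ J, batchLoss B d θ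

/-- An entry of the average of the truncated Hessians of the mini-batches in `J`. -/
def avgHess (R : ℝ) (θ₀ : EuclideanSpace ℝ (Fin p)) (J : Finset (Finset ℕ)) (a b : Fin p)
    (d : ℕ → Datum p) : ℝ :=
  (1 / (J.card : ℝ)) * ∑ B ∈ J, hessKernel R θ₀ a b B d

lemma measurable_avgHess (hR : 0 ≤ R) (J : Finset (Finset ℕ)) (a b : Fin p) :
    Measurable (avgHess R θ₀ J a b) :=
  (Finset.measurable_fun_sum _ fun B _ => (symmKernel_hess hR θ₀ a b).measurable B).const_mul _

lemma avgHess_allBatches (s n : ℕ) (a b : Fin p) :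
    avgHess R θ₀ (allBatches s n) a b = uStat (hessKernel R θ₀ a b) s n := by
  funext d
  simp only [avgHess, uStat, Finset.card_powersetCard, Finset.card_range]

lemma avgHess_blocks {s : ℕ} (hs : 0 < s) (m : ℕ) (a b : Fin p) :
    avgHess R θ₀ (blocks s m) a b = blockStat (hessKernel R θ₀ a b) s m := by
  funext d
  rw [avgHess, blockStat, card_blocks hs, sum_blocks hs]

lemma abs_avgHess_le (hR : 0 ≤ R) (J : Finset (Finset ℕ)) (a b : Fin p) (d : ℕ → Datum p) :
    |avgHess R θ₀ J a b d| ≤ 2 * R ^ 2 := by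
  have := norm_one_div_card_smul_sum_le (B := J) (f := fun B => hessKernel R θ₀ a b B d)
    (K := 2 * R ^ 2) (by positivity) fun B _ => (symmKernel_hess hR θ₀ a b).abs_le B d
  simpa [avgHess] using this

lemma integrable_avgHess_sub_sq (hR : 0 ≤ R) (J : Finset (Finset ℕ)) (a b : Fin p) (m : ℝ) :
    Integrable (fun d => (avgHess R θ₀ J a b d - m) ^ 2) (iidLaw P) :=
  SymmKernel.integrable_of_measurable (((measurable_avgHess hR J a b).sub_const m).pow_const 2)
    (L := (2 * R ^ 2 + |m|) ^ 2) fun d => by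
      rw [abs_pow]
      exact pow_le_pow_left₀ (abs_nonneg _)
        ((abs_sub _ _).trans (by have := abs_avgHess_le (θ₀ := θ₀) hR J a b d; linarith)) 2

lemma tendsto_avgHess_allBatches (hR : 0 ≤ R) {s : ℕ} (hs : 0 < s) (a b : Fin p) :
    TendstoInMeasure (iidLaw P)
      (fun n d => avgHess R θ₀ (allBatches s n) a b d - meanHess P R θ₀ s a b) atTop
      fun _ => 0 := by
  refine tendstoInMeasure_of_integral_sq (Eventually.of_forall fun n =>
    integrable_avgHess_sub_sq hR _ a b _) ?_
  have hb : Tendsto (fun n : ℕ => (2 * (2 * R ^ 2)) ^ 2 * ((s : ℝ) * (s / n))) atTop (𝓝 0) := by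
    have := ((tendsto_const_div_atTop_nhds_zero_nat (s : ℝ)).const_mul (s : ℝ)).const_mul
      ((2 * (2 * R ^ 2)) ^ 2)
    simpa using this
  refine squeeze_zero' (Eventually.of_forall fun n => integral_nonneg fun d => sq_nonneg _)
    ((eventually_ge_atTop s).mono fun n hn => ?_) hb
  rw [avgHess_allBatches]
  exact (symmKernel_hess hR θ₀ a b).integral_uStat_sub_sq_le hs hn

lemma tendsto_avgHess_blocks (hR : 0 ≤ R) {s : ℕ} (hs : 0 < s) (a b : Fin p) :
    TendstoInMeasure (iidLaw P)
      (fun n d => avgHess R θ₀ (blocks s n) a b d - meanHess P R θ₀ s a b) atTop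
      fun _ => 0 := by
  refine tendstoInMeasure_of_integral_sq (Eventually.of_forall fun n =>
    integrable_avgHess_sub_sq hR _ a b _) ?_
  have hb : Tendsto (fun n : ℕ => (2 * (2 * R ^ 2)) ^ 2 * (1 / (n : ℝ))) atTop (𝓝 0) := by
    have := (tendsto_const_div_atTop_nhds_zero_nat (1 : ℝ)).const_mul ((2 * (2 * R ^ 2)) ^ 2)
    simpa using this
  refine squeeze_zero' (Eventually.of_forall fun n => integral_nonneg fun d => sq_nonneg _)
    ((eventually_gt_atTop 0).mono fun n hn => ?_) hb
  rw [avgHess_blocks hs]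
  exact (symmKernel_hess hR θ₀ a b).integral_blockStat_sub_sq_le hn

/-- The deterministic expansion of a minimizer of the average loss. -/
lemma norm_sub_le_of_isArgmin {J : Finset (Finset ℕ)} {s : ℕ} (hJ : ∀ B ∈ J, B.card = s)
    (hR : 0 ≤ R) {d : ℕ → Datum p} (hd : ∀ i, ‖(d i).1‖ ≤ R) {H : Matrix (Fin p) (Fin p) ℝ}
    {c : ℝ} (hc : 0 < c)
    (hH : ∀ v, c * ‖v‖ ^ 2 ≤ ⟪Matrix.toEuclideanCLM (𝕜 := ℝ) H v, v⟫)
    {Θ : Set (EuclideanSpace ℝ (Fin p))} {r : ℝ} (hΘ : Metric.closedBall θ₀ r ⊆ Θ)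
    (hr : 4 * (s * (6 * R ^ 3)) * r ≤ c) {h : ℝ}
    (hh : ∀ v, ‖Matrix.toEuclideanCLM (𝕜 := ℝ) H v‖ ≤ h * ‖v‖)
    {θ : EuclideanSpace ℝ (Fin p)} (hθ : IsArgmin (avgLoss J d) Θ θ) {η : ℝ}
    (hη : η = ∑ a, ∑ b, |avgHess R θ₀ J a b d - H a b|) (hη2 : 2 * η ≤ c)
    (hW : 4 * (h * ‖Matrix.toEuclideanCLM (𝕜 := ℝ) (-H⁻¹) (avgScore R θ₀ J d)‖) < c * r) :
    ‖θ - θ₀ - Matrix.toEuclideanCLM (𝕜 := ℝ) (-H⁻¹) (avgScore R θ₀ J d)‖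
      ≤ (4 * (s * (6 * R ^ 3)) / c * h *
          ‖Matrix.toEuclideanCLM (𝕜 := ℝ) (-H⁻¹) (avgScore R θ₀ J d)‖ + |η|)
        * (4 / c ^ 2 * h * ‖Matrix.toEuclideanCLM (𝕜 := ℝ) (-H⁻¹) (avgScore R θ₀ J d)‖) := by
  set G := avgScore R θ₀ J d with hG
  set W := Matrix.toEuclideanCLM (𝕜 := ℝ) (-H⁻¹) G with hWdef
  set Hop := Matrix.toEuclideanCLM (𝕜 := ℝ) H with hHop
  have htd : truncate R ∘ d = d := funext fun i => truncate_eq_self (hd i)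
  have hdet := isUnit_det_of_coercive hc hH
  have hHW : Hop W = -G := by
    have h1 : Hop W = Matrix.toEuclideanCLM (𝕜 := ℝ) (H * -H⁻¹) G := by
      rw [map_mul]; rfl
    rw [h1, Matrix.mul_neg, Matrix.mul_nonsing_inv _ hdet, map_neg, map_one]
    rfl
  have hGW : ‖G‖ ≤ h * ‖W‖ := by
    have := hh W
    rwa [hHW, norm_neg] at this
  set C : ℝ := s * (6 * R ^ 3) with hC
  have hC0 : 0 ≤ C := by positivity
  have hexp : ConvexExpansion (avgLoss J d)
      (fun θ => (1 / (J.card : ℝ)) • ∑ B ∈ J, score B d θ)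
      ((1 / (J.card : ℝ)) • ∑ B ∈ J, hessOp B d θ₀) θ₀ C := by
    refine ConvexExpansion.average (by positivity) ?_ hC0 fun B hB => ?_
    -- Only an inequality is required, which also covers an empty `J`.
    · rw [one_div, mul_comm, ← div_eq_mul_inv]
      exact div_self_le_one _
    · rw [hC, ← hJ B hB]
      exact convexExpansion_batchLoss hR (fun i _ => hd i) θ₀
  have hg : (1 / (J.card : ℝ)) • ∑ B ∈ J, score B d θ₀ = G := by
    rw [hG, avgScore, htd]
  have hAH : ∀ v, ‖((1 / (J.card : ℝ)) • ∑ B ∈ J, hessOp B d θ₀) v - Hop v‖ ≤ η * ‖v‖ := by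
    intro v
    have h1 := norm_apply_le_sum_abs_mul ((1 / (J.card : ℝ)) • ∑ B ∈ J, hessOp B d θ₀ - Hop) v
    rw [sub_apply] at h1
    refine h1.trans (le_of_eq ?_)
    rw [hη]
    congr 1
    refine Finset.sum_congr rfl fun a _ => Finset.sum_congr rfl fun b _ => ?_
    congr 1
    rw [sub_apply, PiLp.sub_apply]
    congr 1
    · simp only [avgHess, hessKernel, htd, smul_apply, sum_apply, PiLp.smul_apply, smul_eq_mul,
        WithLp.ofLp_sum, Finset.sum_apply, hessMat, Matrix.of_apply]
    · rw [hHop, Matrix.ofLp_toEuclideanCLM]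
      simp
  have hη0 : 0 ≤ η := hη ▸ Finset.sum_nonneg fun a _ => Finset.sum_nonneg fun b _ => abs_nonneg _
  have hG4 : 4 * ‖(1 / (J.card : ℝ)) • ∑ B ∈ J, score B d θ₀‖ < c * r := by
    rw [hg]
    exact lt_of_le_of_lt (mul_le_mul_of_nonneg_left hGW (by norm_num)) hW
  obtain ⟨hA, hmain⟩ := hexp.expansion_of_isMinOn hAH hη2 hH hc hC0 hη0 hr hG4 hΘ
  -- Only after existence is known does `IsArgmin` say anything about `θ`.
  have hex := hexp.exists_isMinOn hA (half_pos hc) hC0 (by linarith) (by linarith) hΘ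
  have h2 := hmain θ (hθ hex).2
  rw [hg] at h2
  have h3 : G + Hop (θ - θ₀) = Hop (θ - θ₀ - W) := by
    rw [map_sub Hop (θ - θ₀) W, hHW, sub_neg_eq_add, add_comm]
  rw [h3] at h2
  -- Coercivity and Cauchy–Schwarz bound `H` from below, which transfers the estimate from `H (θ -
  -- θ₀ - W)` to `θ - θ₀ - W`.
  have h4 : c * ‖θ - θ₀ - W‖ ≤ ‖Hop (θ - θ₀ - W)‖ := by
    rcases (norm_nonneg (θ - θ₀ - W)).eq_or_lt with h0 | h0
    · rw [← h0, mul_zero]; exact norm_nonneg _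
    · have h5 := (hH (θ - θ₀ - W)).trans (real_inner_le_norm _ _)
      rw [sq, ← mul_assoc] at h5
      exact le_of_mul_le_mul_right h5 h0
  have h6 : ‖θ - θ₀ - W‖ ≤ c⁻¹ * ((4 * C / c * ‖G‖ + η) * (4 / c * ‖G‖)) := by
    rw [le_inv_mul_iff₀ hc]
    exact h4.trans h2
  refine h6.trans ?_
  rw [abs_of_nonneg hη0]
  calc c⁻¹ * ((4 * C / c * ‖G‖ + η) * (4 / c * ‖G‖))
      ≤ c⁻¹ * ((4 * C / c * (h * ‖W‖) + η) * (4 / c * (h * ‖W‖))) := by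
        have hy : 0 ≤ 4 * C / c * (h * ‖W‖) :=
          mul_nonneg (by positivity) ((norm_nonneg _).trans hGW)
        refine mul_le_mul_of_nonneg_left (mul_le_mul ?_ ?_ (by positivity)
          (add_nonneg hy hη0)) (by positivity)
        · exact add_le_add (mul_le_mul_of_nonneg_left hGW (by positivity)) le_rfl
        · exact mul_le_mul_of_nonneg_left hGW (by positivity)
    _ = _ := by field_simp

/-- Asymptotic normality of the minimizers of averages of mini-batch losses. -/
theorem CoxLaw.tendstoInDistribution_argmin (hP : CoxLaw P τ R lam θ₀) {s : ℕ} (hs : 2 ≤ s)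
    {J : ℕ → Finset (Finset ℕ)} (hJ : ∀ n, ∀ B ∈ J n, B.card = s) {a : ℕ → ℝ}
    (ha0 : ∀ n, 0 ≤ a n) (ha : Tendsto a atTop atTop) {V : Matrix (Fin p) (Fin p) ℝ}
    (hscore : TendstoInDistribution (fun n d => a n • Matrix.toEuclideanCLM (𝕜 := ℝ)
      (-(meanHess P R θ₀ s)⁻¹) (avgScore R θ₀ (J n) d)) atTop id (fun _ => iidLaw P)
      (multivariateGaussian 0 V))
    (hhess : ∀ i j, TendstoInMeasure (iidLaw P)
      (fun n d => avgHess R θ₀ (J n) i j d - meanHess P R θ₀ s i j) atTop fun _ => 0)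
    {Ω : Type*} [MeasurableSpace Ω] {μ : Measure Ω} [IsProbabilityMeasure μ]
    {d : ℕ → Ω → ℕ → Datum p} (hd : ∀ n, AEMeasurable (d n) μ)
    (hdP : ∀ n, μ.map (d n) = iidLaw P) {Θ : Set (EuclideanSpace ℝ (Fin p))} {r : ℝ} (hr : 0 < r)
    (hΘ : Metric.closedBall θ₀ r ⊆ Θ) {θ : ℕ → Ω → EuclideanSpace ℝ (Fin p)}
    (hθm : ∀ n, AEMeasurable (θ n) μ)
    (hθ : ∀ n, ∀ᵐ ω ∂μ, IsArgmin (avgLoss (J n) (d n ω)) Θ (θ n ω)) :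
    TendstoInDistribution (fun n ω => a n • (θ n ω - θ₀)) atTop id (fun _ => μ)
      (multivariateGaussian 0 V) := by
  have hR := hP.radius_nonneg
  obtain ⟨c, hc, hH⟩ := hP.exists_coercive_meanHess hs
  set H := meanHess P R θ₀ s with hHdef
  set h : ℝ := ‖Matrix.toEuclideanCLM (𝕜 := ℝ) H‖ with hh
  set C : ℝ := s * (6 * R ^ 3) with hC
  have hC0 : 0 ≤ C := by positivity
  have hh0 : 0 ≤ h := norm_nonneg _
  -- The radius must keep the ball inside `Θ` and the Taylor remainder below the curvature; one is
  -- added since `C` may be zero.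
  set r' := min r (c / (4 * C + 1)) with hr'
  have hr'0 : 0 < r' := lt_min hr (by positivity)
  have hr'c : 4 * C * r' ≤ c := by
    have h1 : r' ≤ c / (4 * C + 1) := min_le_right _ _
    rw [le_div_iff₀ (by positivity)] at h1
    linarith
  have hΘ' : Metric.closedBall θ₀ r' ⊆ Θ :=
    (Metric.closedBall_subset_closedBall (min_le_left _ _)).trans hΘ
  -- The data may be reordered anew for each `n`, but convergence in distribution sees only their
  -- law, which stays the same.
  have hW := tendstoInDistribution_comp_of_map_eq hd hdP (fun n => by
    have := ((Matrix.toEuclideanCLM (𝕜 := ℝ) (-H⁻¹)).continuous.measurable.comp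
      (measurable_avgScore R θ₀ (J n))).const_smul (a n)
    exact this) hscore
  have hη : TendstoInMeasure μ
      (fun n ω => ∑ i, ∑ j, |avgHess R θ₀ (J n) i j (d n ω) - H i j|) atTop fun _ => 0 := by
    have h1 : ∀ i j, TendstoInMeasure μ
        (fun n ω => avgHess R θ₀ (J n) i j (d n ω) - H i j) atTop fun _ => 0 := fun i j => by
      have h2 := hhess i j
      rw [tendstoInMeasure_iff_norm] at h2 ⊢
      intro ε hε
      refine (h2 ε hε).congr fun n => ?_
      have hm : MeasurableSet {x : ℕ → Datum p | ε ≤ ‖avgHess R θ₀ (J n) i j x - H i j - 0‖} :=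
        measurableSet_le measurable_const
          ((((measurable_avgHess hR (J n) i j).sub_const _).sub_const 0).norm)
      rw [← hdP n, Measure.map_apply_of_aemeasurable (hd n) hm]
      rfl
    have h3 := tendstoInMeasure_sum_zero (Finset.univ : Finset (Fin p × Fin p))
      fun q _ => h1 q.1 q.2
    simpa only [Fintype.sum_prod_type] using h3
  have hnorm : ∀ n, ∀ᵐ ω ∂μ, ∀ i, ‖(d n ω i).1‖ ≤ R := fun n => by
    have hmeas : MeasurableSet {x : ℕ → Datum p | ∀ i, ‖(x i).1‖ ≤ R} := by
      have : {x : ℕ → Datum p | ∀ i, ‖(x i).1‖ ≤ R} = ⋂ i, {x | ‖(x i).1‖ ≤ R} := by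
        ext; simp
      rw [this]
      exact MeasurableSet.iInter fun i => measurableSet_le
        (by fun_prop : Measurable fun x : ℕ → Datum p => (x i).1).norm measurable_const
    have h1 : ∀ᵐ x ∂(iidLaw P), ∀ i : ℕ, ‖(x i).1‖ ≤ R := by
      rw [ae_all_iff]
      intro i
      exact (measurePreserving_eval_infinitePi (fun _ : ℕ => P) i).quasiMeasurePreserving.ae
        hP.norm_le
    rw [← hdP n] at h1
    exact (ae_map_iff (hd n) hmeas).1 h1
  -- The threshold `c₁` ensures `2 * η ≤ c`, and `c₂` ensures that the gradient `-H W` is small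
  -- compared with `c * r'`.
  refine tendstoInDistribution_of_expansion ha0 ha (fun n => (hθm n).sub_const θ₀) hW hη
    (c₁ := c / 2) (c₂ := c * r' / (4 * (h + 1))) (k₁ := 4 * C / c * h) (k₂ := 4 / c ^ 2 * h)
    (by positivity) (by positivity) (by positivity) (by positivity) fun n => ?_
  filter_upwards [hθ n, hnorm n] with ω hω hωR hη1 hW1
  refine norm_sub_le_of_isArgmin (hJ n) hR hωR hc hH hΘ' hr'c
    (fun v => ContinuousLinearMap.le_opNorm _ v) hω rfl (by linarith) ?_
  rw [lt_div_iff₀ (by positivity)] at hW1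
  have := norm_nonneg
    (Matrix.toEuclideanCLM (𝕜 := ℝ) (-H⁻¹) (avgScore R θ₀ (J n) (d n ω)))
  nlinarith

end Estimator

/-! ### Random splits into mini-batches -/

section Split

/-- The observation that takes place `i` when the batches of a split are put one after another. -/
def splitIndex {s m : ℕ} (σ : Fin m → Fin s → ℕ) (i : ℕ) : ℕ :=
  if h : i < m * s then
    σ ⟨i / s, Nat.div_lt_of_lt_mul (mul_comm m s ▸ h)⟩
      ⟨i % s, Nat.mod_lt i (Nat.pos_of_ne_zero (by rintro rfl; simp at h))⟩
  else i

lemma splitIndex_mul_add {s m : ℕ} (σ : Fin m → Fin s → ℕ) (b : Fin m) (k : Fin s) :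
    splitIndex σ (b * s + k) = σ b k := by
  have hs : 0 < s := k.pos
  have h : (b : ℕ) * s + k < m * s := by
    calc (b : ℕ) * s + k < b * s + s := Nat.add_lt_add_left k.2 _
      _ = (b + 1) * s := by ring
      _ ≤ m * s := Nat.mul_le_mul_right s b.2
  have hdiv : ((b : ℕ) * s + k) / s = b := by
    rw [mul_comm, Nat.mul_add_div hs, Nat.div_eq_of_lt k.2, add_zero]
  have hmod : ((b : ℕ) * s + k) % s = k := by
    rw [mul_comm, Nat.mul_add_mod, Nat.mod_eq_of_lt k.2]
  rw [splitIndex, dif_pos h]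
  simp only [hdiv, hmod]

/-- Below `m * s` the split is injective with values below `m * s`; beyond, the index is left
unchanged, so no collision can occur. -/
lemma IsSplit.injective_splitIndex {s m : ℕ} {σ : Fin m → Fin s → ℕ} (h : IsSplit s m σ) :
    Function.Injective (splitIndex σ) := by
  have hm : ∀ b k, σ b k < m * s := fun b k => h.mapsTo (mem_univ (b, k))
  intro i j hij
  unfold splitIndex at hij
  split_ifs at hij with hi hj hj
  · have := h.injOn (mem_univ (_, _)) (mem_univ (_, _)) hij
    simp only [Prod.mk.injEq, Fin.mk.injEq] at this
    rw [← Nat.div_add_mod i s, ← Nat.div_add_mod j s, this.1, this.2]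
  · exact absurd (hij ▸ hm _ _) hj
  · exact absurd (hij.symm ▸ hm _ _) hi
  · exact hij

variable {β : Type*} [MeasurableSpace β] {P : Measure β} [IsProbabilityMeasure P]
  {Ω : Type*} [MeasurableSpace Ω] {μ : Measure Ω} [IsProbabilityMeasure μ]

/-- Reindexing an i.i.d. sequence by an independent random injection does not change its law. -/
lemma map_reindex_eq_iidLaw {κ : Type*} [MeasurableSpace κ] [MeasurableSingletonClass κ]
    [Countable κ] {σ : Ω → κ} (hσ : Measurable σ) {d : Ω → ℕ → β} (hd : Measurable d)
    (hdP : μ.map d = iidLaw P) (hind : IndepFun σ d μ) {π : κ → ℕ → ℕ}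
    (hπ : ∀ᵐ ω ∂μ, Function.Injective (π (σ ω))) :
    Measurable (fun ω i => d ω (π (σ ω) i)) ∧
      μ.map (fun ω i => d ω (π (σ ω) i)) = iidLaw P := by
  have hΦ : Measurable fun q : κ × (ℕ → β) => fun i => q.2 (π q.1 i) :=
    measurable_from_prod_countable_right fun k => measurable_pi_lambda _ fun i =>
      (measurable_pi_apply (π k i) : Measurable fun d : ℕ → β => d (π k i))
  have hpair : Measurable fun ω => (σ ω, d ω) := hσ.prodMk hd
  refine ⟨hΦ.comp hpair, ?_⟩
  have h1 := (indepFun_iff_map_prod_eq_prod_map_map hσ.aemeasurable hd.aemeasurable).1 hind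
  have h2 := Measure.map_map (μ := μ) hΦ hpair
  rw [h1, hdP] at h2
  change μ.map ((fun q : κ × (ℕ → β) => fun i => q.2 (π q.1 i)) ∘ fun ω => (σ ω, d ω)) = _
  rw [← h2]
  have hp := Measure.isProbabilityMeasure_map (μ := μ) hσ.aemeasurable
  have hπ' : ∀ᵐ k ∂(μ.map σ), Function.Injective (π k) :=
    (ae_map_iff hσ.aemeasurable (Set.to_countable _).measurableSet).2 hπ
  ext A hA
  rw [Measure.map_apply hΦ hA, Measure.prod_apply (hΦ hA)]
  -- For a fixed value of the index, the reindexing is a deterministic injection, which preserves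
  -- the i.i.d. law.
  have h3 : ∀ᵐ k ∂(μ.map σ), iidLaw P (Prod.mk k ⁻¹'
      ((fun q : κ × (ℕ → β) => fun i => q.2 (π q.1 i)) ⁻¹' A)) = iidLaw P A := by
    filter_upwards [hπ'] with k hk
    have h4 := Measure.map_infinitePi_infinitePi_of_inj (P := fun _ : ℕ => P) hk
    have h5 : Measurable fun (d : ℕ → β) i => d (π k i) :=
      measurable_pi_lambda _ fun i => measurable_pi_apply _
    have h6 := Measure.map_apply (μ := iidLaw P) h5 hA
    rw [h4] at h6
    exact h6.symm
  rw [lintegral_congr_ae h3, lintegral_const, measure_univ, mul_one]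

end Split

/-! ### The objectives and matrices of the two procedures -/

section Objectives

variable {p : ℕ}

lemma sbObjective_eq (s n : ℕ) (d : ℕ → Datum p) :
    sbObjective s n d = avgLoss (allBatches s n) d := by
  funext θ
  rw [sbObjective, avgLoss, Finset.card_powersetCard, Finset.card_range]

/-- Reordering the data along the split turns its batches into consecutive blocks, so the split
disappears from the objective. -/
lemma fbObjective_eq {s : ℕ} (hs : 0 < s) (m : ℕ) (σ : Fin m → Fin s → ℕ) (d : ℕ → Datum p) :
    fbObjective s m σ d = avgLoss (blocks s m) fun i => d (splitIndex σ i) := by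
  funext θ
  rw [fbObjective, avgLoss, card_blocks hs, sum_blocks hs, Finset.sum_range]
  congr 1
  refine Finset.sum_congr rfl fun b _ => ?_
  rw [block_eq_map, batchLoss_map]
  congr 1
  funext k
  simp [splitIndex_mul_add]

variable {Ω : Type*} [MeasurableSpace Ω] {μ : Measure Ω} [IsProbabilityMeasure μ]
  {P : Measure (Datum p)} [IsProbabilityMeasure P] {τ R : ℝ} {lam : ℝ → ℝ}
  {θ₀ : EuclideanSpace ℝ (Fin p)} {D : ℕ → Ω → Datum p}

/-- The observations are i.i.d. with law `P`. -/
structure IsSample (μ : Measure Ω) (P : Measure (Datum p)) [IsProbabilityMeasure P]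
    (D : ℕ → Ω → Datum p) : Prop where
  measurable : Measurable fun ω i => D i ω
  map_eq : μ.map (fun ω i => D i ω) = iidLaw P

lemma IsSample.integral_comp (h : IsSample μ P D) {f : (ℕ → Datum p) → ℝ} (hf : Measurable f) :
    ∫ ω, f (fun i => D i ω) ∂μ = ∫ d, f d ∂(iidLaw P) := by
  rw [← h.map_eq, integral_map h.measurable.aemeasurable hf.aestronglyMeasurable]

lemma IsSample.ae_truncate (h : IsSample μ P D) (hP : CoxLaw P τ R lam θ₀) :
    ∀ᵐ ω ∂μ, (truncate R ∘ fun i => D i ω) = fun i => D i ω := by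
  have h1 : ∀ᵐ d ∂(iidLaw P), ∀ i : ℕ, ‖(d i).1‖ ≤ R := by
    rw [ae_all_iff]
    intro i
    exact (measurePreserving_eval_infinitePi (fun _ : ℕ => P) i).quasiMeasurePreserving.ae
      hP.norm_le
  rw [← h.map_eq] at h1
  filter_upwards [ae_of_ae_map h.measurable.aemeasurable h1] with ω hω
  exact funext fun i => truncate_eq_self (hω i)

lemma IsSample.batchGrad_ae_eq (h : IsSample μ P D) (hP : CoxLaw P τ R lam θ₀) (A : Finset ℕ)
    (a : Fin p) : (fun ω => batchGrad A (fun k => D k ω) θ₀ a)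
      =ᵐ[μ] fun ω => scoreKernel R θ₀ a A fun i => D i ω := by
  filter_upwards [h.ae_truncate hP] with ω hω
  rw [scoreKernel, hω, batchGrad_eq]

lemma IsSample.batchHess_ae_eq (h : IsSample μ P D) (hP : CoxLaw P τ R lam θ₀) (A : Finset ℕ)
    (a b : Fin p) : (fun ω => batchHess A (fun k => D k ω) θ₀ a b)
      =ᵐ[μ] fun ω => hessKernel R θ₀ a b A fun i => D i ω := by
  filter_upwards [h.ae_truncate hP] with ω hω
  rw [hessKernel, hω, batchHess_eq]

lemma IsSample.memLp_batchGrad (h : IsSample μ P D) (hP : CoxLaw P τ R lam θ₀) (A : Finset ℕ)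
    (a : Fin p) : MemLp (fun ω => batchGrad A (fun k => D k ω) θ₀ a) 2 μ := by
  have hk := symmKernel_score hP.radius_nonneg θ₀ a
  refine (memLp_congr_ae (h.batchGrad_ae_eq hP A a)).2 ?_
  exact MemLp.of_bound ((hk.measurable A).comp h.measurable).aestronglyMeasurable (2 * R)
    (Eventually.of_forall fun ω => hk.abs_le A _)

lemma IsSample.integrable_batchHess (h : IsSample μ P D) (hP : CoxLaw P τ R lam θ₀)
    (A : Finset ℕ) (a b : Fin p) :
    Integrable (fun ω => batchHess A (fun k => D k ω) θ₀ a b) μ := by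
  have hk := symmKernel_hess hP.radius_nonneg θ₀ a b
  refine (integrable_congr (h.batchHess_ae_eq hP A a b)).2 ?_
  exact Integrable.of_bound ((hk.measurable A).comp h.measurable).aestronglyMeasurable (2 * R ^ 2)
    (Eventually.of_forall fun ω => hk.abs_le A _)

lemma IsSample.hessMatrix_eq (h : IsSample μ P D) (hP : CoxLaw P τ R lam θ₀) (s : ℕ) :
    hessMatrix μ D s θ₀ = meanHess P R θ₀ s := by
  ext a b
  simp only [hessMatrix, meanHess, Matrix.of_apply]
  rw [integral_congr_ae (h.batchHess_ae_eq hP _ a b)]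
  exact h.integral_comp ((symmKernel_hess hP.radius_nonneg θ₀ a b).measurable _)

lemma IsSample.gradCov_apply (h : IsSample μ P D) (hP : CoxLaw P τ R lam θ₀) (A B : Finset ℕ)
    (a b : Fin p) : gradCov μ D A B θ₀ a b
      = ∫ d, scoreKernel R θ₀ a A d * scoreKernel R θ₀ b B d ∂(iidLaw P) := by
  have hk := fun a => symmKernel_score hP.radius_nonneg θ₀ a
  have hmean : ∀ A a, ∫ ω, batchGrad A (fun k => D k ω) θ₀ a ∂μ = 0 := fun A a => by
    rw [integral_congr_ae (h.batchGrad_ae_eq hP A a), h.integral_comp ((hk a).measurable A),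
      hP.integral_scoreKernel]
  simp only [gradCov, Matrix.of_apply, covariance, hmean, sub_zero]
  have hm : Measurable fun d => scoreKernel R θ₀ a A d * scoreKernel R θ₀ b B d :=
    ((hk a).measurable A).mul ((hk b).measurable B)
  rw [← h.integral_comp hm]
  refine integral_congr_ae ?_
  filter_upwards [h.batchGrad_ae_eq hP A a, h.batchGrad_ae_eq hP B b] with ω h1 h2
  rw [h1, h2]

lemma IsSample.sigmaS_eq (h : IsSample μ P D) (hP : CoxLaw P τ R lam θ₀) (s : ℕ) :
    sigmaS μ D s θ₀
      = gram (iidLaw P) fun d => score (Finset.range s) (truncate R ∘ d) θ₀ := by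
  ext a b
  exact h.gradCov_apply hP _ _ a b

/-- Given the common observation, the two scores are independent with the same conditional mean
`scoreProj`, so their covariance is the second moment of this mean. -/
lemma IsSample.sigmaS1_eq (h : IsSample μ P D) (hP : CoxLaw P τ R lam θ₀) {s : ℕ} (hs : 2 ≤ s) :
    sigmaS1 μ D s θ₀ = gram P (scoreProj P R θ₀ s) := by
  ext a b
  rw [sigmaS1, h.gradCov_apply hP]
  have hk := fun a => symmKernel_score hP.radius_nonneg θ₀ a
  have hcard : (batch₂ s).card = s := by
    rw [batch₂, Finset.card_insert_of_notMem (by simp; omega), Nat.card_Ico]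
    omega
  have hinter : batch₁ s ∩ batch₂ s = {0} := by
    ext i
    simp only [batch₁, batch₂, Finset.mem_inter, Finset.mem_range, Finset.mem_insert,
      Finset.mem_Ico, Finset.mem_singleton]
    omega
  have hinter' : ({0} : Finset ℕ) ∩ batch₁ s = {0} := by
    ext i
    simp only [batch₁, Finset.mem_inter, Finset.mem_range, Finset.mem_singleton]
    omega
  -- Conditioning on the first batch replaces the second score by its projection at observation `0`.
  rw [(hk b).integral_mul_of_inter_singleton hcard hinter ((hk a).measurable _) ((hk a).abs_le _)
    ((hk a).congr _)]
  have hπ : ∀ c, Measurable (proj P (scoreKernel R θ₀ c) s) := fun c => (hk c).measurable_proj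
  -- Conditioning on observation `0` alone now replaces the first score by its projection.
  have h1 := (hk a).integral_mul_of_inter_singleton (P := P) (s := s) (B := batch₁ s)
    (by simp [batch₁]) hinter' (f := fun d => proj P (scoreKernel R θ₀ b) s (d 0))
    ((hπ b).comp (measurable_pi_apply 0)) (fun d => (hk b).abs_proj_le (d 0))
    (fun d d' hd => by rw [hd 0 (Finset.mem_singleton_self 0)])
  simp only [mul_comm (proj P (scoreKernel R θ₀ b) s _)] at h1
  rw [h1, integral_iidLaw_eval P 0 (f := fun x => proj P (scoreKernel R θ₀ a) s x *
    proj P (scoreKernel R θ₀ b) s x) ((hπ a).mul (hπ b)).aestronglyMeasurable]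
  rfl

lemma posSemidef_smul_mul_mul_transpose {c : ℝ} (hc : 0 ≤ c) {S : Matrix (Fin p) (Fin p) ℝ}
    (hS : S.PosSemidef) (A : Matrix (Fin p) (Fin p) ℝ) :
    (c • (A * S * A.transpose)).PosSemidef := by
  rw [← Matrix.conjTranspose_eq_transpose_of_trivial]
  exact (hS.mul_mul_conjTranspose_same A).smul hc

lemma boundedInProbability_of_tendstoInDistribution {Z : ℕ → Ω → EuclideanSpace ℝ (Fin p)}
    {ρ : Measure (EuclideanSpace ℝ (Fin p))} [IsProbabilityMeasure ρ]
    (h : TendstoInDistribution Z atTop id (fun _ => μ) ρ) : BoundedInProbability μ Z :=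
  fun _ hε => let ⟨K, _, hK⟩ := exists_measure_norm_gt_le h hε; ⟨K, hK⟩

end Objectives

end CoxSGD

end

/-! ### The limit theorem for both estimators. -/

theorem theorem3 {Ω : Type*} [MeasurableSpace Ω] (μ : Measure Ω) [IsProbabilityMeasure μ]
    -- dimension, batch size, end of study, radius of the parameter ball
    (p s : ℕ) (hs : 2 ≤ s) (τ M : ℝ) (hτ : 0 < τ)
    -- covariates, true failure times, true censoring times; the observations are i.i.d.
    (X : ℕ → Ω → EuclideanSpace ℝ (Fin p)) (Tst Cst : ℕ → Ω → ℝ≥0∞)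
    (hX : ∀ i, Measurable (X i)) (hT : ∀ i, Measurable (Tst i)) (hC : ∀ i, Measurable (Cst i))
    (D : ℕ → Ω → Datum p) (hD : ∀ i, D i = observe (X i) (Tst i) (Cst i))
    (hindep : iIndepFun D μ) (hident : ∀ i, IdentDistrib (D i) (D 0) μ μ)
    -- Cox regression model with true parameter in the ball of radius `M`
    (lam : ℝ → ℝ) (θ₀ : EuclideanSpace ℝ (Fin p)) (hθ₀ : ‖θ₀‖ < M)
    (hcox : ∀ i, CoxModel μ τ lam θ₀ (X i) (Tst i))
    -- conditionally independent censoring, end of study, covariates on the cube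
    (hA1 : ∀ i, CondIndepGiven μ (X i) (Tst i) (Cst i))
    (δ : ℝ) (hδ : 0 < δ) (hA2 : ∀ i, StudyEnd μ τ δ (X i) (Tst i) (Cst i))
    (hA3 : ∀ i, CovariateDensity μ (X i))
    -- the subdensities: two-sided bounds for `Δ = 1`, smoothness for both values of `Δ`
    (q : Bool → EuclideanSpace ℝ (Fin p) × ℝ → ℝ) (hq : ∀ a, IsSubdensity μ τ (D 0) a (q a))
    (c₁ c₂ : ℝ) (hc₁ : 0 < c₁) (hR2 : ∀ z ∈ box p τ, c₁ < q true z ∧ q true z < c₂)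
    (k : ℕ) (hk : 2 ≤ k) (hR3 : ∀ a, HasBoundedPartials k (box p τ) (q a))
    -- the stochastic-batch estimator
    (θSB : ℕ → Ω → EuclideanSpace ℝ (Fin p)) (hSBm : ∀ n, AEMeasurable (θSB n) μ)
    (hSB : ∀ n, ∀ᵐ ω ∂μ,
      IsArgmin (sbObjective s n fun i => D i ω) (Metric.closedBall 0 M) (θSB n ω))
    -- for each `m`, a split of `n = m * s` observations into `m` batches, made without looking
    -- at the data, and the fixed-batch estimator (over the whole space or over the ball)
    (σ : (m : ℕ) → Ω → Fin m → Fin s → ℕ) (hσm : ∀ m, Measurable (σ m))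
    (hσ : ∀ m, ∀ᵐ ω ∂μ, IsSplit s m (σ m ω))
    (hσD : ∀ m, IndepFun (σ m) (fun ω i => D i ω) μ)
    (Θ : Set (EuclideanSpace ℝ (Fin p))) (hΘ : Θ = univ ∨ Θ = Metric.closedBall 0 M)
    (θFB : ℕ → Ω → EuclideanSpace ℝ (Fin p)) (hFBm : ∀ m, AEMeasurable (θFB m) μ)
    (hFB : ∀ m, ∀ᵐ ω ∂μ, IsArgmin (fbObjective s m (σ m ω) fun i => D i ω) Θ (θFB m ω)) :
    -- the matrices are well defined
    ((∀ i j, Integrable (fun ω => batchHess (batch₁ s) (fun k => D k ω) θ₀ i j) μ) ∧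
      (∀ i, MemLp (fun ω => batchGrad (batch₁ s) (fun k => D k ω) θ₀ i) 2 μ) ∧
      (∀ i, MemLp (fun ω => batchGrad (batch₂ s) (fun k => D k ω) θ₀ i) 2 μ) ∧
      IsUnit (hessMatrix μ D s θ₀).det ∧
      (sbVariance μ D s θ₀).PosSemidef ∧ (fbVariance μ D s θ₀).PosSemidef) ∧
    -- stochastic batches
    (BoundedInProbability μ (fun n ω => √(n : ℝ) • (θSB n ω - θ₀)) ∧
      TendstoInDistribution (fun (n : ℕ) ω => √(n : ℝ) • (θSB n ω - θ₀)) atTop id (fun _ => μ)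
        (multivariateGaussian 0 (sbVariance μ D s θ₀))) ∧
    -- fixed batches
    (BoundedInProbability μ (fun m ω => √((m * s : ℕ) : ℝ) • (θFB m ω - θ₀)) ∧
      TendstoInDistribution (fun (m : ℕ) ω => √((m * s : ℕ) : ℝ) • (θFB m ω - θ₀)) atTop id
        (fun _ => μ) (multivariateGaussian 0 (fbVariance μ D s θ₀))) := by
  have hs0 : 0 < s := by omega
  have hDm : ∀ i, Measurable (D i) := fun i => hD i ▸ measurable_observe (hX i) (hT i) (hC i)
  -- The observations are identically distributed, so the model of subject `0` determines the common
  -- law.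
  obtain ⟨lam', hlaw⟩ := (hcox 0).exists_coxLaw hτ (hX 0) (hT 0) (hC 0) (hA1 0) hδ (hA2 0) (hA3 0)
  rw [← hD 0] at hlaw
  have hprob : IsProbabilityMeasure (μ.map (D 0)) :=
    Measure.isProbabilityMeasure_map (hDm 0).aemeasurable
  set P := μ.map (D 0) with hP
  set R := √(p : ℝ) with hR
  have hsample : IsSample μ P D := by
    refine ⟨measurable_pi_lambda _ hDm, ?_⟩
    rw [hindep.map_fun_eq_infinitePi_map hDm]
    simp only [(hident _).map_eq]
    rfl
  have hH := hsample.hessMatrix_eq hlaw s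
  obtain ⟨c, hc, hcoer⟩ := hlaw.exists_coercive_meanHess hs
  have hball : Metric.closedBall θ₀ (M - ‖θ₀‖) ⊆ Metric.closedBall 0 M := by
    refine Metric.closedBall_subset_closedBall' ?_
    rw [dist_zero_right]
    linarith
  have hM : 0 < M - ‖θ₀‖ := sub_pos.2 hθ₀
  -- The linear statistic is `-H⁻¹ G`; its sign cancels in the covariance.
  have hSB_var : sbVariance μ D s θ₀ = (s : ℝ) ^ 2 • (-(meanHess P R θ₀ s)⁻¹ *
      gram P (scoreProj P R θ₀ s) * (-(meanHess P R θ₀ s)⁻¹).transpose) := by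
    rw [sbVariance, hH, hsample.sigmaS1_eq hlaw hs, Matrix.transpose_neg, Matrix.neg_mul,
      Matrix.neg_mul, Matrix.mul_neg, neg_neg]
  have hFB_var : fbVariance μ D s θ₀ = (s : ℝ) • (-(meanHess P R θ₀ s)⁻¹ *
      gram (iidLaw P) (fun d => score (Finset.range s) (truncate R ∘ d) θ₀) *
      (-(meanHess P R θ₀ s)⁻¹).transpose) := by
    rw [fbVariance, hH, hsample.sigmaS_eq hlaw, Matrix.transpose_neg, Matrix.neg_mul,
      Matrix.neg_mul, Matrix.mul_neg, neg_neg]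
  have hSB_lim : TendstoInDistribution (fun (n : ℕ) ω => √(n : ℝ) • (θSB n ω - θ₀)) atTop id
      (fun _ => μ) (multivariateGaussian 0 (sbVariance μ D s θ₀)) := by
    rw [hSB_var]
    refine hlaw.tendstoInDistribution_argmin hs (J := allBatches s)
      (fun n B hB => (Finset.mem_powersetCard.1 hB).2) (fun n => Real.sqrt_nonneg _)
      (Real.tendsto_sqrt_atTop.comp tendsto_natCast_atTop_atTop)
      (hlaw.tendsto_avgScore_allBatches hs _)
      (tendsto_avgHess_allBatches hlaw.radius_nonneg hs0)
      (d := fun _ ω i => D i ω) (fun _ => hsample.measurable.aemeasurable)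
      (fun _ => hsample.map_eq) hM hball hSBm fun n => ?_
    filter_upwards [hSB n] with ω hω
    rwa [sbObjective_eq] at hω
  have hFB_lim : TendstoInDistribution (fun (m : ℕ) ω => √((m * s : ℕ) : ℝ) • (θFB m ω - θ₀))
      atTop id (fun _ => μ) (multivariateGaussian 0 (fbVariance μ D s θ₀)) := by
    rw [hFB_var]
    -- The split is independent of the data, so for each `m` the reordered data are again i.i.d.
    -- with the same law.
    have hre := fun m => map_reindex_eq_iidLaw (hσm m) hsample.measurable hsample.map_eq (hσD m)
      (π := splitIndex) ((hσ m).mono fun ω hω => hω.injective_splitIndex)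
    refine hlaw.tendstoInDistribution_argmin hs (J := blocks s)
      (fun m B hB => ?_) (fun m => Real.sqrt_nonneg _)
      (Real.tendsto_sqrt_atTop.comp (tendsto_natCast_atTop_atTop.comp
        (tendsto_id.atTop_mul_const' hs0)))
      (hlaw.tendsto_avgScore_blocks hs0 _)
      (tendsto_avgHess_blocks hlaw.radius_nonneg hs0)
      (d := fun m ω i => D (splitIndex (σ m ω) i) ω) (fun m => (hre m).1.aemeasurable)
      (fun m => (hre m).2) hM (Θ := Θ) ?_ hFBm fun m => ?_
    · obtain ⟨b, -, rfl⟩ := Finset.mem_image.1 hB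
      exact card_block s b
    · rcases hΘ with rfl | rfl
      · exact subset_univ _
      · exact hball
    · filter_upwards [hFB m] with ω hω
      rwa [fbObjective_eq hs0] at hω
  have hgS : Measurable fun d : ℕ → Datum p => score (Finset.range s) (truncate R ∘ d) θ₀ :=
    (measurable_score θ₀).comp (measurable_truncate_comp R)
  refine ⟨⟨fun i j => hsample.integrable_batchHess hlaw _ i j,
    fun i => hsample.memLp_batchGrad hlaw _ i, fun i => hsample.memLp_batchGrad hlaw _ i,
    hH ▸ isUnit_det_of_coercive hc hcoer, ?_, ?_⟩,
    ⟨boundedInProbability_of_tendstoInDistribution hSB_lim, hSB_lim⟩,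
    ⟨boundedInProbability_of_tendstoInDistribution hFB_lim, hFB_lim⟩⟩
  · rw [hSB_var]
    exact posSemidef_smul_mul_mul_transpose (sq_nonneg _)
      (posSemidef_gram (measurable_scoreProj hlaw.radius_nonneg s)
        (norm_scoreProj_le hlaw.radius_nonneg s)) _
  · rw [hFB_var]
    exact posSemidef_smul_mul_mul_transpose (Nat.cast_nonneg s)
      (posSemidef_gram hgS fun d =>
        norm_score_le hlaw.radius_nonneg (fun i _ => norm_truncate_le hlaw.radius_nonneg _) θ₀) _
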